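/- **Model.** Fix $p\ge 0$. For each $n$ let $(y_{i},x_{i},w_{i})=(y_{ni},x_{ni},w_{ni})$, $1\le i\le n$, be a row of a triangular array with $x_i=(1,\tilde x_i')'\in\mathbb R^{p+1}$, independent pairs $(y_i,x_i)$ and non-random weights $w_i$. With respect to a $\sigma$-finite measure on the sample space $\mathcal Y\subseteq\mathbb R$, the conditional density of $y_i$ given $x_i$ is $f(y\mid x_i'\theta_0)$, where $f(y\mid t)=e^{yt-a(t)}c(y)$ is a probability density for every $t\in\mathbb R$, $c>0$ on $\mathcal Y$, and $\theta_0=(\alpha_0,\beta_0')'$ is fixed. Put $g(y,t)=a(t)-yt-\log c(y)$, with $t$-derivatives $\dot g,\ddot g$, and $$L(\theta)=-\tfrac1n\sum_i w_i g(y_i,x_i'\theta),\quad S(\theta)=-\tfrac1n\sum_i w_ix_i\dot g(y_i,x_i'\theta),$$ $$\hat H(\theta)=\tfrac1n\sum_i w_ix_ix_i'\ddot g(y_i,x_i'\theta),\quad \hat I(\theta)=\tfrac1n\sum_i w_i^2x_ix_i'\dot g(y_i,x_i'\theta)^2,$$ $H(\theta_0)=\mathrm E\hat H(\theta_0)$,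 $I(\theta_0)=\mathrm E\hat I(\theta_0)$. **Conditions.** There are constants $C_l,C_u,\lambda_l,\lambda_u,\eta,L_0>0$ (independent of $n$) such that, for all $n\ge1$ and $i$: (a) $\|x_i\|_{\psi_2}<C_u$, and a.s. $\|x_i\|_\infty<C_u$ and $|x_i'\theta_0|<C_u$; $C_l<w_i<C_u$. (Here $\|X\|_{\psi_2}=\sup_{m\ge1}m^{-1/2}(\mathrm E|X|^m)^{1/m}$ for a random variable, and $\|X\|_{\psi_2}=\sup_{\|b\|_2=1}\|b'X\|_{\psi_2}$ for a random vector.) (b) all eigenvalues of $H(\theta_0)$, $I(\theta_0)$ and $\mathrm E[n^{-1}\sum_i x_ix_i']$ lie in $[\lambda_l,\lambda_u]$. (c) for $y\in\mathcal Y$, $g(y,\cdot)$ is convex and twice differentiable; there is a fixed symmetric matrix $H$ with $\lambda_{\min}(H)>\lambda_l$ such that $\frac1n\sum_i\mathrm E[w_i(g(y_i,x_i'\theta)-g(y_i,x_i'\theta_0))]\ge(\theta-\theta_0)'H(\theta-\theta_0)$ for every $\theta$ with $\max_i|x_i'(\theta-\theta_0)|<\eta$ a.s.; and a.s., for all $y\in\mathcal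 Y$ and $t,\tilde t$ within $\eta$ of $x_i'\theta_0$: $|\ddot g(y,t)-\ddot g(y,\tilde t)|\le L_0|t-\tilde t|$, $|\dot g(y,x_i'\theta_0)|\le C_u$, $|\ddot g(y,t)|\le C_u$. As $n\to\infty$, $H(\theta_0)$ and $I(\theta_0)$ converge to nonsingular matrices. **Selection.** $\hat\theta=(\hat\alpha,\hat\beta')'$ is a (measurable) minimizer of $-L(\theta)+\lambda\|\beta\|_1$ wherever a minimizer exists (it is arbitrary elsewhere), with $\lambda=C_nn^{-1/2}$, $C_n>0$ bounded. $\hat M$ consists of the constant and the regressors with nonzero Lasso slope. Let $M$ consist of the constant and exactly the regressors with nonzero true slope, and suppose that $C_n$ is bounded away from $0$ unless $M$ contains all $p+1$ regressors. Let $\theta_{M0}=(\alpha_0,\beta_{M0}')'$ be the subvector of $\theta_0$ for $M$, $\mathtt s_M=\mathrm{sign}(\beta_{M0})\in\{-1,1\}^{|M|-1}$, $\hat\theta_M$ the subvector of $\hat\theta$, and $\hat{\mathtt s}_M=\mathrm{sign}(\hat\beta_M)$. Subscripts $M$, $-M$ denote blocks of $S,\hat H,\hat I$ evaluated at $\hat\theta_M$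 (padded by zeros). **Parameter function.** $\rho_M=\rho_{M,n}$ is a (measurable) real function of $\theta_M$, possibly depending on $n$, continuously differentiable in a fixed neighbourhood of $\theta_{M0}$, with gradients $\dot\rho_M$ that are equicontinuous in $n$ at $\theta_{M0}$ (automatic if $\rho_M$ does not depend on $n$), $\dot\rho_M(\theta_{M0})'\dot\rho_M(\theta_{M0})>l$ for some $l>0$ independent of $n$, and $\rho_M(\theta_{M0})\ne0$. Put $\mathtt s^\rho_M=\mathrm{sign}(\rho_M(\theta_{M0}))$, $\hat{\mathtt s}^\rho_M=\mathrm{sign}(\rho_M(\hat\theta_M))$. **Interval.** Write $E=[0,I_{|M|-1}]$, $\sigma=(0,\mathtt s_M')'$, $G=\hat H_{-MM}\hat H_M^{-1}$, $\dot\rho=\dot\rho_M(\hat\theta_M)$, and let $$\tilde\beta_M=\hat\beta_M+E\hat H_M^{-1}S_M,\quad \tilde\rho_M=\rho_M(\hat\theta_M)+\dot\rho'\hat H_M^{-1}S_M,\quad \tilde S_{-M}=S_{-M}-GS_M,$$ $$Z_\rho=\sqrt n\begin{bmatrix}\tilde\rho_M\\ \tilde\beta_M\\ \tilde S_{-M}\end{bmatrix},\quad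 A_\rho=\begin{bmatrix}-\mathtt s^\rho_M&0&0\\0&-\mathrm{diag}(\mathtt s_M)&0\\0&0&I\\0&0&-I\end{bmatrix},\quad b_\rho=\sqrt n\begin{bmatrix}-\mathtt s^\rho_M\dot\rho'\hat H_M^{-1}\lambda\sigma\\-\mathrm{diag}(\mathtt s_M)E\hat H_M^{-1}\lambda\sigma\\ \lambda(\mathbf 1-G\sigma)\\ \lambda(\mathbf 1+G\sigma)\end{bmatrix}.$$ With $K=\hat H_M^{-1}\hat I_M\hat H_M^{-1}$ and $Q=\hat H_M^{-1}\hat I_{M(-M)}-K\hat H_{M(-M)}$, let $\hat\Sigma_\rho$ be the symmetric matrix with blocks $\hat\Sigma_{\rho\rho}=\dot\rho'K\dot\rho$, $\hat\Sigma_{\rho\beta}=\dot\rho'KE'$, $\hat\Sigma_{\rho s}=\dot\rho'Q$, $\hat\Sigma_{\beta\beta}=EKE'$, $\hat\Sigma_{\beta s}=EQ$, $\hat\Sigma_{ss}=\hat I_{-M}-G\hat I_{M(-M)}-\hat I_{-MM}G'+G\hat I_MG'$. Let $e$ be the first unit vector, $c=\hat\Sigma_\rho e(e'\hat\Sigma_\rho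 e)^{-1}$, $r=(I-ce')Z_\rho$, $$\mathcal V^-=\max_{j:(A_\rho c)_j<0}\frac{(b_\rho-A_\rho r)_j}{(A_\rho c)_j},\qquad \mathcal V^+=\min_{j:(A_\rho c)_j>0}\frac{(b_\rho-A_\rho r)_j}{(A_\rho c)_j}$$ ($-\infty$, resp. $+\infty$, if there is no such $j$). With $F(x;\mu,\sigma^2,u,v)$ the CDF at $x$ of $N(\mu,\sigma^2)$ truncated to $[u,v]$, the interval of level $1-\zeta$ is $\mathrm{CI}^\rho_{\hat M}=[\tilde q_l,\tilde q_u]$, where $$F(\sqrt n\tilde\rho_M;\sqrt n\tilde q_l,\hat\Sigma_{\rho\rho},\mathcal V^-,\mathcal V^+)=1-\tfrac\zeta2,\qquad F(\sqrt n\tilde\rho_M;\sqrt n\tilde q_u,\hat\Sigma_{\rho\rho},\mathcal V^-,\mathcal V^+)=\tfrac\zeta2$$ (the interval is empty if one of the equations has no solution). **Claim.** For every $\zeta\in(0,1)$, $$\liminf_{n\to\infty}P\big[\rho_M(\theta_{M0})\in\mathrm{CI}^\rho_{\hat M}\,\big|\,\hat M=M,\ \hat{\mathtt s}_{\hat M}=\mathtt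 s_M,\ \hat{\mathtt s}^\rho_{\hat M}=\mathtt s^\rho_M\big]=1-\zeta.$$ -/

import Mathlib

open MeasureTheory ProbabilityTheory Filter Topology Matrix

noncomputable section

namespace SurveyLasso

/-! ### Generalized linear model -/

/-- The GLM density `exp (y t - a t) c y` at index value `t = x'θ`. -/
def glmDensity (a c : ℝ → ℝ) (y t : ℝ) : ℝ := Real.exp (y * t - a t) * c y

/-- The loss `g(y, t) = a t - y t - log (c y)`, i.e. minus the log of `glmDensity` where `c y > 0`. -/
def loss (a c : ℝ → ℝ) (y t : ℝ) : ℝ := a t - y * t - Real.log (c y)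

/-- First derivative of the loss in `t`. -/
def lossD (a c : ℝ → ℝ) (y : ℝ) : ℝ → ℝ := deriv (loss a c y)

/-- Second derivative of the loss in `t`. -/
def lossDD (a c : ℝ → ℝ) (y : ℝ) : ℝ → ℝ := deriv (lossD a c y)

/-- A triangular array of survey observations `(y_{ni}, x_{ni}, w_{ni})`, `1 ≤ i ≤ n`, whose outcomes
follow a GLM with true parameter `θ₀`. Coordinate `0` of the covariates is the constant term,
coordinates `1, …, p` are the slopes. -/
structure SurveyGLM (p : ℕ) (Ω : Type*) [MeasurableSpace Ω] (P : Measure Ω) where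
  /-- dominating measure of the conditional densities -/
  dom : Measure ℝ
  sigmaFinite_dom : SigmaFinite dom
  /-- sample space of the outcome -/
  Y : Set ℝ
  dom_compl : dom Yᶜ = 0
  a : ℝ → ℝ
  c : ℝ → ℝ
  measurable_c : Measurable c
  c_pos : ∀ y ∈ Y, 0 < c y
  /-- `glmDensity a c · t` is a probability density for every index value -/
  density_normalized : ∀ t : ℝ, ∫⁻ y, ENNReal.ofReal (glmDensity a c y t) ∂dom = 1
  θ₀ : Fin (p + 1) → ℝ
  y : (n : ℕ) → Fin n → Ω → ℝ
  x : (n : ℕ) → Fin n → Ω → (Fin (p + 1) → ℝ)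
  /-- the (non-random) survey weights -/
  w : (n : ℕ) → Fin n → ℝ
  measurable_y : ∀ n i, Measurable (y n i)
  measurable_x : ∀ n i, Measurable (x n i)
  x_zero : ∀ n i ω, x n i ω 0 = 1
  /-- the conditional density of `y_{ni}` given `x_{ni}` with respect to `dom` is
  `glmDensity a c · (x_{ni}'θ₀)` -/
  conditional_density : ∀ n i,
    P.map (fun ω => (x n i ω, y n i ω)) =
      ((P.map (x n i)).prod dom).withDensity
        (fun z => ENNReal.ofReal (glmDensity a c z.2 (z.1 ⬝ᵥ θ₀)))

/-! ### Norms and eigenvalue bounds -/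

/-- Sub-Gaussian norm `sup_{m ≥ 1} m^{-1/2} (E |X|^m)^{1/m}` of a random variable. -/
def psi2Norm {Ω : Type*} [MeasurableSpace Ω] (X : Ω → ℝ) (P : Measure Ω) : ENNReal :=
  ⨆ m : {m : ℝ // 1 ≤ m},
    ENNReal.ofReal ((m : ℝ) ^ (-(1 / 2) : ℝ)) * eLpNorm X (ENNReal.ofReal m) P

/-- Sub-Gaussian norm of a random vector: supremum over Euclidean unit vectors `b`. -/
def psi2VecNorm {Ω : Type*} [MeasurableSpace Ω] {k : ℕ} (X : Ω → (Fin k → ℝ))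
    (P : Measure Ω) : ENNReal :=
  ⨆ b : {b : Fin k → ℝ // b ⬝ᵥ b = 1}, psi2Norm (fun ω => X ω ⬝ᵥ b.1) P

/-- `l ≤ λ_min(A)` and `λ_max(A) ≤ u` for the symmetric matrix `A`. -/
def EigBetween {k : ℕ} (l u : ℝ) (A : Matrix (Fin k) (Fin k) ℝ) : Prop :=
  (A - l • (1 : Matrix (Fin k) (Fin k) ℝ)).PosSemidef ∧
    (u • (1 : Matrix (Fin k) (Fin k) ℝ) - A).PosSemidef

namespace SurveyGLM

variable {p : ℕ} {Ω : Type*} [MeasurableSpace Ω] {P : Measure Ω}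

/-! ### Likelihood, score, information and Hessian -/

/-- Weighted log-likelihood `L(θ)`. -/
def logLik (D : SurveyGLM p Ω P) (n : ℕ) (ω : Ω) (θ : Fin (p + 1) → ℝ) : ℝ :=
  -((n : ℝ)⁻¹ * ∑ i : Fin n, D.w n i * loss D.a D.c (D.y n i ω) (D.x n i ω ⬝ᵥ θ))

/-- Score `S(θ)`. -/
def score (D : SurveyGLM p Ω P) (n : ℕ) (ω : Ω) (θ : Fin (p + 1) → ℝ) : Fin (p + 1) → ℝ :=
  fun j => -((n : ℝ)⁻¹ *
    ∑ i : Fin n, D.w n i * D.x n i ω j * lossD D.a D.c (D.y n i ω) (D.x n i ω ⬝ᵥ θ))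

/-- Sample information matrix `Î(θ)`. -/
def info (D : SurveyGLM p Ω P) (n : ℕ) (ω : Ω) (θ : Fin (p + 1) → ℝ) :
    Matrix (Fin (p + 1)) (Fin (p + 1)) ℝ :=
  Matrix.of fun j k => (n : ℝ)⁻¹ *
    ∑ i : Fin n, D.w n i ^ 2 * (D.x n i ω j * D.x n i ω k) *
      lossD D.a D.c (D.y n i ω) (D.x n i ω ⬝ᵥ θ) ^ 2

/-- Sample negative Hessian matrix `Ĥ(θ)`. -/
def hess (D : SurveyGLM p Ω P) (n : ℕ) (ω : Ω) (θ : Fin (p + 1) → ℝ) :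
    Matrix (Fin (p + 1)) (Fin (p + 1)) ℝ :=
  Matrix.of fun j k => (n : ℝ)⁻¹ *
    ∑ i : Fin n, D.w n i * (D.x n i ω j * D.x n i ω k) *
      lossDD D.a D.c (D.y n i ω) (D.x n i ω ⬝ᵥ θ)

/-- `I(θ₀) = E[Î(θ₀)]`. -/
def popInfo (D : SurveyGLM p Ω P) (n : ℕ) : Matrix (Fin (p + 1)) (Fin (p + 1)) ℝ :=
  Matrix.of fun j k => ∫ ω, D.info n ω D.θ₀ j k ∂P

/-- `H(θ₀) = E[Ĥ(θ₀)]`. -/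
def popHess (D : SurveyGLM p Ω P) (n : ℕ) : Matrix (Fin (p + 1)) (Fin (p + 1)) ℝ :=
  Matrix.of fun j k => ∫ ω, D.hess n ω D.θ₀ j k ∂P

/-- `E[n⁻¹ X'X]`. -/
def popGram (D : SurveyGLM p Ω P) (n : ℕ) : Matrix (Fin (p + 1)) (Fin (p + 1)) ℝ :=
  Matrix.of fun j k => ∫ ω, (n : ℝ)⁻¹ * ∑ i : Fin n, D.x n i ω j * D.x n i ω k ∂P

/-- The regularity conditions on the array and the loss, with constants
`0 < Cl`, `Cu`, `0 < ll`, `lu`, `0 < η`, `0 < L₀` that do not depend on `n`. -/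
structure AsyValid (D : SurveyGLM p Ω P) (Cl Cu ll lu η L₀ : ℝ) : Prop where
  Cl_pos : 0 < Cl
  ll_pos : 0 < ll
  η_pos : 0 < η
  L₀_pos : 0 < L₀
  -- (a) independence and boundedness
  indep : ∀ n, iIndepFun (fun (i : Fin n) (ω : Ω) => (D.y n i ω, D.x n i ω)) P
  x_psi2 : ∀ n i, psi2VecNorm (D.x n i) P < ENNReal.ofReal Cu
  x_bdd : ∀ n i, ∀ᵐ ω ∂P, ∀ j, |D.x n i ω j| < Cu
  index_bdd : ∀ n i, ∀ᵐ ω ∂P, |D.x n i ω ⬝ᵥ D.θ₀| < Cu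
  w_lower : ∀ n i, Cl < D.w n i
  w_upper : ∀ n i, D.w n i < Cu
  -- (b) eigenvalue bounds
  eig_hess : ∀ n, 1 ≤ n → EigBetween ll lu (D.popHess n)
  eig_info : ∀ n, 1 ≤ n → EigBetween ll lu (D.popInfo n)
  eig_gram : ∀ n, 1 ≤ n → EigBetween ll lu (D.popGram n)
  -- (c) convexity and smoothness of the loss
  loss_convex : ∀ y ∈ D.Y, ConvexOn ℝ Set.univ (loss D.a D.c y)
  loss_diff : ∀ y ∈ D.Y, Differentiable ℝ (loss D.a D.c y)
  lossD_diff : ∀ y ∈ D.Y, Differentiable ℝ (lossD D.a D.c y)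
  -- quadratic margin: excess risk at least `‖H^{1/2}(θ - θ₀)‖² = (θ - θ₀)'H(θ - θ₀)`
  -- for a fixed `H` with `λ_min(H) > ll`
  margin : ∃ H : Matrix (Fin (p + 1)) (Fin (p + 1)) ℝ,
    (H - ll • (1 : Matrix (Fin (p + 1)) (Fin (p + 1)) ℝ)).PosDef ∧
    ∀ n, 1 ≤ n → ∀ θ : Fin (p + 1) → ℝ,
      (∀ i : Fin n, ∀ᵐ ω ∂P, |D.x n i ω ⬝ᵥ (θ - D.θ₀)| < η) →
      (θ - D.θ₀) ⬝ᵥ (H *ᵥ (θ - D.θ₀)) ≤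
        (n : ℝ)⁻¹ * ∑ i : Fin n, ∫ ω, D.w n i *
          (loss D.a D.c (D.y n i ω) (D.x n i ω ⬝ᵥ θ) -
            loss D.a D.c (D.y n i ω) (D.x n i ω ⬝ᵥ D.θ₀)) ∂P
  lossDD_lip : ∀ n i, ∀ᵐ ω ∂P, ∀ t t' : ℝ,
    |t - D.x n i ω ⬝ᵥ D.θ₀| ≤ η → |t' - D.x n i ω ⬝ᵥ D.θ₀| ≤ η → ∀ y ∈ D.Y,
      |lossDD D.a D.c y t - lossDD D.a D.c y t'| ≤ L₀ * |t - t'|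
  lossD_bdd : ∀ n i, ∀ᵐ ω ∂P, ∀ y ∈ D.Y, |lossD D.a D.c y (D.x n i ω ⬝ᵥ D.θ₀)| ≤ Cu
  lossDD_bdd : ∀ n i, ∀ᵐ ω ∂P, ∀ t : ℝ, |t - D.x n i ω ⬝ᵥ D.θ₀| ≤ η → ∀ y ∈ D.Y,
    |lossDD D.a D.c y t| ≤ Cu

/-! ### The survey-weighted Lasso -/

/-- Lasso objective `-L(θ) + lam ‖β‖₁`; the intercept is not penalized. -/
def lassoObj (D : SurveyGLM p Ω P) (n : ℕ) (lam : ℝ) (ω : Ω) (θ : Fin (p + 1) → ℝ) : ℝ :=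
  -D.logLik n ω θ + lam * ∑ j : Fin p, |θ j.succ|

/-- `th` is a Lasso estimator: a measurable function of the sample point that is almost surely a
global minimizer of the objective wherever a minimizer exists. (For some GLMs, e.g. logit when all
outcomes coincide, there is no minimizer on an event of positive probability; the estimator is
arbitrary there.) -/
def IsLasso (D : SurveyGLM p Ω P) (n : ℕ) (lam : ℝ) (th : Ω → (Fin (p + 1) → ℝ)) : Prop :=
  Measurable th ∧
    ∀ᵐ ω ∂P, (∃ θ, IsMinOn (D.lassoObj n lam ω) Set.univ θ) →
      IsMinOn (D.lassoObj n lam ω) Set.univ (th ω)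

end SurveyGLM

/-! ### Models and subvectors -/

/-- The selected model: the constant together with the nonzero slopes. -/
def selected {p : ℕ} (θ : Fin (p + 1) → ℝ) : Finset (Fin (p + 1)) :=
  Finset.univ.filter fun j => j = 0 ∨ θ j ≠ 0

/-- Indices of `θ_M`. -/
abbrev Act {p : ℕ} (M : Finset (Fin (p + 1))) : Type := {j : Fin (p + 1) // j ∈ M}

/-- Indices of `β_M`. -/
abbrev Slope {p : ℕ} (M : Finset (Fin (p + 1))) : Type := {j : Fin (p + 1) // j ∈ M ∧ j ≠ 0}

/-- Indices of `θ_{-M}`. -/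
abbrev Inact {p : ℕ} (M : Finset (Fin (p + 1))) : Type := {j : Fin (p + 1) // j ∉ M}

/-- `β_M` inside `θ_M`: right multiplication by `[0, I]'` is restriction along this map. -/
def slopeIncl {p : ℕ} (M : Finset (Fin (p + 1))) (j : Slope M) : Act M := ⟨j.1, j.2.1⟩

/-- Subvector `θ_M`. -/
def restr {p : ℕ} (M : Finset (Fin (p + 1))) (θ : Fin (p + 1) → ℝ) : Act M → ℝ := fun j => θ j.1

/-- The full vector with `M`-part `θ_M` and zeros elsewhere. -/
def pad {p : ℕ} (M : Finset (Fin (p + 1))) (θM : Act M → ℝ) : Fin (p + 1) → ℝ :=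
  fun j => if h : j ∈ M then θM ⟨j, h⟩ else 0

/-- Gradient (column of partial derivatives) of `ρ`. -/
def grad {ι : Type*} [Fintype ι] [DecidableEq ι] (ρ : (ι → ℝ) → ℝ) (θ : ι → ℝ) : ι → ℝ :=
  fun j => fderiv ℝ ρ θ (Pi.single j 1)

/-! ### Truncated Gaussian and polyhedral quantities -/

/-- Standard normal CDF, with `Φ(-∞) = 0` and `Φ(∞) = 1`. -/
def stdNormalCDF (x : EReal) : ℝ := (gaussianReal 0 1).real {z : ℝ | (z : EReal) ≤ x}

/-- CDF at `x` of the `N(μ, σ²)` distribution truncated to `[lo, hi]`. -/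
def truncCDF (x μ σsq : ℝ) (lo hi : EReal) : ℝ :=
  (stdNormalCDF (((x - μ) / √σsq : ℝ) : EReal)
      - stdNormalCDF ((lo - (μ : EReal)) / ((√σsq : ℝ) : EReal))) /
    (stdNormalCDF ((hi - (μ : EReal)) / ((√σsq : ℝ) : EReal))
      - stdNormalCDF ((lo - (μ : EReal)) / ((√σsq : ℝ) : EReal)))

section Polyhedral

variable {κ J : Type*} [Fintype κ] [DecidableEq κ]

/-- `c = Σ η (η'Σ η)⁻¹`. -/
def polyC (S : Matrix κ κ ℝ) (η : κ → ℝ) : κ → ℝ := (η ⬝ᵥ (S *ᵥ η))⁻¹ • (S *ᵥ η)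

/-- `r = (I - c η') Z`. -/
def polyR (Z : κ → ℝ) (S : Matrix κ κ ℝ) (η : κ → ℝ) : κ → ℝ :=
  (1 - vecMulVec (polyC S η) η) *ᵥ Z

/-- Lower truncation limit: the maximum of `(b_j - (Ar)_j) / (Ac)_j` over `j` with `(Ac)_j < 0`,
equal to `-∞` if there is no such `j`. -/
def vMinus (A : Matrix J κ ℝ) (b : J → ℝ) (c r : κ → ℝ) : EReal :=
  ⨆ j : {j : J // (A *ᵥ c) j < 0},
    (((b j.1 - (A *ᵥ r) j.1) / (A *ᵥ c) j.1 : ℝ) : EReal)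

/-- Upper truncation limit: the minimum of `(b_j - (Ar)_j) / (Ac)_j` over `j` with `(Ac)_j > 0`,
equal to `∞` if there is no such `j`. -/
def vPlus (A : Matrix J κ ℝ) (b : J → ℝ) (c r : κ → ℝ) : EReal :=
  ⨅ j : {j : J // 0 < (A *ᵥ c) j},
    (((b j.1 - (A *ᵥ r) j.1) / (A *ᵥ c) j.1 : ℝ) : EReal)

end Polyhedral

namespace SurveyGLM

variable {p : ℕ} {Ω : Type*} [MeasurableSpace Ω] {P : Measure Ω}

/-! ### Blocks of the score, Hessian and information matrices for a model `M` -/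

variable (D : SurveyGLM p Ω P) (n : ℕ) (ω : Ω) (M : Finset (Fin (p + 1)))

/-- `S_M(θ_M)`. -/
def scoreM (θM : Act M → ℝ) : Act M → ℝ := fun j => D.score n ω (pad M θM) j.1

/-- `S_{-M}(θ_M)`. -/
def scoreN (θM : Act M → ℝ) : Inact M → ℝ := fun j => D.score n ω (pad M θM) j.1

/-- `Ĥ_M(θ_M)`. -/
def hessMM (θM : Act M → ℝ) : Matrix (Act M) (Act M) ℝ :=
  (D.hess n ω (pad M θM)).submatrix Subtype.val Subtype.val

/-- `Ĥ_{M(-M)}(θ_M)`. -/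
def hessMN (θM : Act M → ℝ) : Matrix (Act M) (Inact M) ℝ :=
  (D.hess n ω (pad M θM)).submatrix Subtype.val Subtype.val

/-- `Ĥ_{-MM}(θ_M)`. -/
def hessNM (θM : Act M → ℝ) : Matrix (Inact M) (Act M) ℝ :=
  (D.hess n ω (pad M θM)).submatrix Subtype.val Subtype.val

/-- `Î_M(θ_M)`. -/
def infoMM (θM : Act M → ℝ) : Matrix (Act M) (Act M) ℝ :=
  (D.info n ω (pad M θM)).submatrix Subtype.val Subtype.val

/-- `Î_{M(-M)}(θ_M)`. -/
def infoMN (θM : Act M → ℝ) : Matrix (Act M) (Inact M) ℝ :=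
  (D.info n ω (pad M θM)).submatrix Subtype.val Subtype.val

/-- `Î_{-MM}(θ_M)`. -/
def infoNM (θM : Act M → ℝ) : Matrix (Inact M) (Act M) ℝ :=
  (D.info n ω (pad M θM)).submatrix Subtype.val Subtype.val

/-- `Î_{-M}(θ_M)`. -/
def infoNN (θM : Act M → ℝ) : Matrix (Inact M) (Inact M) ℝ :=
  (D.info n ω (pad M θM)).submatrix Subtype.val Subtype.val

/-! ### One-step estimators and their estimated covariance -/

/-- The true value `θ_{M0}` of the parameter of model `M`. -/
def thetaM0 : Act M → ℝ := restr M D.θ₀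

/-- The vector `(0, s_M')'` with `s_M = sign(β_{M0})`. -/
def signM : Act M → ℝ := fun j => if j.1 = 0 then 0 else Real.sign (D.θ₀ j.1)

/-- One-step estimator `θ̃_M = θ̂_M + Ĥ_M(θ̂_M)⁻¹ S_M(θ̂_M)`. -/
def oneStep (tM : Act M → ℝ) : Act M → ℝ :=
  tM + (D.hessMM n ω M tM)⁻¹ *ᵥ D.scoreM n ω M tM

/-- One-step estimator `ρ̃_M`. -/
def rhoTilde (ρ : (Act M → ℝ) → ℝ) (tM : Act M → ℝ) : ℝ :=
  ρ tM + grad ρ tM ⬝ᵥ ((D.hessMM n ω M tM)⁻¹ *ᵥ D.scoreM n ω M tM)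

/-- `Ĥ_{-MM}(θ̂_M) Ĥ_M(θ̂_M)⁻¹`. -/
def projNM (tM : Act M → ℝ) : Matrix (Inact M) (Act M) ℝ :=
  D.hessNM n ω M tM * (D.hessMM n ω M tM)⁻¹

/-- `S̃_{-M}(θ̂_M)`. -/
def scoreTilde (tM : Act M → ℝ) : Inact M → ℝ :=
  D.scoreN n ω M tM - D.projNM n ω M tM *ᵥ D.scoreM n ω M tM

/-- `Ĥ_M⁻¹ Î_M Ĥ_M⁻¹`. -/
def sandwich (tM : Act M → ℝ) : Matrix (Act M) (Act M) ℝ :=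
  (D.hessMM n ω M tM)⁻¹ * D.infoMM n ω M tM * (D.hessMM n ω M tM)⁻¹

/-- `Ĥ_M⁻¹ Î_{M(-M)} - Ĥ_M⁻¹ Î_M Ĥ_M⁻¹ Ĥ_{M(-M)}`. -/
def crossCov (tM : Act M → ℝ) : Matrix (Act M) (Inact M) ℝ :=
  (D.hessMM n ω M tM)⁻¹ * D.infoMN n ω M tM - D.sandwich n ω M tM * D.hessMN n ω M tM

/-- `Σ̂_{ss}`. -/
def sigmaSS (tM : Act M → ℝ) : Matrix (Inact M) (Inact M) ℝ :=
  fromCols (1 : Matrix (Inact M) (Inact M) ℝ) (-D.projNM n ω M tM) *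
    fromBlocks (D.infoNN n ω M tM) (D.infoNM n ω M tM)
      (D.infoMN n ω M tM) (D.infoMM n ω M tM) *
    (fromCols (1 : Matrix (Inact M) (Inact M) ℝ) (-D.projNM n ω M tM))ᵀ

/-- `Σ̂`, the estimated covariance of `Z`. -/
def sigmaHat (tM : Act M → ℝ) : Matrix (Slope M ⊕ Inact M) (Slope M ⊕ Inact M) ℝ :=
  fromBlocks
    ((D.sandwich n ω M tM).submatrix (slopeIncl M) (slopeIncl M))
    ((D.crossCov n ω M tM).submatrix (slopeIncl M) id)
    ((D.crossCov n ω M tM).submatrix (slopeIncl M) id)ᵀ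
    (D.sigmaSS n ω M tM)

/-- The row `(Σ̂_{ρβ}, Σ̂_{ρs})`. -/
def sigmaRhoRow (ρ : (Act M → ℝ) → ℝ) (tM : Act M → ℝ) : Slope M ⊕ Inact M → ℝ :=
  Sum.elim (fun j => (grad ρ tM ᵥ* D.sandwich n ω M tM) (slopeIncl M j))
    (grad ρ tM ᵥ* D.crossCov n ω M tM)

/-- `Σ̂_ρ`, the estimated covariance of `Z_ρ`. -/
def sigmaRho (ρ : (Act M → ℝ) → ℝ) (tM : Act M → ℝ) :
    Matrix (Unit ⊕ (Slope M ⊕ Inact M)) (Unit ⊕ (Slope M ⊕ Inact M)) ℝ :=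
  fromBlocks (Matrix.of fun _ _ => grad ρ tM ⬝ᵥ (D.sandwich n ω M tM *ᵥ grad ρ tM))
    (Matrix.of fun _ k => D.sigmaRhoRow n ω M ρ tM k)
    (Matrix.of fun k _ => D.sigmaRhoRow n ω M ρ tM k)
    (D.sigmaHat n ω M tM)

/-! ### The affine description of the conditioning event -/

/-- `Z = √n (β̃_M', S̃_{-M}')'`. -/
def zVec (tM : Act M → ℝ) : Slope M ⊕ Inact M → ℝ :=
  √(n : ℝ) • Sum.elim (fun j => D.oneStep n ω M tM (slopeIncl M j)) (D.scoreTilde n ω M tM)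

/-- `Z_ρ = (√n ρ̃_M, Z')'`. -/
def zRho (ρ : (Act M → ℝ) → ℝ) (tM : Act M → ℝ) : Unit ⊕ (Slope M ⊕ Inact M) → ℝ :=
  Sum.elim (fun _ => √(n : ℝ) * D.rhoTilde n ω M ρ tM) (D.zVec n ω M tM)

/-- The matrix `A`. -/
def aMat : Matrix (Slope M ⊕ (Inact M ⊕ Inact M)) (Slope M ⊕ Inact M) ℝ :=
  fromRows (fromCols (-diagonal fun j : Slope M => D.signM M (slopeIncl M j)) 0)
    (fromRows (fromCols 0 1) (fromCols 0 (-1)))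

/-- The vector `b`. -/
def bVec (lam : ℝ) (tM : Act M → ℝ) : Slope M ⊕ (Inact M ⊕ Inact M) → ℝ :=
  √(n : ℝ) • Sum.elim
    (fun j => -(D.signM M (slopeIncl M j) *
      ((D.hessMM n ω M tM)⁻¹ *ᵥ (lam • D.signM M)) (slopeIncl M j)))
    (Sum.elim (fun j => lam * (1 - (D.projNM n ω M tM *ᵥ D.signM M) j))
      (fun j => lam * (1 + (D.projNM n ω M tM *ᵥ D.signM M) j)))

/-- The sign `s_M^ρ` of `ρ_M(θ_{M0})`. -/
def signRho (ρ : (Act M → ℝ) → ℝ) : ℝ := Real.sign (ρ (D.thetaM0 M))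

/-- The matrix `A_ρ`, with the sign constraint on `ρ` in its first row. -/
def aRho (ρ : (Act M → ℝ) → ℝ) :
    Matrix (Unit ⊕ (Slope M ⊕ (Inact M ⊕ Inact M))) (Unit ⊕ (Slope M ⊕ Inact M)) ℝ :=
  fromBlocks (Matrix.of fun _ _ => -D.signRho M ρ) 0 0 (D.aMat M)

/-- The vector `b_ρ`. -/
def bRho (lam : ℝ) (ρ : (Act M → ℝ) → ℝ) (tM : Act M → ℝ) :
    Unit ⊕ (Slope M ⊕ (Inact M ⊕ Inact M)) → ℝ :=
  Sum.elim
    (fun _ => -(√(n : ℝ) * (D.signRho M ρ *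
      (grad ρ tM ⬝ᵥ ((D.hessMM n ω M tM)⁻¹ *ᵥ (lam • D.signM M))))))
    (D.bVec n ω M lam tM)

/-- The unit vector that picks the `ρ`-coordinate. -/
def eRho : Unit ⊕ (Slope M ⊕ Inact M) → ℝ := Pi.single (Sum.inl ()) 1

/-- The truncated Gaussian pivot at the candidate value `q` of `ρ_M(θ_{M0})`: the CDF, at the
observed `√n ρ̃_M`, of the normal distribution with mean `√n q` and variance `e'Σ̂_ρ e`
truncated to the interval between the truncation limits. -/
def pivot (lam : ℝ) (ρ : (Act M → ℝ) → ℝ) (tM : Act M → ℝ) (q : ℝ) : ℝ :=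
  let S := D.sigmaRho n ω M ρ tM
  let c := polyC S (eRho M)
  let r := polyR (D.zRho n ω M ρ tM) S (eRho M)
  truncCDF (eRho M ⬝ᵥ D.zRho n ω M ρ tM) (√(n : ℝ) * q) (eRho M ⬝ᵥ (S *ᵥ eRho M))
    (vMinus (D.aRho M ρ) (D.bRho n ω M lam ρ tM) c r)
    (vPlus (D.aRho M ρ) (D.bRho n ω M lam ρ tM) c r)

/-- The selective-inference confidence interval `[q_l, q_u]` of level `1 - ζ`, whose end points
solve `pivot q_l = 1 - ζ/2` and `pivot q_u = ζ/2`. (The pivot decreases strictly from `1` to `0` in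
`q` when the observed value is inside the truncation interval, so that the end points are unique;
the set is empty when an equation has no solution.) -/
def ci (ζ lam : ℝ) (ρ : (Act M → ℝ) → ℝ) (tM : Act M → ℝ) : Set ℝ :=
  {q | ∃ ql qu : ℝ, D.pivot n ω M lam ρ tM ql = 1 - ζ / 2 ∧
    D.pivot n ω M lam ρ tM qu = ζ / 2 ∧ q ∈ Set.Icc ql qu}

/-- The conditioning event: the Lasso selects `M`, its slopes have the signs of `β_{M0}`, and the
estimate of `ρ` has the sign of `ρ_M(θ_{M0})`. -/
def condEvent (ρ : (Act M → ℝ) → ℝ) (th : Ω → (Fin (p + 1) → ℝ)) : Set Ω :=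
  {ω | selected (th ω) = M ∧
    (∀ j : Slope M, Real.sign (th ω j.1) = Real.sign (D.θ₀ j.1)) ∧
    Real.sign (ρ (restr M (th ω))) = D.signRho M ρ}

end SurveyGLM

end SurveyLasso

end

/-!
# Conditional coverage of the post-Lasso interval for a smooth parameter

The argument is carried out along ultrafilters `𝒰` of sample sizes, which play the role of
subsequences: it suffices that the conditional coverage tends to `1 - ζ` along each `𝒰 ≤ atTop`.
Along `𝒰` the rescaled penalty level `√n λ` has a limit `c`, the gradients of `ρ_n`, divided by the
asymptotic standard deviation `σ_n` of the estimate, have a limit `g`, and `√n |ρ_n(θ_{M0})| / σ_n`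
has a limit `τ ∈ [0, ∞]` (`exists_pen_limit`, `exists_isRhoLimit`).

**Limit experiment.** The rescaled score `√n S(θ₀)` is asymptotically `N(0, I)` by a central limit
theorem for bounded triangular arrays (`gaussianPi_le_liminf_normalized_sum`), and the Hessian and
the information at `θ₀` obey a law of large numbers (`tendstoInProb_mean`). By
`tendsto_measure_of_local`, the probability of an event therefore tends to the Gaussian probability
of a set `A` as soon as, for almost every `w`, the event is eventually decided by whether `w ∈ A`
along all pairs `(n, ω)` at which the score is near `w`, the two matrices are near their limits, and
`ω` avoids a null set. What remains is deterministic.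

**The Lasso.** Along such pairs the objective is convex with a uniformly positive definite Hessian
at `θ₀`, so a minimizer exists and is `√n`-consistent (`IsLocalSeq.exists_bound`). The first-order
conditions pass to the limit, where they are those of a strictly convex quadratic problem; the model
`M` is selected exactly when the solution of that problem with inactive coefficients zero has inactive
score in the open box of radius `c`, ties on the boundary being negligible
(`IsLocalLimit.eventually_selected_eq`, `IsLocalLimit.eq_of_selected`). The slopes have the correct
signs eventually, and the sign of `ρ` is a further affine constraint, void if `τ = ∞`. So the
conditioning event corresponds to `w` lying in a polyhedron (`rowRegion`), which is open and
nonempty, hence of positive Gaussian probability.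

**The pivot.** On that event the truncated normal distribution function that defines the interval,
evaluated at the true `ρ_n(θ_{M0})`, converges to the corresponding pivot of the Gaussian vector on
the polyhedron (`IsSelectedLimit.tendsto_pivot`). Conditionally on the polyhedron and on the component
of the Gaussian vector independent of the limit `h'w` of the standardized one-step estimator, `h'w` is
a standard normal variable truncated to an interval, so this pivot is exactly uniform on `(0, 1)`
(`gaussianPi_rowPivot_Ioo`). The truncated normal distribution function is continuous and decreasing
from `1` to `0` in its mean, so the interval contains the true value exactly when the pivot lies in
`[ζ/2, 1 - ζ/2]` (`exists_quantiles_iff`), an event of limiting conditional probability `1 - ζ`.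
-/

namespace SurveyLasso

/-! ### The standard normal distribution function on the extended reals -/

lemma measurableSet_coe_le (x : EReal) : MeasurableSet {z : ℝ | (z : EReal) ≤ x} :=
  measurableSet_le measurable_coe_real_ereal measurable_const

lemma stdNormalCDF_sub {lo hi : EReal} (h : lo ≤ hi) :
    stdNormalCDF hi - stdNormalCDF lo =
      (gaussianReal 0 1).real {z : ℝ | lo < z ∧ (z : EReal) ≤ hi} := by
  have : {z : ℝ | lo < z ∧ (z : EReal) ≤ hi} =
      {z : ℝ | (z : EReal) ≤ hi} \ {z : ℝ | (z : EReal) ≤ lo} := by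
    ext z; simp [and_comm]
  have hsub : {z : ℝ | (z : EReal) ≤ lo} ⊆ {z : ℝ | (z : EReal) ≤ hi} :=
    fun z hz => le_trans hz h
  rw [this, measureReal_sdiff hsub (measurableSet_coe_le lo)]
  rfl

lemma gaussianReal_real_pos_of_isOpen {s : Set ℝ} (hs : IsOpen s) (hne : s.Nonempty) :
    0 < (gaussianReal 0 1).real s := by
  rw [measureReal_def, ENNReal.toReal_pos_iff]
  refine ⟨pos_iff_ne_zero.2 fun h0 => ?_, measure_lt_top _ _⟩
  have := gaussianReal_absolutelyContinuous' 0 (one_ne_zero) h0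
  exact (hs.measure_pos volume hne).ne' this

lemma stdNormalCDF_strictMono : StrictMono stdNormalCDF := by
  intro lo hi h
  rw [← sub_pos, stdNormalCDF_sub h.le]
  obtain ⟨z, hz1, hz2⟩ := EReal.lt_iff_exists_real_btwn.1 h
  have hopen : IsOpen {z : ℝ | lo < z ∧ (z : EReal) < hi} :=
    (isOpen_Ioo (a := lo) (b := hi)).preimage continuous_coe_real_ereal
  refine (gaussianReal_real_pos_of_isOpen hopen ⟨z, hz1, hz2⟩).trans_le ?_
  exact measureReal_mono (fun z hz => ⟨hz.1, hz.2.le⟩)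

lemma gaussianReal_singleton (z : ℝ) : gaussianReal 0 1 {z} = 0 :=
  gaussianReal_absolutelyContinuous 0 one_ne_zero (by simp)

lemma gaussianReal_ereal_singleton (x : EReal) : gaussianReal 0 1 {z : ℝ | (z : EReal) = x} = 0 := by
  refine Set.Subsingleton.induction_on (p := fun s => gaussianReal 0 1 s = 0) ?_ (by simp)
    gaussianReal_singleton
  intro z hz z' hz'
  exact EReal.coe_injective (hz.trans hz'.symm)

lemma continuous_stdNormalCDF : Continuous stdNormalCDF := by
  rw [continuous_iff_continuousAt]
  intro x
  have hrep : ∀ y : EReal, stdNormalCDF y =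
      ∫ z, {z : ℝ | (z : EReal) ≤ y}.indicator (fun _ => (1 : ℝ)) z ∂(gaussianReal 0 1) := by
    intro y
    rw [integral_indicator_const _ (measurableSet_coe_le y)]
    simp [stdNormalCDF]
  have hfun : stdNormalCDF = fun y : EReal =>
      ∫ z, {z : ℝ | (z : EReal) ≤ y}.indicator (fun _ => (1 : ℝ)) z ∂(gaussianReal 0 1) :=
    funext hrep
  rw [ContinuousAt, hfun]
  refine tendsto_integral_filter_of_dominated_convergence (fun _ => 1) ?_ ?_ ?_ ?_
  · exact Eventually.of_forall fun y =>
      (measurable_const.indicator (measurableSet_coe_le y)).aestronglyMeasurable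
  · refine Eventually.of_forall fun y => Eventually.of_forall fun z => ?_
    by_cases hz : (z : EReal) ≤ y <;> simp [Set.indicator, hz]
  · exact integrable_const _
  · have hne : ∀ᵐ z : ℝ ∂(gaussianReal 0 1), (z : EReal) ≠ x := by
      rw [ae_iff]; simpa using gaussianReal_ereal_singleton x
    filter_upwards [hne] with z hz
    rcases lt_or_gt_of_ne hz with h | h
    · refine tendsto_const_nhds.congr' ?_
      filter_upwards [lt_mem_nhds h] with y hy
      simp [Set.indicator, h.le, hy.le]
    · refine tendsto_const_nhds.congr' ?_
      filter_upwards [gt_mem_nhds h] with y hy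
      simp [Set.indicator, not_le.2 h, not_le.2 hy]

/-! ### The truncated normal pivot -/

/-- The distribution function at `z ∈ [lo, hi]` of the standard normal law truncated to `[lo, hi]`.
Outside this interval the formula takes values outside `[0, 1]`. -/
noncomputable def truncStd (z lo hi : EReal) : ℝ :=
  (stdNormalCDF z - stdNormalCDF lo) / (stdNormalCDF hi - stdNormalCDF lo)

/-- The probability integral transform for a truncated standard normal variable. -/
lemma gaussianReal_truncStd_mem_Ioo {lo hi : EReal} (h : lo < hi) {s t : ℝ} (hs : 0 ≤ s)
    (hst : s ≤ t) (ht : t ≤ 1) :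
    (gaussianReal 0 1).real
        {z : ℝ | (lo < z ∧ (z : EReal) < hi) ∧ truncStd z lo hi ∈ Set.Ioo s t} =
      (t - s) * (gaussianReal 0 1).real {z : ℝ | lo < z ∧ (z : EReal) < hi} := by
  have hpos : 0 < stdNormalCDF hi - stdNormalCDF lo := sub_pos.2 (stdNormalCDF_strictMono h)
  -- quantiles of the truncated law, as extended reals
  have hq : ∀ u : ℝ, 0 ≤ u → u ≤ 1 → ∃ e ∈ Set.Icc lo hi,
      stdNormalCDF e = stdNormalCDF lo + u * (stdNormalCDF hi - stdNormalCDF lo) := by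
    intro u hu0 hu1
    have := intermediate_value_Icc h.le continuous_stdNormalCDF.continuousOn
    exact this ⟨by nlinarith, by nlinarith⟩
  have hopen : ∀ {a b : EReal}, a ≤ b →
      (gaussianReal 0 1).real {z : ℝ | a < z ∧ (z : EReal) < b} =
        stdNormalCDF b - stdNormalCDF a := by
    intro a b hab
    rw [stdNormalCDF_sub hab]
    refine measureReal_congr ?_
    have hne : ∀ᵐ z : ℝ ∂(gaussianReal 0 1), (z : EReal) ≠ b := by
      rw [ae_iff]; simpa using gaussianReal_ereal_singleton b
    filter_upwards [hne] with z hz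
    exact propext ⟨fun h => ⟨h.1, h.2.le⟩, fun h => ⟨h.1, lt_of_le_of_ne h.2 hz⟩⟩
  obtain ⟨es, hes, hes'⟩ := hq s hs (hst.trans ht)
  obtain ⟨et, het, het'⟩ := hq t (hs.trans hst) ht
  have hle : es ≤ et := by
    rw [← stdNormalCDF_strictMono.le_iff_le, hes', het']
    nlinarith
  have hset : {z : ℝ | (lo < z ∧ (z : EReal) < hi) ∧ truncStd z lo hi ∈ Set.Ioo s t} =
      {z : ℝ | es < z ∧ (z : EReal) < et} := by
    ext z
    have h1 : s < truncStd z lo hi ↔ es < (z : EReal) := by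
      rw [truncStd, lt_div_iff₀ hpos, ← stdNormalCDF_strictMono.lt_iff_lt, hes']
      constructor <;> intro h <;> linarith
    have h2 : truncStd z lo hi < t ↔ (z : EReal) < et := by
      rw [truncStd, div_lt_iff₀ hpos, ← stdNormalCDF_strictMono.lt_iff_lt, het']
      constructor <;> intro h <;> linarith
    simp only [Set.mem_ofPred_eq, Set.mem_Ioo, h1, h2]
    exact ⟨fun h => h.2, fun h => ⟨⟨hes.1.trans_lt h.1, h.2.trans_le het.2⟩, h⟩⟩
  rw [hset, hopen hle, hopen h.le, hes', het']
  ring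

/-- The truncated normal distribution function is injective, so it has no atoms as a pivot. -/
lemma gaussianReal_truncStd_eq {lo hi : EReal} (h : lo < hi) (t : ℝ) :
    gaussianReal 0 1 {z : ℝ | truncStd z lo hi = t} = 0 := by
  have hpos : 0 < stdNormalCDF hi - stdNormalCDF lo := sub_pos.2 (stdNormalCDF_strictMono h)
  refine Set.Subsingleton.induction_on (p := fun s => gaussianReal 0 1 s = 0) ?_ (by simp)
    gaussianReal_singleton
  intro z hz z' hz'
  simp only [Set.mem_ofPred_eq, truncStd] at hz hz'
  have := hz.trans hz'.symm
  rw [div_left_inj' hpos.ne'] at this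
  exact EReal.coe_injective (stdNormalCDF_strictMono.injective (by linarith))

/-- Division by a positive scale after a shift, as a continuous increasing map of the extended
reals. -/
lemma ereal_standardize_strictMono (m : ℝ) {v : ℝ} (hv : 0 < v) :
    StrictMono fun x : EReal => (x - (m : EReal)) / (v : EReal) := by
  intro x y hxy
  refine EReal.strictMono_div_right_of_pos (by exact_mod_cast hv) (EReal.coe_ne_top _) ?_
  induction x <;> induction y <;> simp_all [← EReal.coe_sub]

/-- The weight `∫_s e^{m (z - x)} dΦ(z)` that a normal law with mean `m` gives to `s`, up to a
factor that does not depend on `s`. -/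
noncomputable def tiltMass (x : ℝ) (s : Set ℝ) (m : ℝ) : ℝ :=
  ∫ z in s, Real.exp (m * (z - x)) ∂(gaussianReal 0 1)

lemma integrable_tilt (x m : ℝ) :
    Integrable (fun z : ℝ => Real.exp (m * (z - x))) (gaussianReal 0 1) := by
  have := (integrable_exp_mul_gaussianReal (μ := 0) (v := 1) m).mul_const (Real.exp (-(m * x)))
  refine this.congr (Eventually.of_forall fun z => ?_)
  simp only [← Real.exp_add]; ring_nf

lemma gaussianReal_real_eq_tiltMass (x m : ℝ) {s : Set ℝ} (hs : MeasurableSet s) :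
    (gaussianReal m 1).real s = Real.exp (m * x - m ^ 2 / 2) * tiltMass x s m := by
  have h1 : (gaussianReal m 1).real s = ∫ z in s, gaussianPDFReal m 1 z := by
    rw [measureReal_def, gaussianReal_apply_eq_integral m one_ne_zero,
      ENNReal.toReal_ofReal (integral_nonneg fun z => gaussianPDFReal_nonneg _ _ _)]
  have h2 : tiltMass x s m = ∫ z in s, gaussianPDFReal 0 1 z * Real.exp (m * (z - x)) := by
    rw [tiltMass, ← integral_indicator hs, ← integral_indicator hs,
      integral_gaussianReal_eq_integral_smul one_ne_zero]
    refine integral_congr_ae (Eventually.of_forall fun z => ?_)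
    by_cases hz : z ∈ s <;> simp [hz]
  rw [h1, h2, ← integral_const_mul]
  refine integral_congr_ae (Eventually.of_forall fun z => ?_)
  simp only [gaussianPDFReal]
  rw [mul_left_comm, mul_assoc, mul_assoc, ← Real.exp_add, ← Real.exp_add]
  congr 2
  simp only [NNReal.coe_one]
  ring

lemma tendsto_integral_exp_mul_neg {s : Set ℝ} (hs : MeasurableSet s) {k : ℝ → ℝ}
    (hk : Measurable k) (hneg : ∀ z ∈ s, k z ≤ 0) (hae : ∀ᵐ z ∂(gaussianReal 0 1), k z ≠ 0) :
    Tendsto (fun m : ℝ => ∫ z in s, Real.exp (m * k z) ∂(gaussianReal 0 1)) atTop (𝓝 0) := by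
  suffices h : Tendsto (fun m : ℝ => ∫ z in s, Real.exp (m * k z) ∂(gaussianReal 0 1)) atTop
      (𝓝 (∫ z in s, (0 : ℝ) ∂(gaussianReal 0 1))) by simpa using h
  refine tendsto_integral_filter_of_dominated_convergence (fun _ => (1 : ℝ)) ?_ ?_ ?_ ?_
  · exact Eventually.of_forall fun m => by
      exact ((hk.const_mul m).exp).aestronglyMeasurable
  · filter_upwards [eventually_ge_atTop (0 : ℝ)] with m hm
    rw [ae_restrict_iff' hs]
    refine Eventually.of_forall fun z hz => ?_
    rw [Real.norm_eq_abs, Real.abs_exp, Real.exp_le_one_iff]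
    exact mul_nonpos_of_nonneg_of_nonpos hm (hneg z hz)
  · exact integrable_const _
  · rw [ae_restrict_iff' hs]
    filter_upwards [hae] with z hz hzs
    have : k z < 0 := lt_of_le_of_ne (hneg z hzs) hz
    exact Real.tendsto_exp_atBot.comp (tendsto_id.atTop_mul_const_of_neg this)

lemma stdNormalCDF_sub_shift {lo hi : EReal} (h : lo ≤ hi) (m : ℝ) :
    stdNormalCDF (hi - m) - stdNormalCDF (lo - m) =
      (gaussianReal m 1).real {z : ℝ | lo < z ∧ (z : EReal) ≤ hi} := by
  have hm : gaussianReal m 1 = (gaussianReal 0 1).map (fun z => z + m) := by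
    rw [gaussianReal_map_add_const, zero_add]
  have hle : lo - (m : EReal) ≤ hi - m := EReal.sub_le_sub h le_rfl
  rw [stdNormalCDF_sub hle, hm, map_measureReal_apply (by fun_prop)]
  · congr 1
    ext z
    have e1 : lo - (m : EReal) < z ↔ lo < ((z + m : ℝ) : EReal) := by
      rw [EReal.coe_add, EReal.sub_lt_iff] <;> simp
    have e2 : (z : EReal) ≤ hi - (m : EReal) ↔ ((z + m : ℝ) : EReal) ≤ hi := by
      rw [EReal.coe_add, EReal.le_sub_iff_add_le] <;> simp
    simp [e1, e2]
  · exact (measurableSet_lt measurable_const measurable_coe_real_ereal).inter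
      (measurableSet_coe_le hi)

lemma tiltMass_pos (x : ℝ) {lo hi : EReal} (h : lo < hi) (m : ℝ) :
    0 < tiltMass x {z : ℝ | lo < z ∧ (z : EReal) ≤ hi} m := by
  have hlt : (lo - (m : EReal)) < hi - m := by
    have := ereal_standardize_strictMono m one_pos h
    simpa using this
  have h1 := sub_pos.2 (stdNormalCDF_strictMono hlt)
  rw [stdNormalCDF_sub_shift h.le, gaussianReal_real_eq_tiltMass x] at h1
  · exact (mul_pos_iff_of_pos_left (Real.exp_pos _)).1 h1
  · exact (measurableSet_lt measurable_const measurable_coe_real_ereal).inter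
      (measurableSet_coe_le hi)

/-- As a function of the mean the truncated normal distribution function is a ratio
`D / (D + N)` of tilted masses below and above the observation. -/
lemma truncStd_shift_eq {x : ℝ} {lo hi : EReal} (h1 : lo < x) (h2 : (x : EReal) < hi) (m : ℝ) :
    truncStd ((x : EReal) - m) (lo - m) (hi - m) =
      tiltMass x {z : ℝ | lo < z ∧ (z : EReal) ≤ x} m /
        (tiltMass x {z : ℝ | lo < z ∧ (z : EReal) ≤ x} m +
          tiltMass x {z : ℝ | (x : EReal) < z ∧ (z : EReal) ≤ hi} m) := by
  have hms : ∀ a b : EReal, MeasurableSet {z : ℝ | a < z ∧ (z : EReal) ≤ b} := fun a b =>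
    (measurableSet_lt measurable_const measurable_coe_real_ereal).inter (measurableSet_coe_le b)
  have hsum : stdNormalCDF (hi - m) - stdNormalCDF (lo - m) =
      (stdNormalCDF ((x : EReal) - m) - stdNormalCDF (lo - m)) +
        (stdNormalCDF (hi - m) - stdNormalCDF ((x : EReal) - m)) := by ring
  rw [truncStd, hsum, stdNormalCDF_sub_shift h1.le, stdNormalCDF_sub_shift h2.le,
    gaussianReal_real_eq_tiltMass x m (hms _ _), gaussianReal_real_eq_tiltMass x m (hms _ _),
    ← mul_add, mul_div_mul_left _ _ (Real.exp_pos _).ne']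

lemma antitone_truncStd_shift {x : ℝ} {lo hi : EReal} (h1 : lo < x) (h2 : (x : EReal) < hi) :
    Antitone fun m : ℝ => truncStd ((x : EReal) - m) (lo - m) (hi - m) := by
  have hms : ∀ a b : EReal, MeasurableSet {z : ℝ | a < z ∧ (z : EReal) ≤ b} := fun a b =>
    (measurableSet_lt measurable_const measurable_coe_real_ereal).inter (measurableSet_coe_le b)
  intro m m' hm
  simp only [truncStd_shift_eq h1 h2]
  have a1 := tiltMass_pos x h1 m
  have a2 := tiltMass_pos x h1 m'
  have b1 := tiltMass_pos x h2 m
  have b2 := tiltMass_pos x h2 m'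
  have c1 : tiltMass x {z : ℝ | lo < z ∧ (z : EReal) ≤ x} m' ≤
      tiltMass x {z : ℝ | lo < z ∧ (z : EReal) ≤ x} m := by
    refine setIntegral_mono_on (integrable_tilt x m').integrableOn
      (integrable_tilt x m).integrableOn (hms _ _) fun z hz => ?_
    have hz' : z ≤ x := by exact_mod_cast hz.2
    exact Real.exp_le_exp.2 (by nlinarith)
  have c2 : tiltMass x {z : ℝ | (x : EReal) < z ∧ (z : EReal) ≤ hi} m ≤
      tiltMass x {z : ℝ | (x : EReal) < z ∧ (z : EReal) ≤ hi} m' := by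
    refine setIntegral_mono_on (integrable_tilt x m).integrableOn
      (integrable_tilt x m').integrableOn (hms _ _) fun z hz => ?_
    have hz' : x < z := by exact_mod_cast hz.1
    exact Real.exp_le_exp.2 (by nlinarith)
  rw [div_le_div_iff₀ (by positivity) (by positivity)]
  nlinarith [mul_le_mul c1 c2 b1.le a1.le]

lemma continuous_truncStd_shift {x : ℝ} {lo hi : EReal} (h1 : lo < x) (h2 : (x : EReal) < hi) :
    Continuous fun m : ℝ => truncStd ((x : EReal) - m) (lo - m) (hi - m) := by
  have hc : ∀ e : EReal, Continuous fun m : ℝ => e - (m : EReal) := by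
    intro e
    have hneg : Continuous fun m : ℝ => ((-m : ℝ) : EReal) :=
      continuous_coe_real_ereal.comp continuous_neg
    refine continuous_iff_continuousAt.2 fun m => ?_
    have hadd : ContinuousAt (fun p : EReal × EReal => p.1 + p.2) (e, ((-m : ℝ) : EReal)) :=
      EReal.continuousAt_add (by simp) (by simp)
    have := hadd.comp (f := fun m : ℝ => (e, ((-m : ℝ) : EReal))) (x := m)
      (continuousAt_const.prodMk hneg.continuousAt)
    refine this.congr (Eventually.of_forall fun m => ?_)
    simp [sub_eq_add_neg]
  have hlt : ∀ m : ℝ, lo - (m : EReal) < hi - m := fun m => by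
    simpa using ereal_standardize_strictMono m one_pos (h1.trans h2)
  refine Continuous.div ?_ ?_ fun m => ?_
  · exact (continuous_stdNormalCDF.comp (hc _)).sub (continuous_stdNormalCDF.comp (hc _))
  · exact (continuous_stdNormalCDF.comp (hc _)).sub (continuous_stdNormalCDF.comp (hc _))
  · exact (sub_pos.2 (stdNormalCDF_strictMono (hlt m))).ne'

lemma tendsto_tiltMass_below (x : ℝ) (lo : EReal) :
    Tendsto (tiltMass x {z : ℝ | lo < z ∧ (z : EReal) ≤ x}) atTop (𝓝 0) := by
  refine tendsto_integral_exp_mul_neg (k := fun z => z - x) ?_ (by fun_prop) ?_ ?_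
  · exact (measurableSet_lt measurable_const measurable_coe_real_ereal).inter
      (measurableSet_coe_le _)
  · intro z hz
    have hz' : z ≤ x := by exact_mod_cast hz.2
    linarith
  · rw [ae_iff]; simpa [sub_eq_zero] using gaussianReal_singleton x

lemma tendsto_tiltMass_above (x : ℝ) (hi : EReal) :
    Tendsto (tiltMass x {z : ℝ | (x : EReal) < z ∧ (z : EReal) ≤ hi}) atBot (𝓝 0) := by
  have : Tendsto (fun m : ℝ => ∫ z in {z : ℝ | (x : EReal) < z ∧ (z : EReal) ≤ hi},
      Real.exp (m * (x - z)) ∂(gaussianReal 0 1)) atTop (𝓝 0) := by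
    refine tendsto_integral_exp_mul_neg (k := fun z => x - z) ?_ (by fun_prop) ?_ ?_
    · exact (measurableSet_lt measurable_const measurable_coe_real_ereal).inter
        (measurableSet_coe_le _)
    · intro z hz
      have hz' : x < z := by exact_mod_cast hz.1
      linarith
    · rw [ae_iff]; simpa [sub_eq_zero, eq_comm] using gaussianReal_singleton x
  refine (this.comp tendsto_neg_atBot_atTop).congr fun m => ?_
  simp only [Function.comp, tiltMass]
  congr 1; ext z; ring_nf

lemma tendsto_truncStd_shift_atTop {x : ℝ} {lo hi : EReal} (h1 : lo < x) (h2 : (x : EReal) < hi) :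
    Tendsto (fun m : ℝ => truncStd ((x : EReal) - m) (lo - m) (hi - m)) atTop (𝓝 0) := by
  have hms : ∀ a b : EReal, MeasurableSet {z : ℝ | a < z ∧ (z : EReal) ≤ b} := fun a b =>
    (measurableSet_lt measurable_const measurable_coe_real_ereal).inter (measurableSet_coe_le b)
  set N0 := tiltMass x {z : ℝ | (x : EReal) < z ∧ (z : EReal) ≤ hi} 0 with hN0
  have hN0pos : 0 < N0 := tiltMass_pos x h2 0
  have hlim := (tendsto_tiltMass_below x lo).div_const N0
  rw [zero_div] at hlim
  refine squeeze_zero' ?_ ?_ hlim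
  · refine Eventually.of_forall fun m => ?_
    rw [truncStd_shift_eq h1 h2]
    have a1 := tiltMass_pos x h1 m
    have b1 := tiltMass_pos x h2 m
    positivity
  · filter_upwards [eventually_ge_atTop (0 : ℝ)] with m hm
    rw [truncStd_shift_eq h1 h2]
    have a1 := tiltMass_pos x h1 m
    have b1 : N0 ≤ tiltMass x {z : ℝ | (x : EReal) < z ∧ (z : EReal) ≤ hi} m := by
      refine setIntegral_mono_on (integrable_tilt x 0).integrableOn
        (integrable_tilt x m).integrableOn (hms _ _) fun z hz => ?_
      have hz' : x < z := by exact_mod_cast hz.1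
      exact Real.exp_le_exp.2 (by nlinarith)
    exact div_le_div_of_nonneg_left a1.le hN0pos (by linarith)

lemma tendsto_truncStd_shift_atBot {x : ℝ} {lo hi : EReal} (h1 : lo < x) (h2 : (x : EReal) < hi) :
    Tendsto (fun m : ℝ => truncStd ((x : EReal) - m) (lo - m) (hi - m)) atBot (𝓝 1) := by
  have hms : ∀ a b : EReal, MeasurableSet {z : ℝ | a < z ∧ (z : EReal) ≤ b} := fun a b =>
    (measurableSet_lt measurable_const measurable_coe_real_ereal).inter (measurableSet_coe_le b)
  set D0 := tiltMass x {z : ℝ | lo < z ∧ (z : EReal) ≤ x} 0 with hD0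
  have hD0pos : 0 < D0 := tiltMass_pos x h1 0
  have hlim := ((tendsto_tiltMass_above x hi).div_const D0).const_sub 1
  rw [zero_div, sub_zero] at hlim
  refine tendsto_of_tendsto_of_tendsto_of_le_of_le' hlim tendsto_const_nhds ?_ ?_
  · filter_upwards [eventually_le_atBot (0 : ℝ)] with m hm
    rw [truncStd_shift_eq h1 h2]
    have a1 := tiltMass_pos x h1 m
    have b1 := tiltMass_pos x h2 m
    have c1 : D0 ≤ tiltMass x {z : ℝ | lo < z ∧ (z : EReal) ≤ x} m := by
      refine setIntegral_mono_on (integrable_tilt x 0).integrableOn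
        (integrable_tilt x m).integrableOn (hms _ _) fun z hz => ?_
      have hz' : z ≤ x := by exact_mod_cast hz.2
      exact Real.exp_le_exp.2 (by nlinarith)
    have : tiltMass x {z : ℝ | lo < z ∧ (z : EReal) ≤ x} m /
        (tiltMass x {z : ℝ | lo < z ∧ (z : EReal) ≤ x} m +
          tiltMass x {z : ℝ | (x : EReal) < z ∧ (z : EReal) ≤ hi} m) =
        1 - tiltMass x {z : ℝ | (x : EReal) < z ∧ (z : EReal) ≤ hi} m /
        (tiltMass x {z : ℝ | lo < z ∧ (z : EReal) ≤ x} m +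
          tiltMass x {z : ℝ | (x : EReal) < z ∧ (z : EReal) ≤ hi} m) := by
      field_simp; ring
    rw [this]
    exact sub_le_sub_left (div_le_div_of_nonneg_left b1.le hD0pos (by linarith)) 1
  · refine Eventually.of_forall fun m => ?_
    rw [truncStd_shift_eq h1 h2]
    have a1 := tiltMass_pos x h1 m
    have b1 := tiltMass_pos x h2 m
    rw [div_le_one (by positivity)]
    linarith

lemma truncCDF_eq_truncStd {x μ v : ℝ} (lo hi : EReal) :
    truncCDF x μ v lo hi =
      truncStd (((x - μ) / √v : ℝ) : EReal) ((lo - (μ : EReal)) / ((√v : ℝ) : EReal))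
        ((hi - (μ : EReal)) / ((√v : ℝ) : EReal)) := rfl

/-- Splitting the standardization `(x - μ) / σ` into a scaling and a shift. -/
lemma ereal_standardize_eq (e : EReal) (μ : ℝ) {s : ℝ} (hs : 0 < s) :
    (e - (μ : EReal)) / (s : EReal) = e / (s : EReal) - ((μ / s : ℝ) : EReal) := by
  induction e with
  | bot => simp [EReal.bot_div_of_pos_ne_top (by exact_mod_cast hs) (EReal.coe_ne_top s)]
  | coe e =>
    rw [← EReal.coe_sub, ← EReal.coe_div, ← EReal.coe_div, ← EReal.coe_sub, sub_div]
  | top => simp [EReal.top_div_of_pos_ne_top (by exact_mod_cast hs) (EReal.coe_ne_top s)]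

/-- Test inversion: if the observation `x` lies strictly between the truncation limits, then the
means between the two quantile solutions are those at which the truncated normal distribution
function lies between `ζ/2` and `1 - ζ/2`. -/
lemma exists_quantiles_iff {x v k : ℝ} (hv : 0 < v) (hk : 0 < k) {lo hi : EReal}
    (h1 : lo < x) (h2 : (x : EReal) < hi) {ζ : ℝ} (hζ : ζ ∈ Set.Ioo (0 : ℝ) 1) (q : ℝ) :
    (∃ ql qu : ℝ, truncCDF x (k * ql) v lo hi = 1 - ζ / 2 ∧
      truncCDF x (k * qu) v lo hi = ζ / 2 ∧ q ∈ Set.Icc ql qu) ↔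
    truncCDF x (k * q) v lo hi ∈ Set.Icc (ζ / 2) (1 - ζ / 2) := by
  obtain ⟨hζ0, hζ1⟩ := hζ
  set s := √v with hs
  have hspos : 0 < s := Real.sqrt_pos.2 hv
  have hspos' : (0 : EReal) < (s : EReal) := by exact_mod_cast hspos
  set T : ℝ → ℝ := fun m =>
    truncStd (((x / s : ℝ) : EReal) - m) (lo / (s : EReal) - m) (hi / (s : EReal) - m) with hT
  have hd : StrictMono fun e : EReal => e / (s : EReal) :=
    EReal.strictMono_div_right_of_pos hspos' (EReal.coe_ne_top _)
  have h1' : lo / (s : EReal) < ((x / s : ℝ) : EReal) := by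
    rw [EReal.coe_div]; exact hd h1
  have h2' : ((x / s : ℝ) : EReal) < hi / (s : EReal) := by
    rw [EReal.coe_div]; exact hd h2
  have hF : ∀ q : ℝ, truncCDF x (k * q) v lo hi = T (k * q / s) := by
    intro q
    rw [truncCDF_eq_truncStd, ← hs, ereal_standardize_eq _ _ hspos, ereal_standardize_eq _ _ hspos,
      hT, sub_div, EReal.coe_sub]
  have hanti : Antitone T := antitone_truncStd_shift h1' h2'
  have hcont : Continuous T := continuous_truncStd_shift h1' h2'
  have htop : Tendsto T atTop (𝓝 0) := tendsto_truncStd_shift_atTop h1' h2'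
  have hbot : Tendsto T atBot (𝓝 1) := tendsto_truncStd_shift_atBot h1' h2'
  have hle : ∀ a b : ℝ, a ≤ b → k * a / s ≤ k * b / s := fun a b hab => by gcongr
  have hinv : ∀ m : ℝ, k * (s * m / k) / s = m := fun m => by field_simp
  have hle' : ∀ a b : ℝ, k * a / s ≤ k * b / s → a ≤ b := fun a b hab => by
    rw [div_le_div_iff_of_pos_right hspos] at hab
    exact le_of_mul_le_mul_left hab hk
  simp only [hF]
  constructor
  · rintro ⟨ql, qu, hl, hu, hq⟩
    exact ⟨hu ▸ hanti (hle _ _ hq.2), hl ▸ hanti (hle _ _ hq.1)⟩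
  · rintro ⟨hl, hu⟩
    set m := k * q / s with hm
    obtain ⟨a, ha, ham⟩ :=
      (((hbot.eventually (lt_mem_nhds (show 1 - ζ / 2 < 1 by linarith))).and
        (eventually_le_atBot m))).exists
    obtain ⟨b, hb, hbm⟩ :=
      (((htop.eventually (gt_mem_nhds (show 0 < ζ / 2 by linarith))).and
        (eventually_ge_atTop m))).exists
    obtain ⟨ml, hml, hml'⟩ := intermediate_value_Icc' ham hcont.continuousOn ⟨hu, ha.le⟩
    obtain ⟨mu, hmu, hmu'⟩ := intermediate_value_Icc' hbm hcont.continuousOn ⟨hb.le, hl⟩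
    refine ⟨s * ml / k, s * mu / k, by rw [hinv, hml'], by rw [hinv, hmu'], hle' _ _ ?_, hle' _ _ ?_⟩
    · rw [hinv]; exact hml.2
    · rw [hinv]; exact hmu.1

/-! ### Centered Gaussian vectors -/

section Gaussian

variable {ι : Type*} [Fintype ι] [DecidableEq ι]

/-- The centered Gaussian law with covariance matrix `S` on `ι → ℝ`. -/
noncomputable def gaussianPi (S : Matrix ι ι ℝ) : Measure (ι → ℝ) :=
  (multivariateGaussian (0 : EuclideanSpace ℝ ι) S).map WithLp.ofLp

instance (S : Matrix ι ι ℝ) : IsProbabilityMeasure (gaussianPi S) :=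
  Measure.isProbabilityMeasure_map (by fun_prop)

lemma charFun_map_toLp (μ : Measure (ι → ℝ)) (t : EuclideanSpace ℝ ι) :
    charFun (μ.map (WithLp.toLp 2)) t =
      ∫ w, Complex.exp (((t.ofLp ⬝ᵥ w : ℝ) : ℂ) * Complex.I) ∂μ := by
  rw [charFun_apply, integral_map (by fun_prop) (by fun_prop)]
  refine integral_congr_ae (Eventually.of_forall fun w => ?_)
  simp [PiLp.inner_apply, dotProduct, mul_comm]

lemma integral_exp_gaussianPi {S : Matrix ι ι ℝ} (hS : S.PosSemidef) (t : ι → ℝ) :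
    ∫ w, Complex.exp (((t ⬝ᵥ w : ℝ) : ℂ) * Complex.I) ∂(gaussianPi S) =
      Complex.exp (-((t ⬝ᵥ S *ᵥ t : ℝ) : ℂ) / 2) := by
  have h := charFun_map_toLp (gaussianPi S) (WithLp.toLp 2 t)
  rw [← h, gaussianPi, Measure.map_map (by fun_prop) (by fun_prop)]
  have : (WithLp.toLp 2 ∘ WithLp.ofLp : EuclideanSpace ℝ ι → EuclideanSpace ℝ ι) = id := rfl
  rw [this, Measure.map_id, charFun_multivariateGaussian hS]
  congr 1
  simp [neg_div]

lemma measure_ext_of_integral_exp {μ ν : Measure (ι → ℝ)} [IsFiniteMeasure μ] [IsFiniteMeasure ν]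
    (h : ∀ t : ι → ℝ, ∫ w, Complex.exp (((t ⬝ᵥ w : ℝ) : ℂ) * Complex.I) ∂μ =
      ∫ w, Complex.exp (((t ⬝ᵥ w : ℝ) : ℂ) * Complex.I) ∂ν) : μ = ν := by
  have h1 : μ.map (WithLp.toLp 2) = (ν.map (WithLp.toLp 2) : Measure (EuclideanSpace ℝ ι)) := by
    apply Measure.ext_of_charFun
    ext t
    rw [charFun_map_toLp, charFun_map_toLp, h]
  have h2 := congrArg (fun m => Measure.map WithLp.ofLp m) h1
  simp only [Measure.map_map (WithLp.measurable_ofLp 2 (ι → ℝ)) (WithLp.measurable_toLp 2 (ι → ℝ))] at h2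
  have hid : (WithLp.ofLp ∘ WithLp.toLp 2 : (ι → ℝ) → (ι → ℝ)) = id := rfl
  rwa [hid, Measure.map_id, Measure.map_id] at h2

lemma gaussianPi_map_dotProduct {S : Matrix ι ι ℝ} (hS : S.PosSemidef) (b : ι → ℝ) :
    (gaussianPi S).map (fun w => b ⬝ᵥ w) = gaussianReal 0 (b ⬝ᵥ S *ᵥ b).toNNReal := by
  have hnn : 0 ≤ b ⬝ᵥ S *ᵥ b := by simpa using hS.dotProduct_mulVec_nonneg b
  apply Measure.ext_of_charFun
  ext s
  rw [charFun_apply_real, integral_map (by fun_prop) (by fun_prop), charFun_gaussianReal]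
  have := integral_exp_gaussianPi hS (s • b)
  simp only [smul_dotProduct, mulVec_smul, dotProduct_smul, smul_eq_mul] at this
  push_cast at this
  rw [this, Real.coe_toNNReal _ hnn]
  congr 1
  push_cast
  ring

lemma posDef_dotProduct_pos {S : Matrix ι ι ℝ} (hS : S.PosDef) {b : ι → ℝ} (hb : b ≠ 0) :
    0 < b ⬝ᵥ S *ᵥ b := by
  simpa using hS.dotProduct_mulVec_pos hb

lemma gaussianPi_hyperplane {S : Matrix ι ι ℝ} (hS : S.PosDef) {b : ι → ℝ} (hb : b ≠ 0) (x : ℝ) :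
    gaussianPi S {w | b ⬝ᵥ w = x} = 0 := by
  have hpos : 0 < b ⬝ᵥ S *ᵥ b := posDef_dotProduct_pos hS hb
  have h := gaussianPi_map_dotProduct hS.posSemidef b
  have h2 : (gaussianPi S).map (fun w => b ⬝ᵥ w) {x} = 0 := by
    rw [h]
    exact gaussianReal_absolutelyContinuous 0 (by simpa using hpos) (by simp)
  rwa [Measure.map_apply (by fun_prop) (measurableSet_singleton x)] at h2

instance isOpenPosMeasure_pi_gaussianReal :
    (Measure.pi fun _ : ι => gaussianReal 0 1).IsOpenPosMeasure := by
  have : (gaussianReal 0 1).IsOpenPosMeasure :=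
    (gaussianReal_absolutelyContinuous' 0 one_ne_zero).isOpenPosMeasure
  infer_instance

open scoped MatrixOrder Matrix.Norms.L2Operator in
/-- A nondegenerate Gaussian law charges every nonempty open set. -/
lemma gaussianPi_pos_of_isOpen {S : Matrix ι ι ℝ} (hS : S.PosDef) {A : Set (ι → ℝ)}
    (hA : IsOpen A) (hne : A.Nonempty) : 0 < gaussianPi S A := by
  -- the law is the image of a standard Gaussian vector under an invertible root of `S`
  obtain ⟨B, hBu, hB⟩ : ∃ B : Matrix ι ι ℝ, IsUnit B ∧ S = B * Bᵀ := by
    refine ⟨CFC.sqrt S, ?_, ?_⟩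
    · exact (CFC.isUnit_sqrt_iff S hS.posSemidef.nonneg).2 hS.isUnit
    · have h1 : (CFC.sqrt S)ᵀ = CFC.sqrt S := by
        have := (CFC.sqrt_nonneg S).isSelfAdjoint
        simpa [IsSelfAdjoint, star_eq_conjTranspose] using this
      rw [h1, CFC.sqrt_mul_sqrt_self _ hS.posSemidef.nonneg]
  have hmap : (Measure.pi fun _ : ι => gaussianReal 0 1).map (fun v => B *ᵥ v) = gaussianPi S := by
    apply measure_ext_of_integral_exp
    intro t
    rw [integral_exp_gaussianPi hS.posSemidef, integral_map (by fun_prop) (by fun_prop)]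
    have h0 := charFun_map_toLp (Measure.pi fun _ : ι => gaussianReal 0 1)
      (WithLp.toLp 2 (t ᵥ* B))
    rw [map_pi_eq_stdGaussian, charFun_stdGaussian] at h0
    simp only [dotProduct_mulVec] at h0 ⊢
    rw [← h0]
    have hnorm : ‖(WithLp.toLp 2 (t ᵥ* B) : EuclideanSpace ℝ ι)‖ ^ 2 = t ᵥ* S ⬝ᵥ t := by
      rw [EuclideanSpace.real_norm_sq_eq, hB, ← vecMul_vecMul, ← dotProduct_mulVec,
        mulVec_transpose]
      simp [dotProduct, sq]
    rw [← hnorm]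
    push_cast
    rfl
  rw [← hmap, Measure.map_apply (by fun_prop) hA.measurableSet]
  refine (hA.preimage (by fun_prop)).measure_pos _ ?_
  obtain ⟨w, hw⟩ := hne
  refine ⟨B⁻¹ *ᵥ w, ?_⟩
  simp only [Set.mem_preimage, mulVec_mulVec]
  rwa [mul_nonsing_inv _ ((isUnit_iff_isUnit_det B).1 hBu), one_mulVec]

/-- A Gaussian vector splits into a standard normal variable `h'w` in the direction `S h` and an
independent remainder: replacing `h'w` by a fresh standard normal variable does not change the
law. -/
lemma gaussianPi_resample {S : Matrix ι ι ℝ} (hS : S.PosSemidef) {h : ι → ℝ}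
    (hh : h ⬝ᵥ S *ᵥ h = 1) :
    ((gaussianReal 0 1).prod (gaussianPi S)).map
      (fun q : ℝ × (ι → ℝ) => q.2 + (q.1 - h ⬝ᵥ q.2) • (S *ᵥ h)) = gaussianPi S := by
  have : IsProbabilityMeasure (((gaussianReal 0 1).prod (gaussianPi S)).map
      (fun q : ℝ × (ι → ℝ) => q.2 + (q.1 - h ⬝ᵥ q.2) • (S *ᵥ h))) :=
    Measure.isProbabilityMeasure_map (by fun_prop)
  have hsymm : ∀ u v : ι → ℝ, u ⬝ᵥ S *ᵥ v = v ⬝ᵥ S *ᵥ u := by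
    intro u v
    have : Sᵀ = S := by simpa [IsHermitian] using hS.isHermitian
    rw [dotProduct_mulVec, ← mulVec_transpose, this, dotProduct_comm]
  apply measure_ext_of_integral_exp
  intro t
  rw [integral_exp_gaussianPi hS, integral_map (by fun_prop) (by fun_prop)]
  set κ := t ⬝ᵥ S *ᵥ h with hκ
  have hsplit : ∀ q : ℝ × (ι → ℝ),
      Complex.exp (((t ⬝ᵥ (q.2 + (q.1 - h ⬝ᵥ q.2) • (S *ᵥ h)) : ℝ) : ℂ) * Complex.I) =
        Complex.exp (((κ : ℝ) : ℂ) * q.1 * Complex.I) *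
          Complex.exp ((((t - κ • h) ⬝ᵥ q.2 : ℝ) : ℂ) * Complex.I) := by
    intro q
    rw [← Complex.exp_add, dotProduct_add, dotProduct_smul, sub_dotProduct, smul_dotProduct, ← hκ]
    congr 1
    simp only [smul_eq_mul]
    push_cast
    ring
  simp only [hsplit]
  rw [integral_prod_mul (fun z : ℝ => Complex.exp (((κ : ℝ) : ℂ) * z * Complex.I))
    (fun w : ι → ℝ => Complex.exp ((((t - κ • h) ⬝ᵥ w : ℝ) : ℂ) * Complex.I)),
    integral_exp_gaussianPi hS, ← charFun_apply_real, charFun_gaussianReal, ← Complex.exp_add]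
  congr 1
  have : (t - κ • h) ⬝ᵥ S *ᵥ (t - κ • h) = t ⬝ᵥ S *ᵥ t - κ ^ 2 := by
    simp only [mulVec_sub, mulVec_smul, dotProduct_sub, sub_dotProduct, smul_dotProduct,
      dotProduct_smul, smul_eq_mul, hh, hsymm h t, ← hκ]
    ring
  rw [this]
  push_cast
  ring

end Gaussian

/-! ### Polyhedral conditioning of a Gaussian vector -/

section Rows

variable {ι J : Type*} [Fintype ι] [Fintype J] (S : Matrix ι ι ℝ) (h : ι → ℝ)
  (α : J → EReal) (β : J → ι → ℝ)

/-- Slack of the affine constraint `0 < α j + β j ⬝ w`; `α j = ⊤` encodes a void constraint. -/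
noncomputable def rowSlack (j : J) (w : ι → ℝ) : EReal := α j + ((β j ⬝ᵥ w : ℝ) : EReal)

/-- Rate at which the slack of a constraint decreases in the direction `S h`. -/
noncomputable def rowSlope (j : J) : ℝ := -(β j ⬝ᵥ S *ᵥ h)

/-- The value that `h ⬝ w` has where the line through `w` with direction `S h` meets the boundary of
the constraint. -/
noncomputable def rowCut (j : J) (w : ι → ℝ) : EReal :=
  ((h ⬝ᵥ w : ℝ) : EReal) + rowSlack α β j w / (rowSlope S h β j : EReal)

/-- Lower end of the range of `h ⬝ w` on the line through `w` with direction `S h`. -/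
noncomputable def rowLower (w : ι → ℝ) : EReal :=
  ⨆ j : J, if rowSlope S h β j < 0 then rowCut S h α β j w else ⊥

/-- Upper end of the range of `h ⬝ w` on the line through `w` with direction `S h`. -/
noncomputable def rowUpper (w : ι → ℝ) : EReal :=
  ⨅ j : J, if 0 < rowSlope S h β j then rowCut S h α β j w else ⊤

/-- The polyhedron of points at which all constraints are strictly slack. -/
def rowRegion : Set (ι → ℝ) := {w | ∀ j, 0 < rowSlack α β j w}

/-- The pivot: `h ⬝ w` transformed by the truncated standard normal distribution function. -/
noncomputable def rowPivot (w : ι → ℝ) : ℝ :=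
  truncStd ((h ⬝ᵥ w : ℝ) : EReal) (rowLower S h α β w) (rowUpper S h α β w)

variable {S h α β}

lemma lt_iInf_fintype {x : EReal} (hx : x < ⊤) {f : J → EReal} :
    x < ⨅ j, f j ↔ ∀ j, x < f j := by
  rw [← Finset.inf_univ_eq_iInf, Finset.lt_inf_iff hx]
  simp

lemma iSup_lt_fintype {x : EReal} (hx : ⊥ < x) {f : J → EReal} :
    ⨆ j, f j < x ↔ ∀ j, f j < x := by
  rw [← Finset.sup_univ_eq_iSup, Finset.sup_lt_iff hx]
  simp

lemma lt_rowCut_iff {j : J} (hα : α j ≠ ⊥) (hd : 0 < rowSlope S h β j) (w : ι → ℝ) :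
    ((h ⬝ᵥ w : ℝ) : EReal) < rowCut S h α β j w ↔ 0 < rowSlack α β j w := by
  unfold rowCut rowSlack
  generalize rowSlope S h β j = d at *
  generalize α j = a at *
  induction a with
  | bot => exact absurd rfl hα
  | top =>
    simp [EReal.top_div_of_pos_ne_top (show (0 : EReal) < d by exact_mod_cast hd)]
  | coe a =>
    rw [← EReal.coe_add, ← EReal.coe_div, ← EReal.coe_add, EReal.coe_lt_coe_iff]
    rw [lt_add_iff_pos_right, div_pos_iff_of_pos_right hd]
    exact_mod_cast Iff.rfl

lemma rowCut_lt_iff {j : J} (hα : α j ≠ ⊥) (hd : rowSlope S h β j < 0) (w : ι → ℝ) :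
    rowCut S h α β j w < ((h ⬝ᵥ w : ℝ) : EReal) ↔ 0 < rowSlack α β j w := by
  unfold rowCut rowSlack
  generalize rowSlope S h β j = d at *
  generalize α j = a at *
  induction a with
  | bot => exact absurd rfl hα
  | top =>
    simp [EReal.top_div_of_neg_ne_bot (show (d : EReal) < 0 by exact_mod_cast hd)]
  | coe a =>
    rw [← EReal.coe_add, ← EReal.coe_div, ← EReal.coe_add, EReal.coe_lt_coe_iff]
    rw [add_lt_iff_neg_left, div_neg_iff]
    simp only [hd, not_lt.2 hd.le, and_true, and_false, or_false]
    exact_mod_cast Iff.rfl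

/-- The cut values are constant along lines with direction `S h`. -/
lemma rowCut_add_smul {j : J} (hh : h ⬝ᵥ S *ᵥ h = 1) (hα : α j ≠ ⊥) (hd : rowSlope S h β j ≠ 0)
    (w : ι → ℝ) (s : ℝ) : rowCut S h α β j (w + s • (S *ᵥ h)) = rowCut S h α β j w := by
  have hb : β j ⬝ᵥ (w + s • (S *ᵥ h)) = β j ⬝ᵥ w - s * rowSlope S h β j := by
    simp [rowSlope, dotProduct_add, dotProduct_smul]
  unfold rowCut rowSlack
  rw [hb, dotProduct_add, dotProduct_smul, hh]
  generalize rowSlope S h β j = d at *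
  generalize α j = a at *
  induction a with
  | bot => exact absurd rfl hα
  | top =>
    rw [EReal.top_add_coe, EReal.top_add_coe]
    rcases lt_or_gt_of_ne hd with hd | hd
    · simp [EReal.top_div_of_neg_ne_bot (show (d : EReal) < 0 by exact_mod_cast hd)]
    · rw [EReal.top_div_of_pos_ne_top (show (0 : EReal) < d by exact_mod_cast hd)
        (EReal.coe_ne_top _), EReal.coe_add_top, EReal.coe_add_top]
  | coe a =>
    simp only [← EReal.coe_add, ← EReal.coe_div]
    congr 1
    simp only [smul_eq_mul]
    field_simp
    ring

lemma rowLower_add_smul (hh : h ⬝ᵥ S *ᵥ h = 1) (hα : ∀ j, α j ≠ ⊥) (w : ι → ℝ) (s : ℝ) :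
    rowLower S h α β (w + s • (S *ᵥ h)) = rowLower S h α β w := by
  refine iSup_congr fun j => ?_
  split_ifs with hd
  · exact rowCut_add_smul hh (hα j) hd.ne w s
  · rfl

lemma rowUpper_add_smul (hh : h ⬝ᵥ S *ᵥ h = 1) (hα : ∀ j, α j ≠ ⊥) (w : ι → ℝ) (s : ℝ) :
    rowUpper S h α β (w + s • (S *ᵥ h)) = rowUpper S h α β w := by
  refine iInf_congr fun j => ?_
  split_ifs with hd
  · exact rowCut_add_smul hh (hα j) hd.ne' w s
  · rfl

lemma rowSlack_add_smul_of_slope_eq_zero {j : J} (hd : rowSlope S h β j = 0)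
    (w : ι → ℝ) (s : ℝ) : rowSlack α β j (w + s • (S *ᵥ h)) = rowSlack α β j w := by
  have : β j ⬝ᵥ S *ᵥ h = 0 := by simpa [rowSlope] using hd
  simp [rowSlack, dotProduct_add, dotProduct_smul, this]

lemma mem_rowRegion_iff (hα : ∀ j, α j ≠ ⊥) (w : ι → ℝ) :
    w ∈ rowRegion α β ↔ (∀ j, rowSlope S h β j = 0 → 0 < rowSlack α β j w) ∧
      rowLower S h α β w < ((h ⬝ᵥ w : ℝ) : EReal) ∧
        ((h ⬝ᵥ w : ℝ) : EReal) < rowUpper S h α β w := by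
  rw [rowLower, rowUpper, iSup_lt_fintype (EReal.bot_lt_coe _), lt_iInf_fintype (EReal.coe_lt_top _)]
  constructor
  · intro hw
    refine ⟨fun j _ => hw j, fun j => ?_, fun j => ?_⟩
    · split_ifs with hd
      · exact (rowCut_lt_iff (hα j) hd w).2 (hw j)
      · exact EReal.bot_lt_coe _
    · split_ifs with hd
      · exact (lt_rowCut_iff (hα j) hd w).2 (hw j)
      · exact EReal.coe_lt_top _
  · rintro ⟨h0, h1, h2⟩ j
    rcases lt_trichotomy (rowSlope S h β j) 0 with hd | hd | hd
    · have := h1 j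
      rw [if_pos hd] at this
      exact (rowCut_lt_iff (hα j) hd w).1 this
    · exact h0 j hd
    · have := h2 j
      rw [if_pos hd] at this
      exact (lt_rowCut_iff (hα j) hd w).1 this

lemma measurable_rowSlack (j : J) : Measurable (rowSlack α β j) := by
  unfold rowSlack
  exact measurable_const.add (measurable_coe_real_ereal.comp (by fun_prop))

lemma measurableSet_rowRegion : MeasurableSet (rowRegion α β) := by
  have : rowRegion α β = ⋂ j, {w | 0 < rowSlack α β j w} := by
    ext w; simp [rowRegion]
  rw [this]
  exact MeasurableSet.iInter fun j => measurableSet_lt measurable_const (measurable_rowSlack j)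

lemma continuous_rowSlack {j : J} (hα : α j ≠ ⊥) : Continuous (rowSlack α β j) := by
  refine continuous_iff_continuousAt.2 fun w => ?_
  have hc : Continuous fun w : ι → ℝ => ((β j ⬝ᵥ w : ℝ) : EReal) :=
    continuous_coe_real_ereal.comp (by fun_prop)
  have hadd : ContinuousAt (fun p : EReal × EReal => p.1 + p.2)
      (α j, ((β j ⬝ᵥ w : ℝ) : EReal)) :=
    EReal.continuousAt_add (by simp) (by simp [hα])
  exact hadd.comp (f := fun w : ι → ℝ => (α j, ((β j ⬝ᵥ w : ℝ) : EReal)))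
    (continuousAt_const.prodMk hc.continuousAt)

lemma isOpen_rowRegion (hα : ∀ j, α j ≠ ⊥) : IsOpen (rowRegion α β) := by
  have : rowRegion α β = ⋂ j, {w | 0 < rowSlack α β j w} := by
    ext w; simp [rowRegion]
  rw [this]
  exact isOpen_iInter_of_finite fun j => isOpen_lt continuous_const (continuous_rowSlack (hα j))

lemma measurable_rowCut (j : J) : Measurable (rowCut S h α β j) := by
  unfold rowCut
  refine (measurable_coe_real_ereal.comp (by fun_prop)).add ?_
  simp only [div_eq_mul_inv]
  exact (measurable_rowSlack j).mul_const _

lemma measurable_rowPivot : Measurable (rowPivot S h α β) := by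
  have h1 : Measurable (rowLower S h α β) := by
    refine Measurable.iSup fun j => ?_
    split_ifs
    · exact measurable_rowCut j
    · exact measurable_const
  have h2 : Measurable (rowUpper S h α β) := by
    refine Measurable.iInf fun j => ?_
    split_ifs
    · exact measurable_rowCut j
    · exact measurable_const
  have h3 : Measurable fun w : ι → ℝ => ((h ⬝ᵥ w : ℝ) : EReal) :=
    measurable_coe_real_ereal.comp (by fun_prop)
  have hΦ := continuous_stdNormalCDF.measurable
  exact ((hΦ.comp h3).sub (hΦ.comp h1)).div ((hΦ.comp h2).sub (hΦ.comp h1))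

variable [DecidableEq ι]

/-- Fubini along the lines with direction `S h`: on each line the region is an interval of values of
`h ⬝ w`, with end points that are constant on the line. -/
lemma gaussianPi_rowRegion_inter (hS : S.PosSemidef) (hh : h ⬝ᵥ S *ᵥ h = 1) (hα : ∀ j, α j ≠ ⊥)
    {B : Set ℝ} (hB : MeasurableSet B) :
    gaussianPi S (rowRegion α β ∩ rowPivot S h α β ⁻¹' B) =
      ∫⁻ w, gaussianReal 0 1 {z : ℝ | (∀ j, rowSlope S h β j = 0 → 0 < rowSlack α β j w) ∧
        (rowLower S h α β w < z ∧ (z : EReal) < rowUpper S h α β w) ∧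
          truncStd z (rowLower S h α β w) (rowUpper S h α β w) ∈ B} ∂(gaussianPi S) := by
  have hms : MeasurableSet (rowRegion α β ∩ rowPivot S h α β ⁻¹' B) :=
    measurableSet_rowRegion.inter (measurable_rowPivot hB)
  have hmeas : Measurable fun q : ℝ × (ι → ℝ) => q.2 + (q.1 - h ⬝ᵥ q.2) • (S *ᵥ h) := by fun_prop
  conv_lhs => rw [← gaussianPi_resample hS hh]
  rw [Measure.map_apply hmeas hms, Measure.prod_apply_symm (hmeas hms)]
  refine lintegral_congr fun w => ?_
  congr 1
  ext z
  simp only [Set.mem_preimage, Set.mem_inter_iff, Set.mem_ofPred_eq]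
  set w' := w + (z - h ⬝ᵥ w) • (S *ᵥ h) with hw'
  have hz : h ⬝ᵥ w' = z := by
    rw [hw', dotProduct_add, dotProduct_smul, hh]; simp
  have h0 : (∀ j, rowSlope S h β j = 0 → 0 < rowSlack α β j w') ↔
      (∀ j, rowSlope S h β j = 0 → 0 < rowSlack α β j w) := by
    refine forall_congr' fun j => forall_congr' fun hd => ?_
    rw [hw', rowSlack_add_smul_of_slope_eq_zero hd]
  rw [mem_rowRegion_iff (S := S) (h := h) hα, h0, rowPivot, hz, hw',
    rowLower_add_smul hh hα, rowUpper_add_smul hh hα]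
  tauto

/-- Conditionally on the polyhedral region the pivot is uniformly distributed. -/
theorem gaussianPi_rowPivot_Ioo (hS : S.PosSemidef) (hh : h ⬝ᵥ S *ᵥ h = 1) (hα : ∀ j, α j ≠ ⊥)
    {s t : ℝ} (hs : 0 ≤ s) (hst : s ≤ t) (ht : t ≤ 1) :
    gaussianPi S (rowRegion α β ∩ rowPivot S h α β ⁻¹' Set.Ioo s t) =
      ENNReal.ofReal (t - s) * gaussianPi S (rowRegion α β) := by
  have huniv := gaussianPi_rowRegion_inter (β := β) hS hh hα MeasurableSet.univ
  rw [Set.preimage_univ, Set.inter_univ] at huniv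
  rw [huniv, gaussianPi_rowRegion_inter hS hh hα measurableSet_Ioo,
    ← lintegral_const_mul' _ _ ENNReal.ofReal_ne_top]
  refine lintegral_congr fun w => ?_
  generalize (∀ j, rowSlope S h β j = 0 → 0 < rowSlack α β j w) = p
  by_cases h0 : p
  swap
  · simp [h0]
  by_cases hlt : rowLower S h α β w < rowUpper S h α β w
  · have := gaussianReal_truncStd_mem_Ioo hlt hs hst ht
    rw [measureReal_def, measureReal_def, ← ENNReal.toReal_ofReal (sub_nonneg.2 hst),
      ← ENNReal.toReal_mul, ENNReal.toReal_eq_toReal_iff' (measure_ne_top _ _)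
        (ENNReal.mul_ne_top ENNReal.ofReal_ne_top (measure_ne_top _ _))] at this
    simpa only [h0, true_and, Set.mem_univ, and_true] using this
  · have hempty : ∀ z : ℝ, ¬ (rowLower S h α β w < z ∧ (z : EReal) < rowUpper S h α β w) :=
      fun z hz => hlt (hz.1.trans hz.2)
    simp [hempty]

theorem gaussianPi_rowPivot_eq (hS : S.PosSemidef) (hh : h ⬝ᵥ S *ᵥ h = 1) (hα : ∀ j, α j ≠ ⊥)
    (t : ℝ) : gaussianPi S (rowRegion α β ∩ rowPivot S h α β ⁻¹' {t}) = 0 := by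
  rw [gaussianPi_rowRegion_inter hS hh hα (measurableSet_singleton t),
    ← lintegral_zero (μ := gaussianPi S)]
  refine lintegral_congr fun w => ?_
  by_cases hlt : rowLower S h α β w < rowUpper S h α β w
  · exact measure_mono_null (fun z hz => hz.2.2) (gaussianReal_truncStd_eq hlt t)
  · have hempty : ∀ z : ℝ, ¬ (rowLower S h α β w < z ∧ (z : EReal) < rowUpper S h α β w) :=
      fun z hz => hlt (hz.1.trans hz.2)
    simp [hempty]

lemma gaussianPi_rowSlack_eq_zero (hS : S.PosDef) {j : J} (hβ : β j ≠ 0 ∨ α j = ⊤) :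
    gaussianPi S {w | rowSlack α β j w = 0} = 0 := by
  unfold rowSlack
  generalize α j = a at *
  induction a with
  | bot => simp
  | top => simp
  | coe a =>
    have hb : β j ≠ 0 := by simpa using hβ
    refine measure_mono_null (fun w hw => ?_) (gaussianPi_hyperplane hS hb (-a))
    have hw' : a + β j ⬝ᵥ w = 0 := by exact_mod_cast hw
    exact eq_neg_of_add_eq_zero_right hw'

end Rows

/-! ### Limits of probabilities of events determined by local limits -/

section Local

variable {Ω ι F : Type*} [MeasurableSpace Ω] {P : Measure Ω} [IsProbabilityMeasure P]
  [Fintype ι]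

/-- Convergence in probability to the constant `y`. -/
def TendstoInProb [TopologicalSpace F] (P : Measure Ω) (Y : ℕ → Ω → F) (L : Filter ℕ) (y : F) :
    Prop :=
  ∀ V ∈ 𝓝 y, Tendsto (fun n => P {ω | Y n ω ∉ V}) L (𝓝 0)

/-- The filter on pairs `(n, ω)` along which `n` follows `L`, `ω` stays in `Ω₀`, and the statistics
`W n ω` and `Y n ω` tend to `w` and `y`. -/
def localFilter {E : Type*} [TopologicalSpace E] [TopologicalSpace F] (L : Filter ℕ) (Ω₀ : Set Ω)
    (W : ℕ → Ω → E) (w : E) (Y : ℕ → Ω → F) (y : F) : Filter (ℕ × Ω) :=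
  (L ×ˢ 𝓟 Ω₀) ⊓ (comap (fun q => W q.1 q.2) (𝓝 w) ⊓ comap (fun q => Y q.1 q.2) (𝓝 y))

lemma eventually_localFilter [TopologicalSpace F] {L : Filter ℕ} {Ω₀ : Set Ω}
    {W : ℕ → Ω → ι → ℝ} {w : ι → ℝ} {Y : ℕ → Ω → F} {y : F} {p : ℕ × Ω → Prop}
    (h : ∀ᶠ q in localFilter L Ω₀ W w Y y, p q) :
    ∃ N, IsOpen N ∧ w ∈ N ∧ ∃ V, IsOpen V ∧ y ∈ V ∧
      ∀ᶠ n in L, ∀ ω ∈ Ω₀, W n ω ∈ N → Y n ω ∈ V → p (n, ω) := by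
  rw [localFilter, eventually_inf] at h
  obtain ⟨s, hs, t, ht, hst⟩ := h
  obtain ⟨t1, ht1, t2, ht2, rfl⟩ := mem_inf_iff.1 ht
  obtain ⟨N', hN', hN't⟩ := mem_comap.1 ht1
  obtain ⟨V', hV', hV't⟩ := mem_comap.1 ht2
  obtain ⟨N, hNN', hNo, hwN⟩ := mem_nhds_iff.1 hN'
  obtain ⟨V, hVV', hVo, hyV⟩ := mem_nhds_iff.1 hV'
  obtain ⟨a, ha, b, hb, hab⟩ := mem_prod_iff.1 hs
  refine ⟨N, hNo, hwN, V, hVo, hyV, ?_⟩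
  filter_upwards [ha] with n hn ω hω hW hY
  exact hst (n, ω) ⟨hab ⟨hn, hb hω⟩, hN't (hNN' hW), hV't (hVV' hY)⟩

/-- If `W n` converges in law to `μ` and `Y n` converges in probability to `y`, and if events hold
along the local filter at almost every point of `A`, then they contain measurable events whose
probability is asymptotically at least `μ A`. -/
lemma exists_measurableSet_lt_of_local [TopologicalSpace F] [MeasurableSpace F]
    [OpensMeasurableSpace F] {μ : Measure (ι → ℝ)} [IsProbabilityMeasure μ] {L : Filter ℕ}
    {W : ℕ → Ω → ι → ℝ} (hWm : ∀ n, Measurable (W n))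
    (hW : ∀ G, IsOpen G → μ G ≤ liminf (fun n => P {ω | W n ω ∈ G}) L)
    {Y : ℕ → Ω → F} (hYm : ∀ n, Measurable (Y n)) {y : F} (hY : TendstoInProb P Y L y)
    {Ω₀ : Set Ω} (hΩ₀ : Ω₀ ∈ ae P) {A : Set (ι → ℝ)} {Ev : ℕ → Set Ω}
    (h : ∀ᵐ w ∂μ, w ∈ A → ∀ᶠ q in localFilter L Ω₀ W w Y y, q.2 ∈ Ev q.1)
    {c : ENNReal} (hc : c < μ A) :
    ∀ᶠ n in L, ∃ B ⊆ Ev n, MeasurableSet B ∧ c < P B := by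
  set A' := {w | w ∈ A ∧ ∀ᶠ q in localFilter L Ω₀ W w Y y, q.2 ∈ Ev q.1} with hA'
  have hex : ∀ w : ι → ℝ, ∃ N, IsOpen N ∧ (w ∈ A' → w ∈ N) ∧ ∃ V, IsOpen V ∧ y ∈ V ∧
      ∀ᶠ n in L, ∀ ω ∈ Ω₀, W n ω ∈ N → Y n ω ∈ V → ω ∈ Ev n := by
    intro w
    by_cases hw : w ∈ A'
    · obtain ⟨N, h1, h2, h3⟩ := eventually_localFilter hw.2
      exact ⟨N, h1, fun _ => h2, h3⟩
    · exact ⟨∅, isOpen_empty, fun h => absurd h hw, Set.univ, isOpen_univ, trivial,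
        by simp⟩
  choose N hNo hN V hVo hyV hev using hex
  have hO : IsOpen (⋃ w, N w) := isOpen_iUnion hNo
  have hAO : μ A ≤ μ (⋃ w, N w) := by
    refine measure_mono_ae ?_
    filter_upwards [h] with w hw hwA
    exact Set.mem_iUnion.2 ⟨w, hN w ⟨hwA, hw hwA⟩⟩
  -- compactness makes one neighbourhood `V'` of `y` and one tail of `L` serve finitely many `w`
  obtain ⟨K, hKO, hK, hcK⟩ := hO.exists_lt_isCompact (hc.trans_le hAO)
  obtain ⟨T, hT⟩ := hK.elim_finite_subcover N hNo hKO
  set G := ⋃ w ∈ T, N w with hG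
  have hGo : IsOpen G := isOpen_biUnion fun w _ => hNo w
  have hcG : c < μ G := hcK.trans_le (measure_mono hT)
  obtain ⟨c', hcc', hc'G⟩ := exists_between hcG
  set V' := ⋂ w ∈ T, V w with hV'
  have hV'o : IsOpen V' := isOpen_biInter_finset fun w _ => hVo w
  have hyV' : y ∈ V' := by simp [hV', hyV]
  obtain ⟨Ω₁, hΩ₁, hΩ₁m, hΩ₁P⟩ : ∃ Ω₁ ⊆ Ω₀, MeasurableSet Ω₁ ∧ P Ω₁ᶜ = 0 := by
    obtain ⟨t, ht1, ht2, ht3⟩ := exists_measurable_superset_of_null (mem_ae_iff.1 hΩ₀)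
    exact ⟨tᶜ, Set.compl_subset_comm.1 ht1, ht2.compl, by simpa using ht3⟩
  have e1 : ∀ᶠ n in L, c' < P {ω | W n ω ∈ G} :=
    eventually_lt_of_lt_liminf (hc'G.trans_le (hW G hGo))
  have e2 : ∀ᶠ n in L, P {ω | Y n ω ∉ V'} < c' - c :=
    (hY V' (hV'o.mem_nhds hyV')).eventually (gt_mem_nhds (tsub_pos_of_lt hcc'))
  have e3 : ∀ᶠ n in L, ∀ w ∈ T, ∀ ω ∈ Ω₀, W n ω ∈ N w → Y n ω ∈ V w → ω ∈ Ev n :=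
    (Filter.eventually_all_finset T).2 fun w _ => hev w
  filter_upwards [e1, e2, e3] with n h1 h2 h3
  refine ⟨(W n ⁻¹' G ∩ Y n ⁻¹' V') ∩ Ω₁, ?_, ?_, ?_⟩
  · rintro ω ⟨⟨hωG, hωV⟩, hω⟩
    obtain ⟨w, hw, hωw⟩ := Set.mem_iUnion₂.1 hωG
    exact h3 w hw ω (hΩ₁ hω) hωw (Set.mem_iInter₂.1 hωV w hw)
  · exact ((hWm n hGo.measurableSet).inter (hYm n hV'o.measurableSet)).inter hΩ₁m
  · have hle : P {ω | W n ω ∈ G} ≤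
        P ((W n ⁻¹' G ∩ Y n ⁻¹' V') ∩ Ω₁) + P {ω | Y n ω ∉ V'} := by
      have hsub : {ω | W n ω ∈ G} ⊆
          ((W n ⁻¹' G ∩ Y n ⁻¹' V') ∩ Ω₁) ∪ ({ω | Y n ω ∉ V'} ∪ Ω₁ᶜ) := by
        intro ω hω
        by_cases hV : Y n ω ∈ V' <;> by_cases hΩ : ω ∈ Ω₁
        · exact Or.inl ⟨⟨hω, hV⟩, hΩ⟩
        · exact Or.inr (Or.inr hΩ)
        · exact Or.inr (Or.inl hV)
        · exact Or.inr (Or.inr hΩ)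
      calc P {ω | W n ω ∈ G}
          ≤ P ((W n ⁻¹' G ∩ Y n ⁻¹' V') ∩ Ω₁) + P ({ω | Y n ω ∉ V'} ∪ Ω₁ᶜ) :=
            (measure_mono hsub).trans (measure_union_le _ _)
        _ ≤ P ((W n ⁻¹' G ∩ Y n ⁻¹' V') ∩ Ω₁) + (P {ω | Y n ω ∉ V'} + P Ω₁ᶜ) := by
            gcongr
            exact measure_union_le _ _
        _ = _ := by rw [hΩ₁P, add_zero]
    by_contra hcon
    have hfin : P {ω | Y n ω ∉ V'} ≠ ⊤ := measure_ne_top _ _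
    have hlt : c' < c' := calc
      c' < P {ω | W n ω ∈ G} := h1
      _ ≤ _ := hle
      _ ≤ c + P {ω | Y n ω ∉ V'} := by gcongr; exact not_lt.1 hcon
      _ ≤ c + (c' - c) := by gcongr
      _ = c' := add_tsub_cancel_of_le hcc'.le
    exact lt_irrefl _ hlt

/-- Probabilities of events that are determined by the limits of the statistics `W n` and `Y n`
converge. The events need not be measurable. -/
theorem tendsto_measure_of_local [TopologicalSpace F] [MeasurableSpace F]
    [OpensMeasurableSpace F] {μ : Measure (ι → ℝ)} [IsProbabilityMeasure μ] {L : Filter ℕ}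
    {W : ℕ → Ω → ι → ℝ} (hWm : ∀ n, Measurable (W n))
    (hW : ∀ G, IsOpen G → μ G ≤ liminf (fun n => P {ω | W n ω ∈ G}) L)
    {Y : ℕ → Ω → F} (hYm : ∀ n, Measurable (Y n)) {y : F} (hY : TendstoInProb P Y L y)
    {Ω₀ : Set Ω} (hΩ₀ : Ω₀ ∈ ae P) {A : Set (ι → ℝ)} (hA : MeasurableSet A) {Ev : ℕ → Set Ω}
    (h : ∀ᵐ w ∂μ, (w ∈ A → ∀ᶠ q in localFilter L Ω₀ W w Y y, q.2 ∈ Ev q.1) ∧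
      (w ∉ A → ∀ᶠ q in localFilter L Ω₀ W w Y y, q.2 ∉ Ev q.1)) :
    Tendsto (fun n => P (Ev n)) L (𝓝 (μ A)) := by
  rw [tendsto_order]
  constructor
  · intro c hc
    filter_upwards [exists_measurableSet_lt_of_local hWm hW hYm hY hΩ₀ (h.mono fun w hw => hw.1)
      hc] with n ⟨B, hB, _, hcB⟩
    exact hcB.trans_le (measure_mono hB)
  · intro c hc
    rcases lt_or_ge 1 c with h1c | h1c
    · exact Eventually.of_forall fun n => prob_le_one.trans_lt h1c
    obtain ⟨c', hc', hc'c⟩ := exists_between hc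
    have hadd : 1 - c' + c' = 1 := tsub_add_cancel_of_le (hc'c.le.trans h1c)
    have hfin : 1 - c' ≠ ⊤ := ENNReal.sub_ne_top ENNReal.one_ne_top
    have hc'1 : 1 - c' < μ Aᶜ := by
      rw [prob_compl_eq_one_sub hA, lt_tsub_iff_right]
      calc 1 - c' + μ A < 1 - c' + c' := ENNReal.add_lt_add_left hfin hc'
        _ = 1 := hadd
    filter_upwards [exists_measurableSet_lt_of_local (A := Aᶜ) (Ev := fun n => (Ev n)ᶜ)
      hWm hW hYm hY hΩ₀ (h.mono fun w hw => hw.2) hc'1] with n ⟨B, hB, hBm, hcB⟩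
    calc P (Ev n) ≤ P Bᶜ := measure_mono (Set.subset_compl_comm.1 hB)
      _ = 1 - P B := prob_compl_eq_one_sub hBm
      _ ≤ c' := by
        rw [tsub_le_iff_left, ← hadd]
        gcongr
      _ < c := hc'c

lemma TendstoInProb.pi {κ : Type*} [Finite κ] {X : κ → Type*} [∀ k, TopologicalSpace (X k)]
    {Y : ℕ → Ω → ∀ k, X k} {L : Filter ℕ} {y : ∀ k, X k}
    (h : ∀ k, TendstoInProb P (fun n ω => Y n ω k) L (y k)) : TendstoInProb P Y L y := by
  have := Fintype.ofFinite κ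
  intro V hV
  rw [nhds_pi, Filter.mem_pi'] at hV
  obtain ⟨I, t, ht, hsub⟩ := hV
  have hlim : Tendsto (fun n => ∑ k, P {ω | Y n ω k ∉ t k}) L (𝓝 0) := by
    have := tendsto_finsetSum (Finset.univ : Finset κ) fun k _ => h k (t k) (ht k)
    simpa using this
  refine tendsto_of_tendsto_of_tendsto_of_le_of_le tendsto_const_nhds hlim (fun _ => zero_le) ?_
  intro n
  refine le_trans (measure_mono ?_) (measure_biUnion_finset_le Finset.univ
    fun k => {ω | Y n ω k ∉ t k})
  intro ω hω
  by_contra hcon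
  refine hω (hsub fun k _ => ?_)
  by_contra hk
  exact hcon (Set.mem_iUnion₂.2 ⟨k, Finset.mem_univ k, hk⟩)

end Local

/-! ### Limit theorems for bounded triangular arrays -/

section Arrays

variable {Ω : Type*} [MeasurableSpace Ω] {P : Measure Ω} [IsProbabilityMeasure P]

lemma integrable_of_abs_le {X : Ω → ℝ} (hX : Measurable X) {B : ℝ} (hB : ∀ᵐ ω ∂P, |X ω| ≤ B) :
    Integrable X P :=
  Integrable.of_bound hX.aestronglyMeasurable B (by simpa using hB)

lemma norm_prod_sub_prod_le {κ : Type*} (s : Finset κ) {a b : κ → ℂ} (ha : ∀ i, ‖a i‖ ≤ 1)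
    (hb : ∀ i, ‖b i‖ ≤ 1) : ‖∏ i ∈ s, a i - ∏ i ∈ s, b i‖ ≤ ∑ i ∈ s, ‖a i - b i‖ := by
  classical
  induction s using Finset.induction_on with
  | empty => simp
  | insert i s hi ih =>
    rw [Finset.prod_insert hi, Finset.prod_insert hi, Finset.sum_insert hi]
    have h1 : a i * ∏ j ∈ s, a j - b i * ∏ j ∈ s, b j =
        (a i - b i) * ∏ j ∈ s, a j + b i * (∏ j ∈ s, a j - ∏ j ∈ s, b j) := by ring
    have h2 : ‖∏ j ∈ s, a j‖ ≤ 1 := by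
      rw [norm_prod]
      exact Finset.prod_le_one (fun _ _ => norm_nonneg _) fun j _ => ha j
    rw [h1]
    refine (norm_add_le _ _).trans ?_
    rw [norm_mul, norm_mul]
    refine add_le_add ?_ ?_
    · exact mul_le_of_le_one_right (norm_nonneg _) h2
    · exact (mul_le_of_le_one_left (norm_nonneg _) (hb i)).trans ih

/-- Second-order expansion of the characteristic function of a bounded centered variable, compared
with that of the normal law of the same variance. -/
lemma norm_charFun_sub_gaussian_le {X : Ω → ℝ} (hX : Measurable X) {B : ℝ} (hB0 : 0 ≤ B)
    (hB : ∀ᵐ ω ∂P, |X ω| ≤ B) (h0 : ∫ ω, X ω ∂P = 0) {s : ℝ} (hs : |s| * B ≤ 1) :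
    ‖∫ ω, Complex.exp (((s * X ω : ℝ) : ℂ) * Complex.I) ∂P -
      ((Real.exp (-(s ^ 2 * (∫ ω, X ω ^ 2 ∂P) / 2)) : ℝ) : ℂ)‖ ≤ 2 * (|s| * B) ^ 3 := by
  set v := ∫ ω, X ω ^ 2 ∂P with hv
  have hX2 : ∀ᵐ ω ∂P, |X ω ^ 2| ≤ B ^ 2 := by
    filter_upwards [hB] with ω hω
    rw [abs_pow]; gcongr
  have hv0 : 0 ≤ v := integral_nonneg fun ω => sq_nonneg _
  have hi1 : Integrable X P := integrable_of_abs_le hX hB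
  have hi2 : Integrable (fun ω => X ω ^ 2) P := integrable_of_abs_le (hX.pow_const 2) hX2
  have hvB : v ≤ B ^ 2 := by
    calc v ≤ ∫ _, B ^ 2 ∂P := by
          refine integral_mono_ae hi2 (integrable_const _) ?_
          filter_upwards [hX2] with ω hω using (abs_le.1 hω).2
      _ = B ^ 2 := by simp
  have hsB : 0 ≤ |s| * B := by positivity
  -- the cubic Taylor bound for the complex exponential
  have hpt : ∀ᵐ ω ∂P, ‖Complex.exp (((s * X ω : ℝ) : ℂ) * Complex.I) -
      ((1 : ℂ) + ((s * X ω : ℝ) : ℂ) * Complex.I - (((s ^ 2 * X ω ^ 2 / 2 : ℝ)) : ℂ))‖ ≤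
        (|s| * B) ^ 3 := by
    filter_upwards [hB] with ω hω
    have hn : ‖((s * X ω : ℝ) : ℂ) * Complex.I‖ = |s| * |X ω| := by
      rw [norm_mul, Complex.norm_I, mul_one, Complex.norm_real, Real.norm_eq_abs, abs_mul]
    have hle : |s| * |X ω| ≤ |s| * B := by gcongr
    have := Complex.exp_bound (x := ((s * X ω : ℝ) : ℂ) * Complex.I) (by rw [hn]; linarith)
      (n := 3) (by norm_num)
    rw [hn] at this
    have hsum : ∑ m ∈ Finset.range 3, (((s * X ω : ℝ) : ℂ) * Complex.I) ^ m / (m.factorial : ℂ) =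
        (1 : ℂ) + ((s * X ω : ℝ) : ℂ) * Complex.I - (((s ^ 2 * X ω ^ 2 / 2 : ℝ)) : ℂ) := by
      have hsq : (((s * X ω : ℝ) : ℂ) * Complex.I) ^ 2 = -((s ^ 2 * X ω ^ 2 : ℝ) : ℂ) := by
        rw [mul_pow, Complex.I_sq]; push_cast; ring
      rw [Finset.sum_range_succ, Finset.sum_range_succ, Finset.sum_range_one, hsq]
      simp [Nat.factorial]
      ring
    rw [hsum] at this
    refine this.trans ?_
    calc (|s| * |X ω|) ^ 3 * (((3 : ℕ).succ : ℝ) * ((3 : ℕ).factorial * (3 : ℕ) : ℝ)⁻¹)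
        ≤ (|s| * |X ω|) ^ 3 * 1 := by
          gcongr
          norm_num [Nat.factorial]
      _ ≤ (|s| * B) ^ 3 := by rw [mul_one]; gcongr
  have hint : ∫ ω, ((1 : ℂ) + ((s * X ω : ℝ) : ℂ) * Complex.I - (((s ^ 2 * X ω ^ 2 / 2 : ℝ)) : ℂ)) ∂P
      = ((1 - s ^ 2 * v / 2 : ℝ) : ℂ) := by
    have i1 : Integrable (fun ω => ((s * X ω : ℝ) : ℂ) * Complex.I) P :=
      ((hi1.const_mul s).ofReal).mul_const _
    have i2 : Integrable (fun ω => (((s ^ 2 * X ω ^ 2 / 2 : ℝ)) : ℂ)) P :=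
      (((hi2.const_mul (s ^ 2)).div_const 2)).ofReal
    rw [integral_sub (f := fun ω => (1 : ℂ) + ((s * X ω : ℝ) : ℂ) * Complex.I)
      ((integrable_const _).add i1) i2, integral_add (integrable_const _) i1,
      integral_mul_const, integral_complex_ofReal, integral_complex_ofReal, integral_const_mul,
      integral_div, integral_const_mul, h0, ← hv]
    simp
  have hie : Integrable (fun ω => Complex.exp (((s * X ω : ℝ) : ℂ) * Complex.I)) P := by
    refine Integrable.of_bound (by fun_prop) 1 (Eventually.of_forall fun ω => ?_)
    rw [Complex.norm_exp_ofReal_mul_I]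
  have hit : Integrable (fun ω => (1 : ℂ) + ((s * X ω : ℝ) : ℂ) * Complex.I -
      (((s ^ 2 * X ω ^ 2 / 2 : ℝ)) : ℂ)) P :=
    ((integrable_const _).add (((hi1.const_mul s).ofReal).mul_const _)).sub
      (((hi2.const_mul (s ^ 2)).div_const 2)).ofReal
  have h1 : ‖∫ ω, Complex.exp (((s * X ω : ℝ) : ℂ) * Complex.I) ∂P -
      ((1 - s ^ 2 * v / 2 : ℝ) : ℂ)‖ ≤ (|s| * B) ^ 3 := by
    rw [← hint, ← integral_sub hie hit]
    refine (norm_integral_le_of_norm_le_const hpt).trans ?_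
    simp
  have hu : |-(s ^ 2 * v / 2)| ≤ (|s| * B) ^ 2 / 2 := by
    rw [abs_neg, abs_of_nonneg (by positivity), mul_pow, sq_abs]
    gcongr
  have h2 : ‖((1 - s ^ 2 * v / 2 : ℝ) : ℂ) - ((Real.exp (-(s ^ 2 * v / 2)) : ℝ) : ℂ)‖ ≤
      (|s| * B) ^ 3 := by
    rw [← Complex.ofReal_sub, Complex.norm_real, Real.norm_eq_abs, abs_sub_comm]
    have h3 := Real.abs_exp_sub_one_sub_id_le (x := -(s ^ 2 * v / 2))
      (hu.trans (by nlinarith))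
    have h4 : Real.exp (-(s ^ 2 * v / 2)) - (1 - s ^ 2 * v / 2) =
        Real.exp (-(s ^ 2 * v / 2)) - 1 - -(s ^ 2 * v / 2) := by ring
    rw [h4]
    refine h3.trans ?_
    rw [← sq_abs]
    calc |-(s ^ 2 * v / 2)| ^ 2 ≤ ((|s| * B) ^ 2 / 2) ^ 2 := by gcongr
      _ = (|s| * B) ^ 3 * ((|s| * B) / 4) := by ring
      _ ≤ (|s| * B) ^ 3 * 1 := by gcongr; linarith
      _ = (|s| * B) ^ 3 := mul_one _
  calc _ ≤ _ := norm_sub_le_norm_sub_add_norm_sub _ ((1 - s ^ 2 * v / 2 : ℝ) : ℂ) _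
    _ ≤ (|s| * B) ^ 3 + (|s| * B) ^ 3 := add_le_add h1 h2
    _ = _ := by ring

/-- Central limit theorem for bounded triangular arrays, in terms of characteristic functions. -/
lemma tendsto_integral_exp_normalized_sum {X : (n : ℕ) → Fin n → Ω → ℝ}
    (hX : ∀ n i, Measurable (X n i)) (hind : ∀ n, iIndepFun (X n) P) {B : ℝ}
    (hB : ∀ n i, ∀ᵐ ω ∂P, |X n i ω| ≤ B) (h0 : ∀ n i, ∫ ω, X n i ω ∂P = 0) {σsq : ℝ}
    (hσ : Tendsto (fun n : ℕ => (n : ℝ)⁻¹ * ∑ i, ∫ ω, X n i ω ^ 2 ∂P) atTop (𝓝 σsq)) :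
    Tendsto (fun n : ℕ => ∫ ω, Complex.exp ((((√(n : ℝ))⁻¹ * ∑ i, X n i ω : ℝ) : ℂ) * Complex.I) ∂P)
      atTop (𝓝 ((Real.exp (-(σsq / 2)) : ℝ) : ℂ)) := by
  set B' := max B 0 with hB'
  have hB0 : 0 ≤ B' := le_max_right _ _
  have hBX : ∀ n i, ∀ᵐ ω ∂P, |X n i ω| ≤ B' := fun n i =>
    (hB n i).mono fun ω hω => hω.trans (le_max_left _ _)
  have hsqrt : Tendsto (fun n : ℕ => (√(n : ℝ))⁻¹) atTop (𝓝 0) :=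
    tendsto_inv_atTop_zero.comp (Real.tendsto_sqrt_atTop.comp tendsto_natCast_atTop_atTop)
  have hgauss : Tendsto (fun n : ℕ =>
      ((Real.exp (-(((n : ℝ)⁻¹ * ∑ i, ∫ ω, X n i ω ^ 2 ∂P) / 2)) : ℝ) : ℂ)) atTop
      (𝓝 ((Real.exp (-(σsq / 2)) : ℝ) : ℂ)) :=
    (Complex.continuous_ofReal.tendsto _).comp
      ((Real.continuous_exp.tendsto _).comp ((hσ.div_const 2).neg))
  have hsmall : ∀ᶠ n : ℕ in atTop, (√(n : ℝ))⁻¹ * B' ≤ 1 := by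
    have : Tendsto (fun n : ℕ => (√(n : ℝ))⁻¹ * B') atTop (𝓝 0) := by
      simpa using hsqrt.mul_const B'
    exact this.eventually (Iic_mem_nhds one_pos)
  have hdiff : Tendsto (fun n : ℕ =>
      ∫ ω, Complex.exp ((((√(n : ℝ))⁻¹ * ∑ i, X n i ω : ℝ) : ℂ) * Complex.I) ∂P -
      ((Real.exp (-(((n : ℝ)⁻¹ * ∑ i, ∫ ω, X n i ω ^ 2 ∂P) / 2)) : ℝ) : ℂ)) atTop (𝓝 0) := by
    have hbd : Tendsto (fun n : ℕ => 2 * B' ^ 3 * (√(n : ℝ))⁻¹) atTop (𝓝 0) := by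
      simpa using hsqrt.const_mul (2 * B' ^ 3)
    refine squeeze_zero_norm' ?_ hbd
    filter_upwards [hsmall, eventually_ge_atTop 1] with n hn hn1
    have hnpos : (0 : ℝ) < n := by exact_mod_cast hn1
    have hsn : 0 < √(n : ℝ) := Real.sqrt_pos.2 hnpos
    set s := (√(n : ℝ))⁻¹ with hs
    have hspos : 0 < s := inv_pos.2 hsn
    have habs : |s| = s := abs_of_pos hspos
    have hs2 : s ^ 2 = (n : ℝ)⁻¹ := by rw [hs, inv_pow, Real.sq_sqrt hnpos.le]
    have hprod1 : ∫ ω, Complex.exp (((s * ∑ i, X n i ω : ℝ) : ℂ) * Complex.I) ∂P =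
        ∏ i, ∫ ω, Complex.exp (((s * X n i ω : ℝ) : ℂ) * Complex.I) ∂P := by
      have hcomp : iIndepFun (fun i ω => Complex.exp (((s * X n i ω : ℝ) : ℂ) * Complex.I)) P :=
        (hind n).comp (fun _ x => Complex.exp (((s * x : ℝ) : ℂ) * Complex.I))
          (fun _ => by fun_prop)
      rw [← hcomp.integral_fun_prod_eq_prod_integral fun i => by
        have := hX n i; fun_prop]
      refine integral_congr_ae (Eventually.of_forall fun ω => ?_)
      simp only [← Complex.exp_sum, Finset.mul_sum, Complex.ofReal_sum, Finset.sum_mul]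
    have hprod2 : ((Real.exp (-(((n : ℝ)⁻¹ * ∑ i, ∫ ω, X n i ω ^ 2 ∂P) / 2)) : ℝ) : ℂ) =
        ∏ i, ((Real.exp (-(s ^ 2 * (∫ ω, X n i ω ^ 2 ∂P) / 2)) : ℝ) : ℂ) := by
      rw [← Complex.ofReal_prod, ← Real.exp_sum, hs2, Finset.mul_sum, Finset.sum_neg_distrib,
        Finset.sum_div]
    rw [hprod1, hprod2]
    refine (norm_prod_sub_prod_le Finset.univ (fun i => ?_) fun i => ?_).trans ?_
    · refine (norm_integral_le_of_norm_le_const (C := 1) (Eventually.of_forall fun ω => ?_)).trans ?_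
      · rw [Complex.norm_exp_ofReal_mul_I]
      · simp
    · rw [Complex.norm_real, Real.norm_eq_abs, Real.abs_exp, Real.exp_le_one_iff, neg_nonpos]
      have : 0 ≤ ∫ ω, X n i ω ^ 2 ∂P := integral_nonneg fun ω => sq_nonneg _
      positivity
    · refine (Finset.sum_le_sum fun i _ => norm_charFun_sub_gaussian_le (hX n i) hB0 (hBX n i)
        (h0 n i) (by rw [habs]; exact hn)).trans (le_of_eq ?_)
      rw [Finset.sum_const, Finset.card_univ, Fintype.card_fin, nsmul_eq_mul, habs]
      have : (n : ℝ) * s ^ 2 = 1 := by rw [hs2]; exact mul_inv_cancel₀ hnpos.ne'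
      calc (n : ℝ) * (2 * (s * B') ^ 3) = 2 * B' ^ 3 * s * (n * s ^ 2) := by ring
        _ = _ := by rw [this, mul_one]
  simpa using hdiff.add hgauss

/-- Central limit theorem for bounded triangular arrays of random vectors. -/
theorem gaussianPi_le_liminf_normalized_sum {ι : Type*} [Fintype ι] [DecidableEq ι]
    {X : (n : ℕ) → Fin n → Ω → ι → ℝ} (hX : ∀ n i, Measurable (X n i))
    (hind : ∀ n, iIndepFun (X n) P) {B : ℝ} (hB : ∀ n i, ∀ᵐ ω ∂P, ∀ j, |X n i ω j| ≤ B)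
    (h0 : ∀ n i j, ∫ ω, X n i ω j ∂P = 0) {S : Matrix ι ι ℝ} (hS : S.PosSemidef)
    (hcov : ∀ j k, Tendsto (fun n : ℕ => (n : ℝ)⁻¹ * ∑ i, ∫ ω, X n i ω j * X n i ω k ∂P) atTop
      (𝓝 (S j k)))
    {L : Filter ℕ} (hL : L ≤ atTop) {G : Set (ι → ℝ)} (hG : IsOpen G) :
    gaussianPi S G ≤ liminf (fun n : ℕ => P {ω | (√(n : ℝ))⁻¹ • ∑ i, X n i ω ∈ G}) L := by
  set W : ℕ → Ω → ι → ℝ := fun n ω => (√(n : ℝ))⁻¹ • ∑ i, X n i ω with hW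
  have hWm : ∀ n, Measurable (W n) := fun n => by
    have h1 : Measurable fun ω => ∑ i, X n i ω := Finset.measurable_sum _ fun i _ => hX n i
    exact h1.const_smul (√(n : ℝ))⁻¹
  have hint : ∀ n i j k, Integrable (fun ω => X n i ω j * X n i ω k) P := by
    intro n i j k
    have hj : Measurable fun ω => X n i ω j := (measurable_pi_apply j).comp (hX n i)
    have hk : Measurable fun ω => X n i ω k := (measurable_pi_apply k).comp (hX n i)
    refine integrable_of_abs_le (hj.mul hk) (B := B * B) ?_
    filter_upwards [hB n i] with ω hω
    rw [abs_mul]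
    exact mul_le_mul (hω j) (hω k) (abs_nonneg _) ((abs_nonneg _).trans (hω j))
  have hchar : ∀ t : ι → ℝ, Tendsto (fun n : ℕ =>
      ∫ ω, Complex.exp (((t ⬝ᵥ W n ω : ℝ) : ℂ) * Complex.I) ∂P) atTop
      (𝓝 (Complex.exp (-((t ⬝ᵥ S *ᵥ t : ℝ) : ℂ) / 2))) := by
    intro t
    have key := tendsto_integral_exp_normalized_sum (P := P) (X := fun n i ω => t ⬝ᵥ X n i ω)
      (fun n i => by have := hX n i; fun_prop)
      (fun n => (hind n).comp (fun _ x => t ⬝ᵥ x) (fun _ => by fun_prop))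
      (B := ∑ j, |t j| * B) ?_ ?_ (σsq := t ⬝ᵥ S *ᵥ t) ?_
    · have e1 : (Complex.exp (-((t ⬝ᵥ S *ᵥ t : ℝ) : ℂ) / 2)) =
          ((Real.exp (-(t ⬝ᵥ S *ᵥ t / 2)) : ℝ) : ℂ) := by
        push_cast; congr 1; ring
      rw [e1]
      refine key.congr fun n => ?_
      refine integral_congr_ae (Eventually.of_forall fun ω => ?_)
      simp only [hW, dotProduct_smul, dotProduct_sum, smul_eq_mul]
    · intro n i
      filter_upwards [hB n i] with ω hω
      refine (Finset.abs_sum_le_sum_abs _ _).trans (Finset.sum_le_sum fun j _ => ?_)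
      rw [abs_mul]
      exact mul_le_mul_of_nonneg_left (hω j) (abs_nonneg _)
    · intro n i
      simp only [dotProduct]
      rw [integral_finsetSum _ fun j _ => ?_]
      · simp [integral_const_mul, h0]
      · refine Integrable.const_mul (integrable_of_abs_le
          ((measurable_pi_apply j).comp (hX n i)) (B := B) ?_) _
        exact (hB n i).mono fun ω hω => hω j
    · have e2 : ∀ n : ℕ, (n : ℝ)⁻¹ * ∑ i, ∫ ω, (t ⬝ᵥ X n i ω) ^ 2 ∂P =
          ∑ j, ∑ k, t j * t k * ((n : ℝ)⁻¹ * ∑ i, ∫ ω, X n i ω j * X n i ω k ∂P) := by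
        intro n
        have e3 : ∀ i, ∫ ω, (t ⬝ᵥ X n i ω) ^ 2 ∂P =
            ∑ j, ∑ k, t j * t k * ∫ ω, X n i ω j * X n i ω k ∂P := by
          intro i
          simp only [← integral_const_mul]
          simp only [← integral_finsetSum _ fun k _ => (hint n i _ k).const_mul _]
          rw [← integral_finsetSum _ fun j _ =>
            integrable_finsetSum _ fun k _ => (hint n i j k).const_mul _]
          refine integral_congr_ae (Eventually.of_forall fun ω => ?_)
          simp only [dotProduct, sq, Finset.sum_mul_sum]
          refine Finset.sum_congr rfl fun j _ => Finset.sum_congr rfl fun k _ => by ring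
        simp only [e3, Finset.mul_sum]
        rw [Finset.sum_comm]
        refine Finset.sum_congr rfl fun j _ => ?_
        rw [Finset.sum_comm]
        refine Finset.sum_congr rfl fun k _ => Finset.sum_congr rfl fun i _ => by ring
      simp only [e2]
      have e4 : t ⬝ᵥ S *ᵥ t = ∑ j, ∑ k, t j * t k * S j k := by
        simp only [dotProduct, mulVec, Finset.mul_sum]
        refine Finset.sum_congr rfl fun j _ => Finset.sum_congr rfl fun k _ => by ring
      rw [e4]
      exact tendsto_finsetSum _ fun j _ => tendsto_finsetSum _ fun k _ => (hcov j k).const_mul _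
  -- Lévy's continuity theorem, transported from `EuclideanSpace`
  set ν : ℕ → ProbabilityMeasure (EuclideanSpace ℝ ι) := fun n =>
    ⟨P.map (fun ω => WithLp.toLp 2 (W n ω)), Measure.isProbabilityMeasure_map
      ((WithLp.measurable_toLp 2 (ι → ℝ)).comp (hWm n)).aemeasurable⟩ with hν
  set ν₀ : ProbabilityMeasure (EuclideanSpace ℝ ι) := ⟨multivariateGaussian 0 S, inferInstance⟩
    with hν₀
  have hlim : Tendsto ν atTop (𝓝 ν₀) := by
    refine ProbabilityMeasure.tendsto_iff_tendsto_charFun.2 fun t => ?_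
    have e1 : charFun (ν₀ : Measure (EuclideanSpace ℝ ι)) t =
        Complex.exp (-((t.ofLp ⬝ᵥ S *ᵥ t.ofLp : ℝ) : ℂ) / 2) := by
      simp only [hν₀, ProbabilityMeasure.coe_mk]
      rw [charFun_multivariateGaussian hS]
      simp [neg_div]
    rw [e1]
    refine (hchar t.ofLp).congr fun n => ?_
    simp only [hν, ProbabilityMeasure.coe_mk]
    rw [show (fun ω => WithLp.toLp 2 (W n ω)) = WithLp.toLp 2 ∘ W n from rfl,
      ← Measure.map_map (WithLp.measurable_toLp 2 (ι → ℝ)) (hWm n), charFun_map_toLp,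
      integral_map (hWm n).aemeasurable (by fun_prop)]
  have hGo : IsOpen (WithLp.ofLp ⁻¹' G : Set (EuclideanSpace ℝ ι)) :=
    hG.preimage (PiLp.continuous_ofLp 2 _)
  have := ProbabilityMeasure.le_liminf_measure_open_of_tendsto (hlim.mono_left hL) hGo
  simp only [hν, hν₀, ProbabilityMeasure.coe_mk] at this
  rw [gaussianPi, Measure.map_apply (WithLp.measurable_ofLp 2 (ι → ℝ)) hG.measurableSet]
  refine this.trans (le_of_eq (congrArg (fun f => liminf f L) (funext fun n => ?_)))
  exact Measure.map_apply (f := fun ω => WithLp.toLp 2 (W n ω))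
    ((WithLp.measurable_toLp 2 (ι → ℝ)).comp (hWm n)) hGo.measurableSet

/-- Weak law of large numbers for bounded triangular arrays whose mean converges. -/
theorem tendstoInProb_mean {Z : (n : ℕ) → Fin n → Ω → ℝ} (hZ : ∀ n i, Measurable (Z n i))
    (hind : ∀ n, iIndepFun (Z n) P) {B : ℝ} (hB : ∀ n i, ∀ᵐ ω ∂P, |Z n i ω| ≤ B) {m : ℝ}
    (hm : Tendsto (fun n : ℕ => ∫ ω, (n : ℝ)⁻¹ * ∑ i, Z n i ω ∂P) atTop (𝓝 m))
    {L : Filter ℕ} (hL : L ≤ atTop) :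
    TendstoInProb P (fun (n : ℕ) ω => (n : ℝ)⁻¹ * ∑ i, Z n i ω) L m := by
  intro V hV
  obtain ⟨ε, hε, hεV⟩ := Metric.mem_nhds_iff.1 hV
  have hmem : ∀ n i, MemLp (Z n i) 2 P := fun n i =>
    MemLp.of_bound (hZ n i).aestronglyMeasurable B (by simpa using hB n i)
  have hvar : ∀ n i, variance (Z n i) P ≤ B ^ 2 := by
    intro n i
    have := variance_le_sq_of_bounded (μ := P) (a := -B) (b := B) (X := Z n i)
      (by filter_upwards [hB n i] with ω hω using abs_le.1 hω) (hZ n i).aemeasurable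
    refine this.trans (le_of_eq ?_)
    ring
  have hvmean : ∀ n : ℕ, 1 ≤ n →
      variance (fun ω => (n : ℝ)⁻¹ * ∑ i, Z n i ω) P ≤ (n : ℝ)⁻¹ * B ^ 2 := by
    intro n hn
    have hn0 : (0 : ℝ) < n := by exact_mod_cast hn
    rw [variance_const_mul]
    have : variance (fun ω => ∑ i, Z n i ω) P = ∑ i, variance (Z n i) P := by
      have := IndepFun.variance_sum (μ := P) (X := Z n) (s := Finset.univ) (fun i _ => hmem n i)
        (fun i _ j _ hij => (hind n).indepFun hij)
      rw [← this]
      congr 1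
      ext ω; simp
    rw [this]
    have hs : ∑ i, variance (Z n i) P ≤ n * B ^ 2 := by
      refine (Finset.sum_le_sum fun i _ => hvar n i).trans (le_of_eq ?_)
      simp
    calc (n : ℝ)⁻¹ ^ 2 * ∑ i, variance (Z n i) P ≤ (n : ℝ)⁻¹ ^ 2 * (n * B ^ 2) := by gcongr
      _ = (n : ℝ)⁻¹ * B ^ 2 := by field_simp
  have hbound : Tendsto (fun n : ℕ => ENNReal.ofReal ((n : ℝ)⁻¹ * B ^ 2 / (ε / 2) ^ 2)) L (𝓝 0) := by
    have h1 : Tendsto (fun n : ℕ => (n : ℝ)⁻¹) atTop (𝓝 0) :=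
      tendsto_inv_atTop_zero.comp tendsto_natCast_atTop_atTop
    have h2 := ((h1.mul_const (B ^ 2)).div_const ((ε / 2) ^ 2))
    simp only [zero_mul, zero_div] at h2
    simpa using (ENNReal.tendsto_ofReal h2).mono_left hL
  refine tendsto_of_tendsto_of_tendsto_of_le_of_le' tendsto_const_nhds hbound
    (Eventually.of_forall fun _ => zero_le) ?_
  have hclose := hL (hm.eventually (Metric.ball_mem_nhds m (half_pos hε)))
  filter_upwards [hclose, hL (eventually_ge_atTop 1)] with n hn hn1
  have hn' : |∫ ω, (n : ℝ)⁻¹ * ∑ i, Z n i ω ∂P - m| < ε / 2 := by simpa [Real.dist_eq] using hn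
  have hmean : MemLp (fun ω => (n : ℝ)⁻¹ * ∑ i, Z n i ω) 2 P := by
    have := (memLp_finsetSum (μ := P) (p := 2) Finset.univ fun i _ => hmem n i).const_mul ((n : ℝ)⁻¹)
    simpa using this
  refine (measure_mono ?_).trans ((meas_ge_le_variance_div_sq hmean (half_pos hε)).trans
    (ENNReal.ofReal_le_ofReal (by gcongr; exact hvmean n hn1)))
  intro ω hω
  by_contra hcon
  refine hω (hεV ?_)
  rw [Metric.mem_ball, Real.dist_eq]
  simp only [Set.mem_ofPred_eq, not_le] at hcon
  calc |(n : ℝ)⁻¹ * ∑ i, Z n i ω - m|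
      ≤ |(n : ℝ)⁻¹ * ∑ i, Z n i ω - ∫ ω, (n : ℝ)⁻¹ * ∑ i, Z n i ω ∂P| +
        |∫ ω, (n : ℝ)⁻¹ * ∑ i, Z n i ω ∂P - m| := abs_sub_le _ _ _
    _ < ε / 2 + ε / 2 := add_lt_add hcon hn'
    _ = ε := by ring

end Arrays

namespace SurveyGLM

variable {p : ℕ} {Ω : Type*} [MeasurableSpace Ω] {P : Measure Ω}

/-! ### The exponential family behind the generalized linear model -/

/-- The measure with density `c` with respect to the dominating measure; its cumulant generating
function is `a`. -/
noncomputable def baseMeasure (D : SurveyGLM p Ω P) : Measure ℝ :=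
  D.dom.withDensity fun y => ENNReal.ofReal (D.c y)

lemma lintegral_exp_baseMeasure (D : SurveyGLM p Ω P) (t : ℝ) :
    ∫⁻ y, ENNReal.ofReal (Real.exp (t * y)) ∂D.baseMeasure = ENNReal.ofReal (Real.exp (D.a t)) := by
  rw [baseMeasure, lintegral_withDensity_eq_lintegral_mul _ D.measurable_c.ennreal_ofReal
    (by fun_prop)]
  have h : ∀ y, ((fun y => ENNReal.ofReal (D.c y)) * fun y => ENNReal.ofReal (Real.exp (t * y))) y =
      ENNReal.ofReal (Real.exp (D.a t)) * ENNReal.ofReal (glmDensity D.a D.c y t) := by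
    intro y
    rw [Pi.mul_apply, glmDensity, ← ENNReal.ofReal_mul (Real.exp_pos _).le, ← mul_assoc,
      ← Real.exp_add, mul_comm, ← ENNReal.ofReal_mul (Real.exp_pos _).le]
    congr 3
    ring
  simp only [h]
  rw [lintegral_const_mul' _ _ ENNReal.ofReal_ne_top, D.density_normalized, mul_one]

lemma integrable_exp_baseMeasure (D : SurveyGLM p Ω P) (t : ℝ) :
    Integrable (fun y => Real.exp (t * id y)) D.baseMeasure := by
  refine ⟨by fun_prop, ?_⟩
  rw [hasFiniteIntegral_iff_ofReal (Eventually.of_forall fun y => (Real.exp_pos _).le)]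
  simp only [id, D.lintegral_exp_baseMeasure t]
  exact ENNReal.ofReal_lt_top

lemma mem_interior_integrableExpSet (D : SurveyGLM p Ω P) (t : ℝ) :
    t ∈ interior (integrableExpSet id D.baseMeasure) := by
  have : integrableExpSet id D.baseMeasure = Set.univ :=
    Set.eq_univ_of_forall fun t => D.integrable_exp_baseMeasure t
  simp [this]

lemma mgf_baseMeasure (D : SurveyGLM p Ω P) (t : ℝ) :
    mgf id D.baseMeasure t = Real.exp (D.a t) := by
  rw [mgf, integral_eq_lintegral_of_nonneg_ae (Eventually.of_forall fun y => (Real.exp_pos _).le)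
    (by fun_prop)]
  simp only [id, D.lintegral_exp_baseMeasure t, ENNReal.toReal_ofReal (Real.exp_pos _).le]

lemma a_eq_cgf (D : SurveyGLM p Ω P) : D.a = cgf id D.baseMeasure := by
  ext t
  rw [cgf, mgf_baseMeasure, Real.log_exp]

lemma contDiff_a (D : SurveyGLM p Ω P) : ContDiff ℝ 3 D.a := by
  rw [contDiff_iff_contDiffAt, a_eq_cgf]
  exact fun t => (analyticAt_cgf (D.mem_interior_integrableExpSet t)).contDiffAt

lemma differentiable_a (D : SurveyGLM p Ω P) : Differentiable ℝ D.a :=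
  D.contDiff_a.differentiable (by norm_num)

lemma contDiff_deriv_a (D : SurveyGLM p Ω P) : ContDiff ℝ 2 (deriv D.a) := by
  have h : ContDiff ℝ (2 + 1) D.a := D.contDiff_a
  exact (contDiff_succ_iff_deriv.1 h).2.2

lemma contDiff_deriv_deriv_a (D : SurveyGLM p Ω P) : ContDiff ℝ 1 (deriv (deriv D.a)) := by
  have h : ContDiff ℝ (1 + 1) (deriv D.a) := D.contDiff_deriv_a
  exact (contDiff_succ_iff_deriv.1 h).2.2

lemma lossD_eq (D : SurveyGLM p Ω P) (y t : ℝ) : lossD D.a D.c y t = deriv D.a t - y := by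
  have h : HasDerivAt (loss D.a D.c y) (deriv D.a t - y * 1) t :=
    (((D.differentiable_a t).hasDerivAt).sub ((hasDerivAt_id t).const_mul y)).sub_const _
  rw [lossD, h.deriv, mul_one]

lemma lossDD_eq (D : SurveyGLM p Ω P) (y t : ℝ) : lossDD D.a D.c y t = deriv (deriv D.a) t := by
  have : lossD D.a D.c y = fun t => deriv D.a t - y := funext fun t => D.lossD_eq y t
  rw [lossDD, this, deriv_sub_const]

/-- The mean of the exponential family at `t` is `a' t`. -/
lemma integral_deriv_a_sub_mul_exp (D : SurveyGLM p Ω P) (t : ℝ) :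
    ∫ y, (deriv D.a t - y) * Real.exp (t * y) ∂D.baseMeasure = 0 := by
  have hd := deriv_cgf (D.mem_interior_integrableExpSet t)
  rw [← a_eq_cgf] at hd
  have hi := integrable_pow_mul_exp_of_mem_interior_integrableExpSet
    (D.mem_interior_integrableExpSet t) 1
  simp only [pow_one, id] at hi
  have h1 : Integrable (fun y => Real.exp (t * y)) D.baseMeasure := D.integrable_exp_baseMeasure t
  simp only [sub_mul]
  rw [integral_sub (h1.const_mul _) hi, integral_const_mul, hd]
  have hm : ∫ y, Real.exp (t * y) ∂D.baseMeasure = mgf id D.baseMeasure t := rfl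
  rw [hm, div_mul_cancel₀ _ (by rw [mgf_baseMeasure]; exact (Real.exp_pos _).ne')]
  simp

lemma aemem_Y [IsProbabilityMeasure P] (D : SurveyGLM p Ω P) (n : ℕ) (i : Fin n) :
    ∀ᵐ ω ∂P, D.y n i ω ∈ D.Y := by
  have := D.sigmaFinite_dom
  obtain ⟨T, hYT, hT, hT0⟩ := exists_measurable_superset_of_null D.dom_compl
  have hmeas : Measurable fun ω => (D.x n i ω, D.y n i ω) :=
    (D.measurable_x n i).prodMk (D.measurable_y n i)
  have h0 : P.map (fun ω => (D.x n i ω, D.y n i ω)) (Set.univ ×ˢ T) = 0 := by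
    rw [D.conditional_density]
    refine withDensity_absolutelyContinuous _ _ ?_
    rw [Measure.prod_prod, hT0, mul_zero]
  rw [Measure.map_apply hmeas (MeasurableSet.univ.prod hT)] at h0
  refine measure_mono_null (fun ω hω => ?_) h0
  exact ⟨trivial, hYT hω⟩

/-- The generalized residual `y - a'(x'θ₀)` is centered given the covariates. -/
lemma integral_mul_lossD [IsProbabilityMeasure P] (D : SurveyGLM p Ω P) (n : ℕ) (i : Fin n)
    {f : (Fin (p + 1) → ℝ) → ℝ} (hf : Measurable f) {B : ℝ}
    (hB : ∀ᵐ ω ∂P, |f (D.x n i ω) * (deriv D.a (D.x n i ω ⬝ᵥ D.θ₀) - D.y n i ω)| ≤ B) :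
    ∫ ω, f (D.x n i ω) * (deriv D.a (D.x n i ω ⬝ᵥ D.θ₀) - D.y n i ω) ∂P = 0 := by
  have := D.sigmaFinite_dom
  have hda : Measurable (deriv D.a) := D.contDiff_deriv_a.continuous.measurable
  have hdot : Measurable fun x : Fin (p + 1) → ℝ => x ⬝ᵥ D.θ₀ := by fun_prop
  have hma : Measurable D.a := D.contDiff_a.continuous.measurable
  have hmc := D.measurable_c
  have hmeas : Measurable fun ω => (D.x n i ω, D.y n i ω) :=
    (D.measurable_x n i).prodMk (D.measurable_y n i)
  have : IsProbabilityMeasure (P.map (D.x n i)) :=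
    Measure.isProbabilityMeasure_map (D.measurable_x n i).aemeasurable
  set G : (Fin (p + 1) → ℝ) × ℝ → ℝ := fun z => f z.1 * (deriv D.a (z.1 ⬝ᵥ D.θ₀) - z.2) with hG
  have hGm : Measurable G := by
    have h1 : Measurable fun z : (Fin (p + 1) → ℝ) × ℝ => deriv D.a (z.1 ⬝ᵥ D.θ₀) :=
      hda.comp (hdot.comp measurable_fst)
    exact (hf.comp measurable_fst).mul (h1.sub measurable_snd)
  have hdens : Measurable fun z : (Fin (p + 1) → ℝ) × ℝ =>
      ENNReal.ofReal (glmDensity D.a D.c z.2 (z.1 ⬝ᵥ D.θ₀)) := by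
    have h1 : Measurable fun z : (Fin (p + 1) → ℝ) × ℝ => z.1 ⬝ᵥ D.θ₀ := hdot.comp measurable_fst
    have h2 : Measurable fun z : (Fin (p + 1) → ℝ) × ℝ => D.a (z.1 ⬝ᵥ D.θ₀) := hma.comp h1
    have h3 : Measurable fun z : (Fin (p + 1) → ℝ) × ℝ => D.c z.2 := hmc.comp measurable_snd
    unfold glmDensity
    exact (((measurable_snd.mul h1).sub h2).exp.mul h3).ennreal_ofReal
  have hint : Integrable G (P.map fun ω => (D.x n i ω, D.y n i ω)) := by
    rw [integrable_map_measure hGm.aestronglyMeasurable hmeas.aemeasurable]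
    exact integrable_of_abs_le (hGm.comp hmeas) hB
  have e1 : ∫ ω, f (D.x n i ω) * (deriv D.a (D.x n i ω ⬝ᵥ D.θ₀) - D.y n i ω) ∂P =
      ∫ z, G z ∂(P.map fun ω => (D.x n i ω, D.y n i ω)) := by
    rw [integral_map hmeas.aemeasurable hGm.aestronglyMeasurable]
  rw [D.conditional_density] at hint e1
  have hfin : ∀ᵐ z ∂((P.map (D.x n i)).prod D.dom),
      ENNReal.ofReal (glmDensity D.a D.c z.2 (z.1 ⬝ᵥ D.θ₀)) < ⊤ :=
    Eventually.of_forall fun _ => ENNReal.ofReal_lt_top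
  rw [integrable_withDensity_iff_integrable_smul' hdens hfin] at hint
  rw [e1, integral_withDensity_eq_integral_toReal_smul hdens hfin, integral_prod _ hint]
  refine integral_eq_zero_of_ae (Eventually.of_forall fun x => ?_)
  set t := x ⬝ᵥ D.θ₀ with ht
  have h0 := D.integral_deriv_a_sub_mul_exp t
  rw [baseMeasure, integral_withDensity_eq_integral_toReal_smul D.measurable_c.ennreal_ofReal
    (Eventually.of_forall fun _ => ENNReal.ofReal_lt_top)] at h0
  have e2 : ∀ y : ℝ, (ENNReal.ofReal (glmDensity D.a D.c y t)).toReal • G (x, y) =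
      (f x * Real.exp (-D.a t)) * ((ENNReal.ofReal (D.c y)).toReal •
        ((deriv D.a t - y) * Real.exp (t * y))) := by
    intro y
    rw [glmDensity, ENNReal.ofReal_mul (Real.exp_pos _).le, ENNReal.toReal_mul,
      ENNReal.toReal_ofReal (Real.exp_pos _).le, sub_eq_add_neg, Real.exp_add, mul_comm y t]
    simp only [hG, smul_eq_mul, ← ht]
    ring
  exact (integral_congr_ae (Eventually.of_forall e2)).trans
    (by rw [integral_const_mul, h0, mul_zero]; rfl)

/-! ### Local expansions of the likelihood -/

/-- Taylor bounds for `a` near bounded index values. -/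
lemma exists_taylor_bounds (D : SurveyGLM p Ω P) (K : ℝ) :
    ∃ B : ℝ, 0 ≤ B ∧ ∀ t₀ t : ℝ, |t₀| ≤ K → |t - t₀| ≤ 1 →
      |deriv D.a t₀| ≤ B ∧ |deriv (deriv D.a) t₀| ≤ B ∧
      |deriv D.a t - deriv D.a t₀| ≤ B * |t - t₀| ∧
      |deriv (deriv D.a) t - deriv (deriv D.a) t₀| ≤ B * |t - t₀| ∧
      |deriv D.a t - deriv D.a t₀ - deriv (deriv D.a) t₀ * (t - t₀)| ≤ B * |t - t₀| ^ 2 ∧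
      |D.a t - D.a t₀ - deriv D.a t₀ * (t - t₀) - deriv (deriv D.a) t₀ * (t - t₀) ^ 2 / 2| ≤
        B * |t - t₀| ^ 3 := by
  set a1 := deriv D.a with ha1
  set a2 := deriv a1 with ha2
  set a3 := deriv a2 with ha3
  have h2 : ContDiff ℝ (0 + 1) a2 := D.contDiff_deriv_deriv_a
  have c1 : Continuous a1 := D.contDiff_deriv_a.continuous
  have c2 : Continuous a2 := h2.continuous
  have c3 : Continuous a3 := (contDiff_succ_iff_deriv.1 h2).2.2.continuous
  have d0 : ∀ s, HasDerivAt D.a (a1 s) s := fun s => (D.differentiable_a s).hasDerivAt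
  have d1 : ∀ s, HasDerivAt a1 (a2 s) s := fun s =>
    (D.contDiff_deriv_a.differentiable (by norm_num) s).hasDerivAt
  have d2 : ∀ s, HasDerivAt a2 (a3 s) s := fun s =>
    (h2.differentiable (by norm_num) s).hasDerivAt
  obtain ⟨B1, hB1⟩ := (isCompact_closedBall (0 : ℝ) (K + 1)).exists_bound_of_continuousOn
    c1.continuousOn
  obtain ⟨B2, hB2⟩ := (isCompact_closedBall (0 : ℝ) (K + 1)).exists_bound_of_continuousOn
    c2.continuousOn
  obtain ⟨B3, hB3⟩ := (isCompact_closedBall (0 : ℝ) (K + 1)).exists_bound_of_continuousOn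
    c3.continuousOn
  set B := max (max B1 B2) (max B3 0) with hB
  have b1 : B1 ≤ B := (le_max_left _ _).trans (le_max_left _ _)
  have b2 : B2 ≤ B := (le_max_right _ _).trans (le_max_left _ _)
  have b3 : B3 ≤ B := (le_max_left _ _).trans (le_max_right _ _)
  have b0 : 0 ≤ B := (le_max_right _ _).trans (le_max_right _ _)
  refine ⟨B, b0, fun t₀ t ht₀ ht => ?_⟩
  set s := Metric.closedBall t₀ |t - t₀| with hs
  have hconv : Convex ℝ s := convex_closedBall _ _
  have hmem0 : t₀ ∈ s := Metric.mem_closedBall_self (abs_nonneg _)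
  have hmem : t ∈ s := by simp [hs, Real.dist_eq]
  have hsub : ∀ u ∈ s, u ∈ Metric.closedBall (0 : ℝ) (K + 1) := by
    intro u hu
    have hu' : |u - t₀| ≤ |t - t₀| := by simpa [hs, Real.dist_eq] using hu
    have : |u| ≤ |u - t₀| + |t₀| := by simpa using abs_add_le (u - t₀) t₀
    simp only [mem_closedBall_zero_iff, Real.norm_eq_abs]
    linarith
  have hdist : ∀ u ∈ s, |u - t₀| ≤ |t - t₀| := fun u hu => by simpa [hs, Real.dist_eq] using hu
  have mvt : ∀ (f f' : ℝ → ℝ) (C : ℝ), (∀ u, HasDerivAt f (f' u) u) → (∀ u ∈ s, |f' u| ≤ C) →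
      ∀ u ∈ s, |f u - f t₀| ≤ C * |u - t₀| := by
    intro f f' C hf hC u hu
    exact hconv.norm_image_sub_le_of_norm_hasDerivWithin_le
      (fun v hv => (hf v).hasDerivWithinAt) hC hmem0 hu
  have k1 := mvt a1 a2 B d1 fun u hu => (hB2 u (hsub u hu)).trans b2
  have k2 := mvt a2 a3 B d2 fun u hu => (hB3 u (hsub u hu)).trans b3
  have k3 := mvt (fun u => a1 u - a2 t₀ * (u - t₀)) (fun u => a2 u - a2 t₀ * 1) (B * |t - t₀|)
    (fun u => (d1 u).sub (((hasDerivAt_id u).sub_const t₀).const_mul _)) fun u hu => by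
      rw [mul_one]
      exact (k2 u hu).trans (mul_le_mul_of_nonneg_left (hdist u hu) b0)
  have k3' : ∀ u ∈ s, |a1 u - a1 t₀ - a2 t₀ * (u - t₀)| ≤ B * |t - t₀| ^ 2 := by
    intro u hu
    have := k3 u hu
    rw [sub_self, mul_zero, sub_zero] at this
    calc |a1 u - a1 t₀ - a2 t₀ * (u - t₀)| = |a1 u - a2 t₀ * (u - t₀) - a1 t₀| := by ring_nf
      _ ≤ B * |t - t₀| * |u - t₀| := this
      _ ≤ B * |t - t₀| * |t - t₀| := mul_le_mul_of_nonneg_left (hdist u hu) (by positivity)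
      _ = B * |t - t₀| ^ 2 := by ring
  have k4 := mvt (fun u => D.a u - a1 t₀ * (u - t₀) - a2 t₀ / 2 * (u - t₀) ^ 2)
    (fun u => a1 u - a1 t₀ - a2 t₀ * (u - t₀)) (B * |t - t₀| ^ 2)
    (fun u => by
      have e1 : HasDerivAt (fun u => u - t₀) 1 u := (hasDerivAt_id u).sub_const t₀
      have := ((d0 u).sub (e1.const_mul (a1 t₀))).sub ((e1.pow 2).const_mul (a2 t₀ / 2))
      refine this.congr_deriv ?_
      simp only [Nat.cast_ofNat, Nat.add_one_sub_one, pow_one]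
      ring) k3' t hmem
  refine ⟨(hB1 t₀ (hsub _ hmem0)).trans b1, (hB2 t₀ (hsub _ hmem0)).trans b2, k1 t hmem,
    k2 t hmem, k3' t hmem, ?_⟩
  simp only [sub_self, mul_zero, sub_zero, ne_eq, OfNat.ofNat_ne_zero, not_false_eq_true,
    zero_pow] at k4
  calc _ = |D.a t - a1 t₀ * (t - t₀) - a2 t₀ / 2 * (t - t₀) ^ 2 - D.a t₀| := by ring_nf
    _ ≤ B * |t - t₀| ^ 2 * |t - t₀| := k4
    _ = _ := by ring

lemma abs_mean_le {n : ℕ} {f : Fin n → ℝ} {B : ℝ} (hB0 : 0 ≤ B) (hf : ∀ i, |f i| ≤ B) :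
    |(n : ℝ)⁻¹ * ∑ i, f i| ≤ B := by
  rcases Nat.eq_zero_or_pos n with rfl | hn
  · simpa using hB0
  have hn' : (0 : ℝ) < n := by exact_mod_cast hn
  rw [abs_mul, abs_of_pos (inv_pos.2 hn'), inv_mul_le_iff₀ hn']
  refine (Finset.abs_sum_le_sum_abs _ _).trans ((Finset.sum_le_sum fun i _ => hf i).trans ?_)
  simp

/-- Sample points at which the almost sure bounds on the data hold. -/
structure IsRegularPoint (D : SurveyGLM p Ω P) (Cu : ℝ) (ω : Ω) : Prop where
  y_mem : ∀ n i, D.y n i ω ∈ D.Y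
  x_le : ∀ n i j, |D.x n i ω j| ≤ Cu
  index_le : ∀ n i, |D.x n i ω ⬝ᵥ D.θ₀| ≤ Cu
  resid_le : ∀ n i, |deriv D.a (D.x n i ω ⬝ᵥ D.θ₀) - D.y n i ω| ≤ Cu

lemma AsyValid.ae_isRegularPoint [IsProbabilityMeasure P] {D : SurveyGLM p Ω P}
    {Cl Cu ll lu η L₀ : ℝ} (hD : D.AsyValid Cl Cu ll lu η L₀) :
    ∀ᵐ ω ∂P, D.IsRegularPoint Cu ω := by
  have h1 : ∀ᵐ ω ∂P, ∀ n i, D.y n i ω ∈ D.Y :=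
    ae_all_iff.2 fun n => ae_all_iff.2 fun i => D.aemem_Y n i
  have h2 : ∀ᵐ ω ∂P, ∀ n i, ∀ j, |D.x n i ω j| < Cu :=
    ae_all_iff.2 fun n => ae_all_iff.2 fun i => hD.x_bdd n i
  have h3 : ∀ᵐ ω ∂P, ∀ n i, |D.x n i ω ⬝ᵥ D.θ₀| < Cu :=
    ae_all_iff.2 fun n => ae_all_iff.2 fun i => hD.index_bdd n i
  have h4 : ∀ᵐ ω ∂P, ∀ n i, ∀ y ∈ D.Y, |lossD D.a D.c y (D.x n i ω ⬝ᵥ D.θ₀)| ≤ Cu :=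
    ae_all_iff.2 fun n => ae_all_iff.2 fun i => hD.lossD_bdd n i
  filter_upwards [h1, h2, h3, h4] with ω h1 h2 h3 h4
  exact ⟨h1, fun n i j => (h2 n i j).le, fun n i => (h3 n i).le, fun n i => by
    rw [← D.lossD_eq]; exact h4 n i _ (h1 n i)⟩

lemma abs_dotProduct_le_of_abs_le {k : ℕ} {x h : Fin k → ℝ} {C : ℝ} (hx : ∀ j, |x j| ≤ C) :
    |x ⬝ᵥ h| ≤ k * C * ‖h‖ := by
  refine (Finset.abs_sum_le_sum_abs _ _).trans ?_
  calc ∑ j, |x j * h j| ≤ ∑ _j : Fin k, C * ‖h‖ := Finset.sum_le_sum fun j _ => by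
        rw [abs_mul]
        exact mul_le_mul (hx j) (norm_le_pi_norm h j) (abs_nonneg _) ((abs_nonneg _).trans (hx j))
    _ = k * C * ‖h‖ := by simp; ring

variable {D : SurveyGLM p Ω P}

lemma logLik_sub (n : ℕ) (ω : Ω) (θ θ' : Fin (p + 1) → ℝ) :
    D.logLik n ω θ' - D.logLik n ω θ = (n : ℝ)⁻¹ * ∑ i, D.w n i *
      (D.a (D.x n i ω ⬝ᵥ θ) - D.a (D.x n i ω ⬝ᵥ θ') -
        D.y n i ω * (D.x n i ω ⬝ᵥ θ - D.x n i ω ⬝ᵥ θ')) := by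
  simp only [logLik, loss]
  rw [neg_sub_neg, ← mul_sub, ← Finset.sum_sub_distrib]
  congr 1
  exact Finset.sum_congr rfl fun i _ => by ring

lemma hess_mulVec_apply (n : ℕ) (ω : Ω) (θ h : Fin (p + 1) → ℝ) (j : Fin (p + 1)) :
    (D.hess n ω θ *ᵥ h) j = (n : ℝ)⁻¹ * ∑ i, D.w n i * D.x n i ω j *
      (deriv (deriv D.a) (D.x n i ω ⬝ᵥ θ) * (D.x n i ω ⬝ᵥ h)) := by
  have e : ∀ i, D.x n i ω ⬝ᵥ h = ∑ k, D.x n i ω k * h k := fun i => rfl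
  simp only [hess, mulVec, Matrix.of_apply, lossDD_eq, e]
  rw [dotProduct]
  simp only [Finset.mul_sum, Finset.sum_mul]
  rw [Finset.sum_comm]
  exact Finset.sum_congr rfl fun i _ => Finset.sum_congr rfl fun k _ => by ring

lemma dotProduct_hess_mulVec (n : ℕ) (ω : Ω) (θ h : Fin (p + 1) → ℝ) :
    h ⬝ᵥ (D.hess n ω θ *ᵥ h) = (n : ℝ)⁻¹ * ∑ i, D.w n i *
      (deriv (deriv D.a) (D.x n i ω ⬝ᵥ θ) * (D.x n i ω ⬝ᵥ h) ^ 2) := by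
  have e : ∀ i, (D.x n i ω ⬝ᵥ h) ^ 2 = ∑ k, D.x n i ω k * h k * (D.x n i ω ⬝ᵥ h) := fun i => by
    rw [← Finset.sum_mul, sq]; rfl
  rw [dotProduct]
  simp only [hess_mulVec_apply, e]
  simp only [Finset.mul_sum]
  rw [Finset.sum_comm]
  exact Finset.sum_congr rfl fun i _ => Finset.sum_congr rfl fun k _ => by ring

lemma dotProduct_score (n : ℕ) (ω : Ω) (θ h : Fin (p + 1) → ℝ) :
    D.score n ω θ ⬝ᵥ h = -((n : ℝ)⁻¹ * ∑ i, D.w n i *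
      ((deriv D.a (D.x n i ω ⬝ᵥ θ) - D.y n i ω) * (D.x n i ω ⬝ᵥ h))) := by
  have e : ∀ i, D.x n i ω ⬝ᵥ h = ∑ k, D.x n i ω k * h k := fun i => rfl
  rw [dotProduct]
  simp only [score, lossD_eq, e]
  simp only [neg_mul, Finset.sum_neg_distrib, Finset.mul_sum, Finset.sum_mul]
  rw [Finset.sum_comm, neg_inj]
  exact Finset.sum_congr rfl fun i _ => Finset.sum_congr rfl fun k _ => by ring

/-- Uniform local expansions of likelihood, score, Hessian and information around `θ₀`. -/
lemma AsyValid.exists_local_expansion {Cl Cu ll lu η L₀ : ℝ}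
    (hD : D.AsyValid Cl Cu ll lu η L₀) :
    ∃ δ B : ℝ, 0 < δ ∧ 0 ≤ B ∧ ∀ n ω, D.IsRegularPoint Cu ω → ∀ h : Fin (p + 1) → ℝ, ‖h‖ ≤ δ →
      |D.logLik n ω D.θ₀ - D.logLik n ω (D.θ₀ + h) + D.score n ω D.θ₀ ⬝ᵥ h -
        (h ⬝ᵥ (D.hess n ω D.θ₀ *ᵥ h)) / 2| ≤ B * ‖h‖ ^ 3 ∧
      (∀ j, |D.score n ω (D.θ₀ + h) j - D.score n ω D.θ₀ j + (D.hess n ω D.θ₀ *ᵥ h) j| ≤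
        B * ‖h‖ ^ 2) ∧
      (∀ j k, |D.hess n ω (D.θ₀ + h) j k - D.hess n ω D.θ₀ j k| ≤ B * ‖h‖) ∧
      (∀ j k, |D.info n ω (D.θ₀ + h) j k - D.info n ω D.θ₀ j k| ≤ B * ‖h‖) := by
  obtain ⟨B, hB0, hB⟩ := D.exists_taylor_bounds Cu
  by_cases hne : ∃ ω₀, D.IsRegularPoint Cu ω₀
  swap
  · exact ⟨1, 0, one_pos, le_rfl, fun n ω hω => absurd ⟨ω, hω⟩ hne⟩
  obtain ⟨ω₀, hω₀⟩ := hne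
  have hCu : 0 ≤ Cu := (abs_nonneg _).trans (hω₀.x_le 1 0 0)
  set R : ℝ := (p + 1 : ℕ) * Cu with hR
  have hR0 : 0 ≤ R := by positivity
  have hw : ∀ n i, |D.w n i| ≤ Cu := fun n i => by
    rw [abs_of_pos (hD.Cl_pos.trans (hD.w_lower n i))]; exact (hD.w_upper n i).le
  set B1 := Cu * (B * R ^ 3) with hB1
  set B2 := Cu * Cu * (B * R ^ 2) with hB2
  set B3 := Cu * (Cu * Cu) * (B * R) with hB3
  set B4 := Cu ^ 2 * (Cu * Cu) * (B * R * (B + 2 * Cu)) with hB4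
  have hBs : 0 ≤ B1 ∧ 0 ≤ B2 ∧ 0 ≤ B3 ∧ 0 ≤ B4 := ⟨by positivity, by positivity, by positivity,
    by positivity⟩
  obtain ⟨hB1', hB2', hB3', hB4'⟩ := hBs
  refine ⟨(R + 1)⁻¹, B1 + B2 + B3 + B4, by positivity, by positivity, ?_⟩
  intro n ω hω h hh
  have hxh : ∀ i, |D.x n i ω ⬝ᵥ h| ≤ R * ‖h‖ := fun i =>
    abs_dotProduct_le_of_abs_le fun j => hω.x_le n i j
  have hxh1 : ∀ i, |D.x n i ω ⬝ᵥ h| ≤ 1 := by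
    intro i
    refine (hxh i).trans ?_
    calc R * ‖h‖ ≤ (R + 1) * (R + 1)⁻¹ := by gcongr; linarith
      _ = 1 := mul_inv_cancel₀ (by positivity)
  have hT := fun i => hB (D.x n i ω ⬝ᵥ D.θ₀) (D.x n i ω ⬝ᵥ (D.θ₀ + h)) (hω.index_le n i)
    (by rw [dotProduct_add, add_sub_cancel_left]; exact hxh1 i)
  simp only [dotProduct_add, add_sub_cancel_left] at hT
  have hn0 := norm_nonneg h
  refine ⟨?_, fun j => ?_, fun j k => ?_, fun j k => ?_⟩
  · rw [logLik_sub, dotProduct_score, dotProduct_hess_mulVec, ← sub_eq_add_neg, ← mul_sub,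
      ← Finset.sum_sub_distrib, mul_div_assoc, ← mul_sub, Finset.sum_div, ← Finset.sum_sub_distrib]
    refine (abs_mean_le (B := B1 * ‖h‖ ^ 3) (by positivity) fun i => ?_).trans
      (by gcongr; linarith)
    obtain ⟨_, _, _, _, _, h6⟩ := hT i
    have e : D.w n i * (D.a (D.x n i ω ⬝ᵥ (D.θ₀ + h)) - D.a (D.x n i ω ⬝ᵥ D.θ₀) -
        D.y n i ω * (D.x n i ω ⬝ᵥ (D.θ₀ + h) - D.x n i ω ⬝ᵥ D.θ₀)) -
        D.w n i * ((deriv D.a (D.x n i ω ⬝ᵥ D.θ₀) - D.y n i ω) * (D.x n i ω ⬝ᵥ h)) -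
        D.w n i * (deriv (deriv D.a) (D.x n i ω ⬝ᵥ D.θ₀) * (D.x n i ω ⬝ᵥ h) ^ 2) / 2 =
        D.w n i * (D.a (D.x n i ω ⬝ᵥ D.θ₀ + D.x n i ω ⬝ᵥ h) - D.a (D.x n i ω ⬝ᵥ D.θ₀) -
          deriv D.a (D.x n i ω ⬝ᵥ D.θ₀) * (D.x n i ω ⬝ᵥ h) -
          deriv (deriv D.a) (D.x n i ω ⬝ᵥ D.θ₀) * (D.x n i ω ⬝ᵥ h) ^ 2 / 2) := by
      rw [dotProduct_add]; ring
    rw [e, abs_mul]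
    calc _ ≤ Cu * (B * |D.x n i ω ⬝ᵥ h| ^ 3) := by gcongr; exact hw n i
      _ ≤ Cu * (B * (R * ‖h‖) ^ 3) := by gcongr; exact hxh i
      _ = B1 * ‖h‖ ^ 3 := by rw [hB1]; ring
  · have e : D.score n ω (D.θ₀ + h) j - D.score n ω D.θ₀ j + (D.hess n ω D.θ₀ *ᵥ h) j =
        (n : ℝ)⁻¹ * ∑ i, -(D.w n i * D.x n i ω j *
          (deriv D.a (D.x n i ω ⬝ᵥ D.θ₀ + D.x n i ω ⬝ᵥ h) - deriv D.a (D.x n i ω ⬝ᵥ D.θ₀) -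
            deriv (deriv D.a) (D.x n i ω ⬝ᵥ D.θ₀) * (D.x n i ω ⬝ᵥ h))) := by
      simp only [score, hess_mulVec_apply, lossD_eq, dotProduct_add]
      rw [neg_sub_neg, ← mul_sub, ← Finset.sum_sub_distrib, ← mul_add, ← Finset.sum_add_distrib]
      congr 1
      exact Finset.sum_congr rfl fun i _ => by ring
    rw [e]
    refine (abs_mean_le (B := B2 * ‖h‖ ^ 2) (by positivity) fun i => ?_).trans
      (by gcongr; linarith)
    obtain ⟨_, _, _, _, h5, _⟩ := hT i
    rw [abs_neg, abs_mul, abs_mul]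
    calc _ ≤ Cu * Cu * (B * |D.x n i ω ⬝ᵥ h| ^ 2) := by
          gcongr
          · exact hw n i
          · exact hω.x_le n i j
      _ ≤ Cu * Cu * (B * (R * ‖h‖) ^ 2) := by gcongr; exact hxh i
      _ = B2 * ‖h‖ ^ 2 := by rw [hB2]; ring
  · have e : D.hess n ω (D.θ₀ + h) j k - D.hess n ω D.θ₀ j k =
        (n : ℝ)⁻¹ * ∑ i, D.w n i * (D.x n i ω j * D.x n i ω k) *
          (deriv (deriv D.a) (D.x n i ω ⬝ᵥ D.θ₀ + D.x n i ω ⬝ᵥ h) -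
            deriv (deriv D.a) (D.x n i ω ⬝ᵥ D.θ₀)) := by
      simp only [hess, lossDD_eq, dotProduct_add, Matrix.of_apply]
      rw [← mul_sub, ← Finset.sum_sub_distrib]
      congr 1
      exact Finset.sum_congr rfl fun i _ => by ring
    rw [e]
    refine (abs_mean_le (B := B3 * ‖h‖) (by positivity) fun i => ?_).trans
      (by gcongr; linarith)
    obtain ⟨_, _, _, h4, _, _⟩ := hT i
    rw [abs_mul, abs_mul, abs_mul]
    calc _ ≤ Cu * (Cu * Cu) * (B * |D.x n i ω ⬝ᵥ h|) := by
          gcongr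
          · exact hw n i
          · exact hω.x_le n i j
          · exact hω.x_le n i k
      _ ≤ Cu * (Cu * Cu) * (B * (R * ‖h‖)) := by gcongr; exact hxh i
      _ = B3 * ‖h‖ := by rw [hB3]; ring
  · have e : D.info n ω (D.θ₀ + h) j k - D.info n ω D.θ₀ j k =
        (n : ℝ)⁻¹ * ∑ i, D.w n i ^ 2 * (D.x n i ω j * D.x n i ω k) *
          ((deriv D.a (D.x n i ω ⬝ᵥ D.θ₀ + D.x n i ω ⬝ᵥ h) - deriv D.a (D.x n i ω ⬝ᵥ D.θ₀)) *
            ((deriv D.a (D.x n i ω ⬝ᵥ D.θ₀ + D.x n i ω ⬝ᵥ h) - deriv D.a (D.x n i ω ⬝ᵥ D.θ₀)) +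
              2 * (deriv D.a (D.x n i ω ⬝ᵥ D.θ₀) - D.y n i ω))) := by
      simp only [info, lossD_eq, dotProduct_add, Matrix.of_apply]
      rw [← mul_sub, ← Finset.sum_sub_distrib]
      congr 1
      exact Finset.sum_congr rfl fun i _ => by ring
    rw [e]
    refine (abs_mean_le (B := B4 * ‖h‖) (by positivity) fun i => ?_).trans
      (by gcongr; linarith)
    obtain ⟨_, _, h3, _, _, _⟩ := hT i
    have hsum : |(deriv D.a (D.x n i ω ⬝ᵥ D.θ₀ + D.x n i ω ⬝ᵥ h) - deriv D.a (D.x n i ω ⬝ᵥ D.θ₀)) +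
        2 * (deriv D.a (D.x n i ω ⬝ᵥ D.θ₀) - D.y n i ω)| ≤ B + 2 * Cu := by
      refine (abs_add_le _ _).trans (add_le_add ?_ ?_)
      · exact h3.trans (mul_le_of_le_one_right hB0 (hxh1 i))
      · rw [abs_mul, abs_two]
        exact mul_le_mul_of_nonneg_left (hω.resid_le n i) (by norm_num)
    rw [abs_mul, abs_mul, abs_mul, abs_mul, abs_pow]
    calc _ ≤ Cu ^ 2 * (Cu * Cu) * ((B * |D.x n i ω ⬝ᵥ h|) * (B + 2 * Cu)) := by
          gcongr
          · exact hw n i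
          · exact hω.x_le n i j
          · exact hω.x_le n i k
      _ ≤ Cu ^ 2 * (Cu * Cu) * ((B * (R * ‖h‖)) * (B + 2 * Cu)) := by gcongr; exact hxh i
      _ = B4 * ‖h‖ := by rw [hB4]; ring

end SurveyGLM

namespace SurveyGLM

variable {p : ℕ} {Ω : Type*} [MeasurableSpace Ω] {P : Measure Ω} {D : SurveyGLM p Ω P}
  {Cl Cu ll lu η L₀ : ℝ}

/-! ### Limits of the score, Hessian and information at the true parameter -/

/-- Contribution of one observation to the score at `θ₀`. -/
noncomputable def scoreTerm (D : SurveyGLM p Ω P) (n : ℕ) (i : Fin n) (ω : Ω) : Fin (p + 1) → ℝ :=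
  fun j => -(D.w n i * D.x n i ω j * (deriv D.a (D.x n i ω ⬝ᵥ D.θ₀) - D.y n i ω))

lemma sqrt_smul_score (n : ℕ) (ω : Ω) :
    √(n : ℝ) • D.score n ω D.θ₀ = (√(n : ℝ))⁻¹ • ∑ i, D.scoreTerm n i ω := by
  ext j
  simp only [Pi.smul_apply, Finset.sum_apply, smul_eq_mul, score, scoreTerm, lossD_eq,
    Finset.sum_neg_distrib, mul_neg]
  rw [← mul_assoc, ← div_eq_mul_inv, Real.sqrt_div_self]

lemma measurable_deriv_a_index (n : ℕ) (i : Fin n) :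
    Measurable fun ω => deriv D.a (D.x n i ω ⬝ᵥ D.θ₀) := by
  have h1 : Measurable fun x : Fin (p + 1) → ℝ => x ⬝ᵥ D.θ₀ := by fun_prop
  exact D.contDiff_deriv_a.continuous.measurable.comp (h1.comp (D.measurable_x n i))

lemma measurable_deriv_deriv_a_index (n : ℕ) (i : Fin n) :
    Measurable fun ω => deriv (deriv D.a) (D.x n i ω ⬝ᵥ D.θ₀) := by
  have h1 : Measurable fun x : Fin (p + 1) → ℝ => x ⬝ᵥ D.θ₀ := by fun_prop
  exact D.contDiff_deriv_deriv_a.continuous.measurable.comp (h1.comp (D.measurable_x n i))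

lemma measurable_x_apply (n : ℕ) (i : Fin n) (j : Fin (p + 1)) :
    Measurable fun ω => D.x n i ω j := (measurable_pi_apply j).comp (D.measurable_x n i)

lemma measurable_scoreTerm (n : ℕ) (i : Fin n) : Measurable (D.scoreTerm n i) :=
  measurable_pi_lambda _ fun j =>
    (((measurable_x_apply n i j).const_mul _).mul
      ((measurable_deriv_a_index n i).sub (D.measurable_y n i))).neg

lemma measurable_sqrt_smul_score (n : ℕ) :
    Measurable fun ω => √(n : ℝ) • D.score n ω D.θ₀ := by
  simp only [sqrt_smul_score]
  have h1 : Measurable fun ω => ∑ i, D.scoreTerm n i ω :=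
    Finset.measurable_sum _ fun i _ => measurable_scoreTerm n i
  exact h1.const_smul (√(n : ℝ))⁻¹

variable [IsProbabilityMeasure P]

lemma AsyValid.Cu_pos (hD : D.AsyValid Cl Cu ll lu η L₀) : 0 < Cu :=
  hD.Cl_pos.trans ((hD.w_lower 1 0).trans (hD.w_upper 1 0))

lemma AsyValid.abs_w_le (hD : D.AsyValid Cl Cu ll lu η L₀) (n : ℕ) (i : Fin n) :
    |D.w n i| ≤ Cu := by
  rw [abs_of_pos (hD.Cl_pos.trans (hD.w_lower n i))]
  exact (hD.w_upper n i).le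

lemma AsyValid.ae_abs_scoreTerm_le (hD : D.AsyValid Cl Cu ll lu η L₀) (n : ℕ) (i : Fin n) :
    ∀ᵐ ω ∂P, ∀ j, |D.scoreTerm n i ω j| ≤ Cu * Cu * Cu := by
  have hCu := hD.Cu_pos
  filter_upwards [hD.ae_isRegularPoint] with ω hω j
  rw [scoreTerm, abs_neg, abs_mul, abs_mul]
  gcongr
  · exact hD.abs_w_le n i
  · exact hω.x_le n i j
  · exact hω.resid_le n i

lemma AsyValid.integral_scoreTerm (hD : D.AsyValid Cl Cu ll lu η L₀) (n : ℕ) (i : Fin n)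
    (j : Fin (p + 1)) : ∫ ω, D.scoreTerm n i ω j ∂P = 0 := by
  have hCu := hD.Cu_pos
  have := D.integral_mul_lossD n i (f := fun x => x j) (by fun_prop) (B := Cu * Cu) ?_
  · have e : ∀ ω, D.scoreTerm n i ω j =
        -D.w n i * (D.x n i ω j * (deriv D.a (D.x n i ω ⬝ᵥ D.θ₀) - D.y n i ω)) := fun ω => by
      rw [scoreTerm]; ring
    simp only [e, integral_const_mul, this, mul_zero]
  · filter_upwards [hD.ae_isRegularPoint] with ω hω
    rw [abs_mul]
    gcongr
    · exact hω.x_le n i j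
    · exact hω.resid_le n i

lemma AsyValid.popInfo_apply (hD : D.AsyValid Cl Cu ll lu η L₀) (n : ℕ) (j k : Fin (p + 1)) :
    D.popInfo n j k = (n : ℝ)⁻¹ * ∑ i, ∫ ω, D.scoreTerm n i ω j * D.scoreTerm n i ω k ∂P := by
  have hCu := hD.Cu_pos
  rw [popInfo, Matrix.of_apply, ← integral_finsetSum, ← integral_const_mul]
  · refine integral_congr_ae (Eventually.of_forall fun ω => ?_)
    simp only [info, Matrix.of_apply, scoreTerm, lossD_eq]
    congr 1
    exact Finset.sum_congr rfl fun i _ => by ring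
  · intro i _
    refine integrable_of_abs_le (B := (Cu * Cu * Cu) * (Cu * Cu * Cu))
      (((measurable_pi_apply j).comp (measurable_scoreTerm n i)).mul
        ((measurable_pi_apply k).comp (measurable_scoreTerm n i))) ?_
    filter_upwards [hD.ae_abs_scoreTerm_le n i] with ω hω
    rw [abs_mul]
    exact mul_le_mul (hω j) (hω k) (abs_nonneg _) (by positivity)

/-- Central limit theorem for the score at the true parameter. -/
theorem AsyValid.gaussianPi_le_liminf_score (hD : D.AsyValid Cl Cu ll lu η L₀)
    {Ilim : Matrix (Fin (p + 1)) (Fin (p + 1)) ℝ} (hIpos : Ilim.PosSemidef)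
    (hI : Tendsto D.popInfo atTop (𝓝 Ilim)) {L : Filter ℕ} (hL : L ≤ atTop)
    {G : Set (Fin (p + 1) → ℝ)} (hG : IsOpen G) :
    gaussianPi Ilim G ≤ liminf (fun n : ℕ => P {ω | √(n : ℝ) • D.score n ω D.θ₀ ∈ G}) L := by
  simp only [sqrt_smul_score]
  refine gaussianPi_le_liminf_normalized_sum measurable_scoreTerm (fun n => ?_)
    hD.ae_abs_scoreTerm_le hD.integral_scoreTerm hIpos (fun j k => ?_) hL hG
  · refine (hD.indep n).comp (fun i (z : ℝ × (Fin (p + 1) → ℝ)) j =>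
      -(D.w n i * z.2 j * (deriv D.a (z.2 ⬝ᵥ D.θ₀) - z.1))) fun i => ?_
    have h1 : Measurable fun x : Fin (p + 1) → ℝ => x ⬝ᵥ D.θ₀ := by fun_prop
    have h2 : Measurable fun z : ℝ × (Fin (p + 1) → ℝ) => deriv D.a (z.2 ⬝ᵥ D.θ₀) :=
      D.contDiff_deriv_a.continuous.measurable.comp (h1.comp measurable_snd)
    fun_prop
  · refine (tendsto_pi_nhds.1 (tendsto_pi_nhds.1 hI j) k).congr fun n => ?_
    exact hD.popInfo_apply n j k

/-- The entries of the sample Hessian (`true`) and information (`false`) at `θ₀`. -/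
noncomputable def momentStat (D : SurveyGLM p Ω P) (n : ℕ) (ω : Ω) :
    Bool × Fin (p + 1) × Fin (p + 1) → ℝ :=
  fun b => if b.1 then D.hess n ω D.θ₀ b.2.1 b.2.2 else D.info n ω D.θ₀ b.2.1 b.2.2

lemma measurable_momentStat (n : ℕ) : Measurable (D.momentStat n) := by
  refine measurable_pi_lambda _ fun b => ?_
  unfold momentStat
  have hx : ∀ (i : Fin n) j, Measurable fun ω => D.x n i ω j := fun i j => measurable_x_apply n i j
  have hy : ∀ i : Fin n, Measurable fun ω => D.y n i ω := fun i => D.measurable_y n i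
  split_ifs
  · simp only [hess, Matrix.of_apply, lossDD_eq]
    refine Measurable.const_mul (Finset.measurable_sum _ fun i _ => ?_) _
    exact (((hx i _).mul (hx i _)).const_mul _).mul (measurable_deriv_deriv_a_index n i)
  · simp only [info, Matrix.of_apply, lossD_eq]
    refine Measurable.const_mul (Finset.measurable_sum _ fun i _ => ?_) _
    exact (((hx i _).mul (hx i _)).const_mul _).mul
      (((measurable_deriv_a_index n i).sub (hy i)).pow_const 2)

/-- Law of large numbers for the sample Hessian and information at the true parameter. -/
theorem AsyValid.tendstoInProb_momentStat (hD : D.AsyValid Cl Cu ll lu η L₀)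
    {Hlim Ilim : Matrix (Fin (p + 1)) (Fin (p + 1)) ℝ}
    (hH : Tendsto D.popHess atTop (𝓝 Hlim)) (hI : Tendsto D.popInfo atTop (𝓝 Ilim))
    {L : Filter ℕ} (hL : L ≤ atTop) :
    TendstoInProb P D.momentStat L
      (fun b => if b.1 then Hlim b.2.1 b.2.2 else Ilim b.2.1 b.2.2) := by
  have hCu := hD.Cu_pos
  obtain ⟨B, hB0, hB⟩ := D.exists_taylor_bounds Cu
  have h1 : Measurable fun x : Fin (p + 1) → ℝ => x ⬝ᵥ D.θ₀ := by fun_prop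
  refine TendstoInProb.pi fun b => ?_
  obtain ⟨b, j, k⟩ := b
  cases b
  · have hZ : ∀ n (i : Fin n), Measurable fun z : ℝ × (Fin (p + 1) → ℝ) =>
        D.w n i ^ 2 * (z.2 j * z.2 k) * (deriv D.a (z.2 ⬝ᵥ D.θ₀) - z.1) ^ 2 := fun n i => by
      have h2 : Measurable fun z : ℝ × (Fin (p + 1) → ℝ) => deriv D.a (z.2 ⬝ᵥ D.θ₀) :=
        D.contDiff_deriv_a.continuous.measurable.comp (h1.comp measurable_snd)
      fun_prop
    have := tendstoInProb_mean (P := P) (m := Ilim j k) (B := Cu ^ 2 * (Cu * Cu) * Cu ^ 2)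
      (Z := fun n i ω => D.w n i ^ 2 * (D.x n i ω j * D.x n i ω k) *
        (deriv D.a (D.x n i ω ⬝ᵥ D.θ₀) - D.y n i ω) ^ 2)
      (fun n i => (hZ n i).comp ((D.measurable_y n i).prodMk (D.measurable_x n i)))
      (fun n => (hD.indep n).comp _ (hZ n)) (fun n i => ?_) ?_ hL
    · simpa only [momentStat, info, Matrix.of_apply, lossD_eq, Bool.false_eq_true, if_false]
        using this
    · filter_upwards [hD.ae_isRegularPoint] with ω hω
      rw [abs_mul, abs_mul, abs_mul, abs_pow, abs_pow]
      gcongr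
      · exact hD.abs_w_le n i
      · exact hω.x_le n i j
      · exact hω.x_le n i k
      · exact hω.resid_le n i
    · simpa only [popInfo, info, Matrix.of_apply, lossD_eq] using
        tendsto_pi_nhds.1 (tendsto_pi_nhds.1 hI j) k
  · have hZ : ∀ n (i : Fin n), Measurable fun z : ℝ × (Fin (p + 1) → ℝ) =>
        D.w n i * (z.2 j * z.2 k) * deriv (deriv D.a) (z.2 ⬝ᵥ D.θ₀) := fun n i => by
      have h2 : Measurable fun z : ℝ × (Fin (p + 1) → ℝ) => deriv (deriv D.a) (z.2 ⬝ᵥ D.θ₀) :=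
        D.contDiff_deriv_deriv_a.continuous.measurable.comp (h1.comp measurable_snd)
      fun_prop
    have := tendstoInProb_mean (P := P) (m := Hlim j k) (B := Cu * (Cu * Cu) * B)
      (Z := fun n i ω => D.w n i * (D.x n i ω j * D.x n i ω k) *
        deriv (deriv D.a) (D.x n i ω ⬝ᵥ D.θ₀))
      (fun n i => (hZ n i).comp ((D.measurable_y n i).prodMk (D.measurable_x n i)))
      (fun n => (hD.indep n).comp _ (hZ n)) (fun n i => ?_) ?_ hL
    · simpa only [momentStat, hess, Matrix.of_apply, lossDD_eq, if_true] using this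
    · filter_upwards [hD.ae_isRegularPoint] with ω hω
      rw [abs_mul, abs_mul, abs_mul]
      gcongr
      · exact hD.abs_w_le n i
      · exact hω.x_le n i j
      · exact hω.x_le n i k
      · exact (hB _ (D.x n i ω ⬝ᵥ D.θ₀) (hω.index_le n i) (by simp)).2.1
    · simpa only [popHess, hess, Matrix.of_apply, lossDD_eq] using
        tendsto_pi_nhds.1 (tendsto_pi_nhds.1 hH j) k

/-- A limit of symmetric matrices with eigenvalues bounded below by `l`. -/
lemma dotProduct_mulVec_ge_of_tendsto {k : ℕ} {A : ℕ → Matrix (Fin k) (Fin k) ℝ}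
    {A₀ : Matrix (Fin k) (Fin k) ℝ} (hA : Tendsto A atTop (𝓝 A₀)) {l u : ℝ}
    (he : ∀ n, 1 ≤ n → EigBetween l u (A n)) :
    A₀.IsHermitian ∧ ∀ x : Fin k → ℝ, l * (x ⬝ᵥ x) ≤ x ⬝ᵥ A₀ *ᵥ x := by
  have hent : ∀ i j, Tendsto (fun n => A n i j) atTop (𝓝 (A₀ i j)) := fun i j =>
    tendsto_pi_nhds.1 (tendsto_pi_nhds.1 hA i) j
  constructor
  · ext i j
    rw [conjTranspose_apply, star_trivial]
    refine tendsto_nhds_unique_of_eventuallyEq (hent j i) (hent i j) ?_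
    filter_upwards [eventually_ge_atTop 1] with n hn
    have h1 := (he n hn).1.isHermitian
    have h2 : (l • (1 : Matrix (Fin k) (Fin k) ℝ)).IsHermitian := by
      simp [IsHermitian]
    have h3 := (h1.add h2)
    rw [sub_add_cancel] at h3
    simpa using h3.apply i j
  · intro x
    have hq : Tendsto (fun n => x ⬝ᵥ A n *ᵥ x) atTop (𝓝 (x ⬝ᵥ A₀ *ᵥ x)) := by
      have hc : Continuous fun B : Matrix (Fin k) (Fin k) ℝ => x ⬝ᵥ B *ᵥ x := by fun_prop
      exact (hc.tendsto A₀).comp hA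
    refine ge_of_tendsto hq ?_
    filter_upwards [eventually_ge_atTop 1] with n hn
    have := (he n hn).1.dotProduct_mulVec_nonneg x
    simp only [star_trivial, sub_mulVec, smul_mulVec, one_mulVec, dotProduct_sub, dotProduct_smul,
      smul_eq_mul] at this
    linarith

lemma posDef_of_dotProduct_ge {k : ℕ} {A : Matrix (Fin k) (Fin k) ℝ} (hA : A.IsHermitian) {l : ℝ}
    (hl : 0 < l) (h : ∀ x : Fin k → ℝ, l * (x ⬝ᵥ x) ≤ x ⬝ᵥ A *ᵥ x) : A.PosDef := by
  refine PosDef.of_dotProduct_mulVec_pos hA fun x hx => ?_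
  have : 0 < x ⬝ᵥ x := by
    have h0 : 0 ≤ x ⬝ᵥ x := Finset.sum_nonneg fun i _ => mul_self_nonneg _
    exact lt_of_le_of_ne h0 fun h => hx (dotProduct_self_eq_zero.1 h.symm)
  simp only [star_trivial]
  exact lt_of_lt_of_le (by positivity) (h x)

end SurveyGLM

/-! ### Convex minimization -/

/-- A convex function that is larger on a sphere than at its center has a minimizer, and all its
minimizers are inside the sphere. -/
lemma exists_isMinOn_of_lt_on_sphere {ι : Type*} [Fintype ι] {f : (ι → ℝ) → ℝ}
    (hf : ConvexOn ℝ Set.univ f) (hc : Continuous f) {x₀ : ι → ℝ} {r : ℝ} (hr : 0 < r)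
    (hs : ∀ x, ‖x - x₀‖ = r → f x₀ < f x) :
    (∃ x, IsMinOn f Set.univ x) ∧ ∀ x, IsMinOn f Set.univ x → ‖x - x₀‖ ≤ r := by
  have hout : ∀ x, r < ‖x - x₀‖ → f x₀ < f x := by
    intro x hx
    have hpos : 0 < ‖x - x₀‖ := hr.trans hx
    set t := r / ‖x - x₀‖ with ht
    have ht0 : 0 < t := div_pos hr hpos
    have ht1 : t < 1 := (div_lt_one hpos).2 hx
    have h1 := hf.2 (Set.mem_univ x₀) (Set.mem_univ x) (sub_nonneg.2 ht1.le) ht0.le (by ring)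
    have h2 : f x₀ < f ((1 - t) • x₀ + t • x) := by
      refine hs _ ?_
      have : (1 - t) • x₀ + t • x - x₀ = t • (x - x₀) := by
        ext i; simp only [Pi.add_apply, Pi.sub_apply, Pi.smul_apply, smul_eq_mul]; ring
      rw [this, norm_smul, Real.norm_eq_abs, abs_of_pos ht0, ht, div_mul_cancel₀ _ hpos.ne']
    simp only [smul_eq_mul] at h1
    nlinarith
  constructor
  · obtain ⟨x, hx, hmin⟩ := (isCompact_closedBall x₀ r).exists_isMinOn
      ⟨x₀, Metric.mem_closedBall_self hr.le⟩ hc.continuousOn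
    refine ⟨x, fun z _ => ?_⟩
    by_cases hz : ‖z - x₀‖ ≤ r
    · exact hmin (by rwa [mem_closedBall_iff_norm])
    · exact (hmin (Metric.mem_closedBall_self hr.le)).trans (hout z (not_le.1 hz)).le
  · intro x hx
    by_contra hcon
    exact absurd (hx (Set.mem_univ x₀)) (not_le.2 (hout x (not_le.1 hcon)))

/-- First-order conditions at a minimizer of `f t + l |t + b|` at `t = 0`. -/
lemma subgradient_of_isMinOn {f : ℝ → ℝ} {f' l b : ℝ} (hl : 0 ≤ l) (hf : HasDerivAt f f' 0)
    (hmin : ∀ t, f 0 + l * |b| ≤ f t + l * |b + t|) :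
    |f'| ≤ l ∧ (b ≠ 0 → f' = -(l * Real.sign b)) := by
  have habs : ∀ a : ℝ, (∀ t : ℝ, |b + t| - |b| ≤ |t|) := fun _ t => by
    have := abs_add_le b t; linarith
  constructor
  · rw [abs_le]
    have hslope := hasDerivAt_iff_tendsto_slope_zero.1 hf
    constructor
    · refine ge_of_tendsto (hslope.mono_left (nhdsGT_le_nhdsNE 0)) ?_
      filter_upwards [self_mem_nhdsWithin] with t ht
      have ht' : 0 < t := ht
      have h1 := hmin t
      have h2 := habs 0 t
      rw [abs_of_pos ht'] at h2
      rw [zero_add, smul_eq_mul, inv_mul_eq_div, le_div_iff₀ ht']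
      nlinarith
    · refine le_of_tendsto (hslope.mono_left (nhdsLT_le_nhdsNE 0)) ?_
      filter_upwards [self_mem_nhdsWithin] with t ht
      have ht' : t < 0 := ht
      have h1 := hmin t
      have h2 := habs 0 t
      rw [abs_of_neg ht'] at h2
      rw [zero_add, smul_eq_mul, inv_mul_eq_div, div_le_iff_of_neg ht']
      nlinarith
  · intro hb
    have h1 : HasDerivAt (fun t => f t + l * (Real.sign b * (b + t))) (f' + l * (Real.sign b * 1)) 0 :=
      hf.add ((((hasDerivAt_id (0 : ℝ)).const_add b).const_mul _).const_mul l)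
    have hloc : IsLocalMin (fun t => f t + l * (Real.sign b * (b + t))) 0 := by
      have hnear : ∀ᶠ t : ℝ in 𝓝 0, Real.sign b * (b + t) = |b + t| := by
        have hcont : Tendsto (fun t : ℝ => b + t) (𝓝 0) (𝓝 b) := by
          have hc : Continuous fun t : ℝ => b + t := by fun_prop
          simpa using hc.tendsto 0
        rcases lt_or_gt_of_ne hb with h | h
        · filter_upwards [hcont.eventually (gt_mem_nhds h)] with t ht
          rw [Real.sign_of_neg h, abs_of_neg ht]; ring
        · filter_upwards [hcont.eventually (lt_mem_nhds h)] with t ht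
          rw [Real.sign_of_pos h, abs_of_pos ht]; ring
      filter_upwards [hnear] with t ht
      rw [ht, hnear.self_of_nhds, add_zero]
      exact hmin t
    have := hloc.hasDerivAt_eq_zero h1
    linarith

namespace SurveyGLM

variable {p : ℕ} {Ω : Type*} [MeasurableSpace Ω] {P : Measure Ω} {D : SurveyGLM p Ω P}
  {Cl Cu ll lu η L₀ : ℝ}

/-! ### First-order conditions of the Lasso -/

lemma continuous_logLik (n : ℕ) (ω : Ω) : Continuous (D.logLik n ω) := by
  have h := D.contDiff_a.continuous
  unfold logLik loss
  fun_prop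

lemma convexOn_neg_logLik (hD : D.AsyValid Cl Cu ll lu η L₀) {n : ℕ} {ω : Ω}
    (hω : D.IsRegularPoint Cu ω) : ConvexOn ℝ Set.univ fun θ => -D.logLik n ω θ := by
  have e : (fun θ => -D.logLik n ω θ) = fun θ => (n : ℝ)⁻¹ * ∑ i : Fin n, D.w n i *
      loss D.a D.c (D.y n i ω) (D.x n i ω ⬝ᵥ θ) := by
    ext θ; rw [logLik, neg_neg]
  rw [e]
  refine ⟨convex_univ, fun θ _ θ' _ s t hs ht hst => ?_⟩
  simp only [smul_eq_mul]
  rw [mul_left_comm s, mul_left_comm t, ← mul_add, Finset.mul_sum (a := s),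
    Finset.mul_sum (a := t), ← Finset.sum_add_distrib]
  refine mul_le_mul_of_nonneg_left (Finset.sum_le_sum fun i _ => ?_) (by positivity)
  have h := (hD.loss_convex _ (hω.y_mem n i)).2 (Set.mem_univ (D.x n i ω ⬝ᵥ θ))
    (Set.mem_univ (D.x n i ω ⬝ᵥ θ')) hs ht hst
  simp only [smul_eq_mul] at h
  rw [dotProduct_add, dotProduct_smul, dotProduct_smul, smul_eq_mul, smul_eq_mul,
    mul_left_comm s, mul_left_comm t, ← mul_add]
  exact mul_le_mul_of_nonneg_left h (hD.Cl_pos.trans (hD.w_lower n i)).le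

lemma continuous_lassoObj (n : ℕ) (lam : ℝ) (ω : Ω) : Continuous (D.lassoObj n lam ω) := by
  have := continuous_logLik (D := D) n ω
  unfold lassoObj
  fun_prop

lemma convexOn_lassoObj (hD : D.AsyValid Cl Cu ll lu η L₀) {n : ℕ} {ω : Ω}
    (hω : D.IsRegularPoint Cu ω) {lam : ℝ} (hlam : 0 ≤ lam) :
    ConvexOn ℝ Set.univ (D.lassoObj n lam ω) := by
  have h1 := convexOn_neg_logLik (n := n) hD hω
  have h2 : ConvexOn ℝ Set.univ fun θ : Fin (p + 1) → ℝ => lam * ∑ j : Fin p, |θ j.succ| := by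
    refine ⟨convex_univ, fun θ _ θ' _ s t hs ht hst => ?_⟩
    simp only [smul_eq_mul]
    rw [mul_left_comm s, mul_left_comm t, ← mul_add, Finset.mul_sum (a := s),
      Finset.mul_sum (a := t), ← Finset.sum_add_distrib]
    refine mul_le_mul_of_nonneg_left (Finset.sum_le_sum fun j _ => ?_) hlam
    simp only [Pi.add_apply, Pi.smul_apply, smul_eq_mul]
    refine (abs_add_le _ _).trans ?_
    rw [abs_mul, abs_mul, abs_of_nonneg hs, abs_of_nonneg ht]
  exact h1.add h2

lemma hasDerivAt_neg_logLik (n : ℕ) (ω : Ω) (θ : Fin (p + 1) → ℝ) (j : Fin (p + 1)) :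
    HasDerivAt (fun t : ℝ => -D.logLik n ω (θ + t • Pi.single j 1)) (-D.score n ω θ j) 0 := by
  have e : (fun t : ℝ => -D.logLik n ω (θ + t • Pi.single j 1)) = fun t : ℝ =>
      (n : ℝ)⁻¹ * ∑ i : Fin n, D.w n i *
        loss D.a D.c (D.y n i ω) (D.x n i ω ⬝ᵥ θ + t * D.x n i ω j) := by
    ext t
    simp only [logLik, neg_neg, dotProduct_add, dotProduct_smul, dotProduct_single, mul_one,
      smul_eq_mul]
  rw [e]
  have hl : ∀ y t, HasDerivAt (loss D.a D.c y) (lossD D.a D.c y t) t := fun y t => by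
    rw [D.lossD_eq]
    have : HasDerivAt (loss D.a D.c y) (deriv D.a t - y * 1) t :=
      (((D.differentiable_a t).hasDerivAt).sub ((hasDerivAt_id t).const_mul y)).sub_const _
    simpa using this
  have hs : ∀ i : Fin n, HasDerivAt (fun t : ℝ => D.w n i *
        loss D.a D.c (D.y n i ω) (D.x n i ω ⬝ᵥ θ + t * D.x n i ω j))
      (D.w n i * (lossD D.a D.c (D.y n i ω) (D.x n i ω ⬝ᵥ θ) * (1 * D.x n i ω j))) 0 := by
    intro i
    refine HasDerivAt.const_mul _ ?_
    refine HasDerivAt.comp (0 : ℝ) (h := fun t : ℝ => D.x n i ω ⬝ᵥ θ + t * D.x n i ω j)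
      (h₂ := loss D.a D.c (D.y n i ω)) ?_
      (((hasDerivAt_id (0 : ℝ)).mul_const (D.x n i ω j)).const_add _)
    simpa using hl (D.y n i ω) (D.x n i ω ⬝ᵥ θ)
  refine ((HasDerivAt.fun_sum fun i _ => hs i).const_mul ((n : ℝ)⁻¹)).congr_deriv ?_
  rw [score, neg_neg]
  congr 1
  exact Finset.sum_congr rfl fun i _ => by ring

/-- Karush-Kuhn-Tucker conditions of the Lasso. -/
lemma score_of_isMinOn {n : ℕ} {lam : ℝ} {ω : Ω} {θ : Fin (p + 1) → ℝ} (hlam : 0 ≤ lam)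
    (hmin : IsMinOn (D.lassoObj n lam ω) Set.univ θ) :
    D.score n ω θ 0 = 0 ∧ ∀ j, j ≠ 0 → |D.score n ω θ j| ≤ lam ∧
      (θ j ≠ 0 → D.score n ω θ j = lam * Real.sign (θ j)) := by
  have hm : ∀ (j : Fin (p + 1)) (t : ℝ), D.lassoObj n lam ω θ ≤
      D.lassoObj n lam ω (θ + t • Pi.single j 1) := fun j t => hmin (Set.mem_univ _)
  constructor
  · have hd := hasDerivAt_neg_logLik (D := D) n ω θ 0
    have hloc : IsLocalMin (fun t : ℝ => -D.logLik n ω (θ + t • Pi.single 0 1)) 0 := by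
      refine Eventually.of_forall fun t => ?_
      have := hm 0 t
      simp only [lassoObj, Pi.add_apply, Pi.smul_apply, Pi.single_apply, Fin.succ_ne_zero,
        if_false, smul_zero, add_zero] at this
      simp only [zero_smul, add_zero]
      linarith
    simpa using hloc.hasDerivAt_eq_zero hd
  · intro j hj
    obtain ⟨k, rfl⟩ := Fin.exists_succ_eq.2 hj
    have hd := hasDerivAt_neg_logLik (D := D) n ω θ k.succ
    obtain ⟨h1, h2⟩ := subgradient_of_isMinOn hlam hd (b := θ k.succ) fun t => by
      have h := hm k.succ t
      have hsum : ∀ v : Fin (p + 1) → ℝ, ∑ i : Fin p, |v i.succ| =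
          |v k.succ| + ∑ i ∈ Finset.univ.erase k, |v i.succ| := fun v =>
        (Finset.add_sum_erase _ _ (Finset.mem_univ k)).symm
      simp only [lassoObj] at h
      rw [hsum, hsum (θ + _)] at h
      have hrest : ∑ i ∈ Finset.univ.erase k, |(θ + t • (Pi.single k.succ 1 : Fin (p + 1) → ℝ)) i.succ| =
          ∑ i ∈ Finset.univ.erase k, |θ i.succ| := by
        refine Finset.sum_congr rfl fun i hi => ?_
        simp [(Finset.ne_of_mem_erase hi)]
      rw [hrest] at h
      simp only [Pi.add_apply, Pi.smul_apply, Pi.single_eq_same, smul_eq_mul, mul_one] at h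
      simp only [zero_smul, add_zero]
      linarith
    rw [abs_neg] at h1
    exact ⟨h1, fun hne => by have := h2 hne; linarith⟩

end SurveyGLM

/-! ### Limits of products of matrices and vectors -/

section MatrixLimits

variable {α m n k : Type*} [Fintype m] [Fintype n] [Fintype k] {F : Filter α}

lemma tendsto_dotProduct {x y : α → m → ℝ} {x₀ y₀ : m → ℝ} (hx : Tendsto x F (𝓝 x₀))
    (hy : Tendsto y F (𝓝 y₀)) : Tendsto (fun q => x q ⬝ᵥ y q) F (𝓝 (x₀ ⬝ᵥ y₀)) :=
  tendsto_finsetSum _ fun j _ => (tendsto_pi_nhds.1 hx j).mul (tendsto_pi_nhds.1 hy j)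

lemma tendsto_mulVec {A : α → Matrix m n ℝ} {x : α → n → ℝ} {A₀ : Matrix m n ℝ} {x₀ : n → ℝ}
    (hA : Tendsto A F (𝓝 A₀)) (hx : Tendsto x F (𝓝 x₀)) :
    Tendsto (fun q => A q *ᵥ x q) F (𝓝 (A₀ *ᵥ x₀)) :=
  tendsto_pi_nhds.2 fun i => tendsto_dotProduct (tendsto_pi_nhds.1 hA i) hx

lemma tendsto_matrix_mul {A : α → Matrix m n ℝ} {B : α → Matrix n k ℝ} {A₀ : Matrix m n ℝ}
    {B₀ : Matrix n k ℝ} (hA : Tendsto A F (𝓝 A₀)) (hB : Tendsto B F (𝓝 B₀)) :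
    Tendsto (fun q => A q * B q) F (𝓝 (A₀ * B₀)) :=
  tendsto_pi_nhds.2 fun i => tendsto_pi_nhds.2 fun j => tendsto_dotProduct
    (tendsto_pi_nhds.1 hA i) (tendsto_pi_nhds.2 fun l => tendsto_pi_nhds.1 (tendsto_pi_nhds.1 hB l) j)

lemma tendsto_vecMul {A : α → Matrix m n ℝ} {x : α → m → ℝ} {A₀ : Matrix m n ℝ} {x₀ : m → ℝ}
    (hx : Tendsto x F (𝓝 x₀)) (hA : Tendsto A F (𝓝 A₀)) :
    Tendsto (fun q => x q ᵥ* A q) F (𝓝 (x₀ ᵥ* A₀)) :=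
  tendsto_pi_nhds.2 fun j => tendsto_dotProduct hx
    (tendsto_pi_nhds.2 fun i => tendsto_pi_nhds.1 (tendsto_pi_nhds.1 hA i) j)

end MatrixLimits

namespace SurveyGLM

variable {p : ℕ} {Ω : Type*} [MeasurableSpace Ω] {P : Measure Ω} {D : SurveyGLM p Ω P}
  {Cl Cu ll lu η L₀ : ℝ}

/-! ### Local asymptotics of the Lasso -/

/-- A filter on pairs `(n, ω)` along which the rescaled score, the Hessian and the information at
`θ₀` tend to `w`, `H` and `I`, and the rescaled penalty level tends to `c`. -/
structure IsLocalSeq (D : SurveyGLM p Ω P) (Cu : ℝ) (lam : ℕ → ℝ)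
    (th : ℕ → Ω → (Fin (p + 1) → ℝ)) (𝒱 : Filter (ℕ × Ω)) (w : Fin (p + 1) → ℝ)
    (H I : Matrix (Fin (p + 1)) (Fin (p + 1)) ℝ) (c : ℝ) : Prop where
  fst : Tendsto Prod.fst 𝒱 atTop
  regular : ∀ᶠ q in 𝒱, D.IsRegularPoint Cu q.2
  lasso : ∀ᶠ q in 𝒱, (∃ θ, IsMinOn (D.lassoObj q.1 (lam q.1) q.2) Set.univ θ) →
    IsMinOn (D.lassoObj q.1 (lam q.1) q.2) Set.univ (th q.1 q.2)
  score : Tendsto (fun q : ℕ × Ω => √(q.1 : ℝ) • D.score q.1 q.2 D.θ₀) 𝒱 (𝓝 w)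
  hess : Tendsto (fun q : ℕ × Ω => D.hess q.1 q.2 D.θ₀) 𝒱 (𝓝 H)
  info : Tendsto (fun q : ℕ × Ω => D.info q.1 q.2 D.θ₀) 𝒱 (𝓝 I)
  pen : Tendsto (fun q : ℕ × Ω => √(q.1 : ℝ) * lam q.1) 𝒱 (𝓝 c)
  pen_pos : ∀ᶠ q in 𝒱, 0 < lam q.1

variable {lam : ℕ → ℝ} {th : ℕ → Ω → (Fin (p + 1) → ℝ)} {w : Fin (p + 1) → ℝ}
  {H I : Matrix (Fin (p + 1)) (Fin (p + 1)) ℝ} {c : ℝ}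

lemma norm_sq_le_dotProduct_self {ι : Type*} [Fintype ι] (h : ι → ℝ) : ‖h‖ ^ 2 ≤ h ⬝ᵥ h := by
  have h0 : 0 ≤ h ⬝ᵥ h := Finset.sum_nonneg fun i _ => mul_self_nonneg _
  rw [← Real.sq_sqrt h0]
  refine pow_le_pow_left₀ (norm_nonneg _) ?_ 2
  refine (pi_norm_le_iff_of_nonneg (Real.sqrt_nonneg _)).2 fun i => ?_
  rw [Real.norm_eq_abs, ← Real.sqrt_sq_eq_abs]
  refine Real.sqrt_le_sqrt ?_
  rw [sq]
  exact Finset.single_le_sum (f := fun i => h i * h i) (fun i _ => mul_self_nonneg _)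
    (Finset.mem_univ i)

lemma abs_dotProduct_mulVec_le {ι : Type*} [Fintype ι] (A : Matrix ι ι ℝ) (h : ι → ℝ) :
    |h ⬝ᵥ A *ᵥ h| ≤ (∑ i, ∑ j, |A i j|) * ‖h‖ ^ 2 := by
  simp only [dotProduct, mulVec, Finset.mul_sum, Finset.sum_mul]
  refine (Finset.abs_sum_le_sum_abs _ _).trans (Finset.sum_le_sum fun i _ => ?_)
  refine (Finset.abs_sum_le_sum_abs _ _).trans (Finset.sum_le_sum fun j _ => ?_)
  rw [abs_mul, abs_mul, sq]
  have hi := norm_le_pi_norm h i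
  have hj := norm_le_pi_norm h j
  rw [Real.norm_eq_abs] at hi hj
  calc |h i| * (|A i j| * |h j|) = |A i j| * (|h i| * |h j|) := by ring
    _ ≤ |A i j| * (‖h‖ * ‖h‖) := by gcongr

namespace IsLocalSeq

variable {𝒱 : Filter (ℕ × Ω)}

lemma tendsto_sqrt (hs : D.IsLocalSeq Cu lam th 𝒱 w H I c) :
    Tendsto (fun q : ℕ × Ω => √(q.1 : ℝ)) 𝒱 atTop :=
  Real.tendsto_sqrt_atTop.comp (tendsto_natCast_atTop_atTop.comp hs.fst)

lemma tendsto_inv_sqrt (hs : D.IsLocalSeq Cu lam th 𝒱 w H I c) :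
    Tendsto (fun q : ℕ × Ω => (√(q.1 : ℝ))⁻¹) 𝒱 (𝓝 0) :=
  tendsto_inv_atTop_zero.comp hs.tendsto_sqrt

/-- The objective exceeds its value at `θ₀` on a sphere of radius of order `n^{-1/2}`; by convexity
the Lasso exists and is `√n`-consistent. -/
lemma exists_bound (hD : D.AsyValid Cl Cu ll lu η L₀) (hs : D.IsLocalSeq Cu lam th 𝒱 w H I c)
    (hH : ∀ x : Fin (p + 1) → ℝ, ll * (x ⬝ᵥ x) ≤ x ⬝ᵥ H *ᵥ x) :
    ∃ K : ℝ, ∀ᶠ q in 𝒱, IsMinOn (D.lassoObj q.1 (lam q.1) q.2) Set.univ (th q.1 q.2) ∧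
      ‖√(q.1 : ℝ) • (th q.1 q.2 - D.θ₀)‖ ≤ K := by
  obtain ⟨δ, B, hδ, hB, hexp⟩ := hD.exists_local_expansion
  have hll := hD.ll_pos
  set d : ℝ := ((p + 1 : ℕ) : ℝ) with hd
  have hd0 : 0 ≤ d := Nat.cast_nonneg _
  -- `m` exceeds by one the rates of the linear term and of the penalty, and at radius `K n^{-1/2}`
  -- the quadratic term is `m K / n`; the spare unit absorbs the cubic remainder
  set m : ℝ := d * (‖w‖ + 1) + (|c| + 1) * p + 1 with hm
  have hm1 : 1 ≤ m := by
    have : 0 ≤ d * (‖w‖ + 1) + (|c| + 1) * p := by positivity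
    linarith
  set K : ℝ := 4 / ll * m with hK
  have hK0 : 0 < K := by positivity
  have hKm : ll / 4 * K = m := by rw [hK]; field_simp
  refine ⟨K, ?_⟩
  have hsc : ∀ᶠ q in 𝒱, ‖√(q.1 : ℝ) • D.score q.1 q.2 D.θ₀‖ ≤ ‖w‖ + 1 :=
    (hs.score.norm.eventually (gt_mem_nhds (lt_add_one ‖w‖))).mono fun _ h => le_of_lt h
  have hpen : ∀ᶠ q in 𝒱, √(q.1 : ℝ) * lam q.1 ≤ |c| + 1 :=
    (hs.pen.eventually (gt_mem_nhds ((le_abs_self c).trans_lt (lt_add_one _)))).mono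
      fun _ h => le_of_lt h
  have hhess : ∀ᶠ q in 𝒱, ∑ i, ∑ j, |(D.hess q.1 q.2 D.θ₀ - H) i j| ≤ ll / 2 := by
    have hc : Continuous fun A : Matrix (Fin (p + 1)) (Fin (p + 1)) ℝ =>
      ∑ i, ∑ j, |(A - H) i j| := by
        simp only [Matrix.sub_apply]
        fun_prop
    have := (hc.tendsto H).comp hs.hess
    simp only [sub_self, Matrix.zero_apply, abs_zero, Finset.sum_const_zero] at this
    exact (this.eventually (gt_mem_nhds (half_pos hll))).mono fun _ h => le_of_lt h
  have hsmall1 : ∀ᶠ q in 𝒱, K * (√(q.1 : ℝ))⁻¹ < δ := by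
    have := hs.tendsto_inv_sqrt.const_mul K
    rw [mul_zero] at this
    exact this.eventually (gt_mem_nhds hδ)
  have hsmall2 : ∀ᶠ q in 𝒱, B * K ^ 2 * (√(q.1 : ℝ))⁻¹ < 1 := by
    have := hs.tendsto_inv_sqrt.const_mul (B * K ^ 2)
    rw [mul_zero] at this
    exact this.eventually (gt_mem_nhds one_pos)
  filter_upwards [hs.regular, hs.lasso, hsc, hpen, hhess, hsmall1, hsmall2, hs.pen_pos,
    hs.tendsto_sqrt.eventually_gt_atTop 0] with q hreg hlasso hsc hpen hhess h1 h2 hlam hn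
  set r := (√(q.1 : ℝ))⁻¹ with hr
  have hr0 : 0 < r := inv_pos.2 hn
  have hrn : r * √(q.1 : ℝ) = 1 := inv_mul_cancel₀ hn.ne'
  have hsphere : ∀ x, ‖x - D.θ₀‖ = K * r →
      D.lassoObj q.1 (lam q.1) q.2 D.θ₀ < D.lassoObj q.1 (lam q.1) q.2 x := by
    intro x hx
    set h := x - D.θ₀ with hh
    have hxh : x = D.θ₀ + h := by rw [hh]; abel
    have e1 := (abs_le.1 (hexp q.1 q.2 hreg h (hx.le.trans h1.le)).1).1
    -- the score at `θ₀` is of order `n^{-1/2}`, so the linear term is of order `n^{-1/2} ‖h‖`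
    have e2 : D.score q.1 q.2 D.θ₀ ⬝ᵥ h ≤ r * (d * (‖w‖ + 1) * ‖h‖) := by
      have := abs_dotProduct_le_of_abs_le (x := √(q.1 : ℝ) • D.score q.1 q.2 D.θ₀) (h := h)
        fun j => (norm_le_pi_norm _ j).trans hsc
      rw [smul_dotProduct, smul_eq_mul] at this
      calc D.score q.1 q.2 D.θ₀ ⬝ᵥ h = r * (√(q.1 : ℝ) * (D.score q.1 q.2 D.θ₀ ⬝ᵥ h)) := by
            rw [← mul_assoc, hrn, one_mul]
        _ ≤ _ := mul_le_mul_of_nonneg_left ((le_abs_self _).trans this) hr0.le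
    -- half of the curvature `ll` of the limit `H` survives the error of the sample Hessian
    have e3 : ll / 2 * ‖h‖ ^ 2 ≤ h ⬝ᵥ D.hess q.1 q.2 D.θ₀ *ᵥ h := by
      have a1 := (abs_le.1 (abs_dotProduct_mulVec_le (D.hess q.1 q.2 D.θ₀ - H) h)).1
      rw [sub_mulVec, dotProduct_sub] at a1
      have a2 := hH h
      have a3 := mul_le_mul_of_nonneg_left (norm_sq_le_dotProduct_self h) hll.le
      have a4 := mul_le_mul_of_nonneg_right hhess (sq_nonneg ‖h‖)
      linarith
    -- the penalty can decrease by at most `O(n^{-1/2} ‖h‖)`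
    have e4 : ∑ j : Fin p, |D.θ₀ j.succ| - ∑ j : Fin p, |x j.succ| ≤ p * ‖h‖ := by
      rw [← Finset.sum_sub_distrib]
      calc _ ≤ ∑ _j : Fin p, ‖h‖ := Finset.sum_le_sum fun j _ => by
            have := abs_sub_abs_le_abs_sub (D.θ₀ j.succ) (x j.succ)
            rw [abs_sub_comm] at this
            exact this.trans (norm_le_pi_norm h j.succ)
        _ = p * ‖h‖ := by simp
    have e5 : lam q.1 * (∑ j : Fin p, |D.θ₀ j.succ| - ∑ j : Fin p, |x j.succ|) ≤
        r * ((|c| + 1) * (p * ‖h‖)) := by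
      have hph : 0 ≤ p * ‖h‖ := by positivity
      calc _ ≤ lam q.1 * (p * ‖h‖) := mul_le_mul_of_nonneg_left e4 hlam.le
        _ = r * ((√(q.1 : ℝ) * lam q.1) * (p * ‖h‖)) := by
            rw [← mul_assoc r, ← mul_assoc r, hrn, one_mul]
        _ ≤ _ := mul_le_mul_of_nonneg_left (mul_le_mul_of_nonneg_right hpen hph) hr0.le
    rw [← hxh] at e1
    simp only [lassoObj]
    rw [hx] at e1 e2 e3 e5
    have hkey : 0 < K * r ^ 2 * (ll / 4 * K - (d * (‖w‖ + 1) + (|c| + 1) * p) -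
        B * K ^ 2 * r) := by
      rw [hKm, hm]
      have : 0 < K * r ^ 2 := by positivity
      refine mul_pos this ?_
      linarith
    have hid : K * r ^ 2 * (ll / 4 * K - (d * (‖w‖ + 1) + (|c| + 1) * p) - B * K ^ 2 * r) =
        ll / 2 * (K * r) ^ 2 / 2 - r * (d * (‖w‖ + 1) * (K * r)) -
          r * ((|c| + 1) * (p * (K * r))) - B * (K * r) ^ 3 := by ring
    rw [hid] at hkey
    linarith
  obtain ⟨hex, hle⟩ := exists_isMinOn_of_lt_on_sphere (convexOn_lassoObj hD hreg hlam.le)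
    (continuous_lassoObj q.1 (lam q.1) q.2) (mul_pos hK0 hr0) hsphere
  have hmin := hlasso hex
  refine ⟨hmin, ?_⟩
  rw [norm_smul, Real.norm_eq_abs, abs_of_pos hn]
  calc √(q.1 : ℝ) * ‖th q.1 q.2 - D.θ₀‖ ≤ √(q.1 : ℝ) * (K * r) :=
        mul_le_mul_of_nonneg_left (hle _ hmin) hn.le
    _ = K * (r * √(q.1 : ℝ)) := by ring
    _ = K := by rw [hrn, mul_one]

end IsLocalSeq

/-- The local limit of the Lasso: `u` is the limit of `√n (θ̂ - θ₀)`. -/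
structure IsLocalLimit (D : SurveyGLM p Ω P) (lam : ℕ → ℝ) (th : ℕ → Ω → (Fin (p + 1) → ℝ))
    (𝒱 : Filter (ℕ × Ω)) (w : Fin (p + 1) → ℝ) (H I : Matrix (Fin (p + 1)) (Fin (p + 1)) ℝ)
    (u : Fin (p + 1) → ℝ) : Prop where
  est : Tendsto (fun q : ℕ × Ω => √(q.1 : ℝ) • (th q.1 q.2 - D.θ₀)) 𝒱 (𝓝 u)
  consistent : Tendsto (fun q : ℕ × Ω => th q.1 q.2) 𝒱 (𝓝 D.θ₀)
  score : Tendsto (fun q : ℕ × Ω => √(q.1 : ℝ) • D.score q.1 q.2 (th q.1 q.2)) 𝒱 (𝓝 (w - H *ᵥ u))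
  hess : Tendsto (fun q : ℕ × Ω => D.hess q.1 q.2 (th q.1 q.2)) 𝒱 (𝓝 H)
  info : Tendsto (fun q : ℕ × Ω => D.info q.1 q.2 (th q.1 q.2)) 𝒱 (𝓝 I)
  score_zero : ∀ᶠ q in 𝒱, D.score q.1 q.2 (th q.1 q.2) 0 = 0
  score_le : ∀ᶠ q in 𝒱, ∀ j, j ≠ 0 → |D.score q.1 q.2 (th q.1 q.2) j| ≤ lam q.1
  score_eq : ∀ᶠ q in 𝒱, ∀ j, j ≠ 0 → th q.1 q.2 j ≠ 0 →
    D.score q.1 q.2 (th q.1 q.2) j = lam q.1 * Real.sign (th q.1 q.2 j)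

lemma IsLocalSeq.tendsto_score_est {𝒱 : Filter (ℕ × Ω)} {u : Fin (p + 1) → ℝ}
    (hD : D.AsyValid Cl Cu ll lu η L₀) (hs : D.IsLocalSeq Cu lam th 𝒱 w H I c)
    (hest : Tendsto (fun q : ℕ × Ω => √(q.1 : ℝ) • (th q.1 q.2 - D.θ₀)) 𝒱 (𝓝 u))
    (hnorm : Tendsto (fun q : ℕ × Ω => ‖th q.1 q.2 - D.θ₀‖) 𝒱 (𝓝 0)) :
    Tendsto (fun q : ℕ × Ω => √(q.1 : ℝ) • D.score q.1 q.2 (th q.1 q.2)) 𝒱 (𝓝 (w - H *ᵥ u)) := by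
  obtain ⟨δ, B, hδ, hB, hexp⟩ := hD.exists_local_expansion
  have hlin : Tendsto (fun q : ℕ × Ω => √(q.1 : ℝ) • D.score q.1 q.2 D.θ₀ -
      D.hess q.1 q.2 D.θ₀ *ᵥ (√(q.1 : ℝ) • (th q.1 q.2 - D.θ₀))) 𝒱 (𝓝 (w - H *ᵥ u)) :=
    hs.score.sub (tendsto_mulVec hs.hess hest)
  refine tendsto_pi_nhds.2 fun j => ?_
  have hbd : Tendsto (fun q : ℕ × Ω => B * (‖√(q.1 : ℝ) • (th q.1 q.2 - D.θ₀)‖ *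
      ‖th q.1 q.2 - D.θ₀‖)) 𝒱 (𝓝 0) := by
    have := (hest.norm.mul hnorm).const_mul B
    rwa [mul_zero, mul_zero] at this
  have hrem : Tendsto (fun q : ℕ × Ω => (√(q.1 : ℝ) • D.score q.1 q.2 (th q.1 q.2)) j -
      (√(q.1 : ℝ) • D.score q.1 q.2 D.θ₀ -
        D.hess q.1 q.2 D.θ₀ *ᵥ (√(q.1 : ℝ) • (th q.1 q.2 - D.θ₀))) j) 𝒱 (𝓝 0) := by
    refine squeeze_zero_norm' ?_ hbd
    filter_upwards [hs.regular, hnorm.eventually (gt_mem_nhds hδ)] with q hreg hq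
    have h2 := (hexp q.1 q.2 hreg _ (le_of_lt hq)).2.1 j
    rw [add_sub_cancel] at h2
    have e : (√(q.1 : ℝ) • D.score q.1 q.2 (th q.1 q.2)) j -
        (√(q.1 : ℝ) • D.score q.1 q.2 D.θ₀ -
          D.hess q.1 q.2 D.θ₀ *ᵥ (√(q.1 : ℝ) • (th q.1 q.2 - D.θ₀))) j =
        √(q.1 : ℝ) * (D.score q.1 q.2 (th q.1 q.2) j - D.score q.1 q.2 D.θ₀ j +
          (D.hess q.1 q.2 D.θ₀ *ᵥ (th q.1 q.2 - D.θ₀)) j) := by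
      rw [mulVec_smul]
      simp only [Pi.sub_apply, Pi.smul_apply, smul_eq_mul]
      ring
    rw [e, norm_mul, norm_smul, Real.norm_eq_abs (_ + _)]
    calc _ ≤ ‖√(q.1 : ℝ)‖ * (B * ‖th q.1 q.2 - D.θ₀‖ ^ 2) :=
          mul_le_mul_of_nonneg_left h2 (norm_nonneg _)
      _ = _ := by ring
  have := hrem.add (tendsto_pi_nhds.1 hlin j)
  rw [zero_add] at this
  exact this.congr fun q => sub_add_cancel _ _

/-- By `√n`-consistency the rescaled estimation error has a limit along an ultrafilter; the moments
at the estimate have the limits they have at `θ₀`, and the first-order conditions hold. -/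
lemma IsLocalSeq.exists_isLocalLimit {𝒱 : Ultrafilter (ℕ × Ω)}
    (hD : D.AsyValid Cl Cu ll lu η L₀) (hs : D.IsLocalSeq Cu lam th 𝒱 w H I c)
    (hH : ∀ x : Fin (p + 1) → ℝ, ll * (x ⬝ᵥ x) ≤ x ⬝ᵥ H *ᵥ x) :
    ∃ u, D.IsLocalLimit lam th 𝒱 w H I u := by
  obtain ⟨K, hK⟩ := hs.exists_bound hD hH
  obtain ⟨δ, B, hδ, hB, hexp⟩ := hD.exists_local_expansion
  obtain ⟨u, -, hu⟩ := (isCompact_closedBall (0 : Fin (p + 1) → ℝ) K).ultrafilter_le_nhds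
    (𝒱.map fun q : ℕ × Ω => √(q.1 : ℝ) • (th q.1 q.2 - D.θ₀)) (by
      rw [le_principal_iff]
      exact hK.mono fun q hq => by simpa using hq.2)
  have hest : Tendsto (fun q : ℕ × Ω => √(q.1 : ℝ) • (th q.1 q.2 - D.θ₀)) 𝒱 (𝓝 u) := hu
  have hdiff : Tendsto (fun q : ℕ × Ω => th q.1 q.2 - D.θ₀) (𝒱 : Filter (ℕ × Ω)) (𝓝 0) := by
    have := hs.tendsto_inv_sqrt.smul hest
    rw [zero_smul] at this
    refine this.congr' ?_
    filter_upwards [hs.tendsto_sqrt.eventually_gt_atTop 0] with q hq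
    rw [smul_smul, inv_mul_cancel₀ hq.ne', one_smul]
  have hnorm : Tendsto (fun q : ℕ × Ω => ‖th q.1 q.2 - D.θ₀‖) (𝒱 : Filter (ℕ × Ω)) (𝓝 0) := by
    simpa using hdiff.norm
  have hcons : Tendsto (fun q : ℕ × Ω => th q.1 q.2) (𝒱 : Filter (ℕ × Ω)) (𝓝 D.θ₀) := by
    simpa using hdiff.add_const D.θ₀
  have hnear : ∀ᶠ q in (𝒱 : Filter (ℕ × Ω)), ‖th q.1 q.2 - D.θ₀‖ ≤ δ :=
    (hnorm.eventually (gt_mem_nhds hδ)).mono fun _ h => le_of_lt h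
  have hth : ∀ q : ℕ × Ω, D.θ₀ + (th q.1 q.2 - D.θ₀) = th q.1 q.2 := fun q => by abel
  have hent : ∀ {f f₀ : ℕ × Ω → Matrix (Fin (p + 1)) (Fin (p + 1)) ℝ}
      {A : Matrix (Fin (p + 1)) (Fin (p + 1)) ℝ}, Tendsto f₀ 𝒱 (𝓝 A) →
      (∀ᶠ q in (𝒱 : Filter (ℕ × Ω)), ∀ j k, |f q j k - f₀ q j k| ≤ B * ‖th q.1 q.2 - D.θ₀‖) →
      Tendsto f 𝒱 (𝓝 A) := by
    intro f f₀ A hf₀ hff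
    refine tendsto_pi_nhds.2 fun j => tendsto_pi_nhds.2 fun k => ?_
    have h1 : Tendsto (fun q : ℕ × Ω => f q j k - f₀ q j k) (𝒱 : Filter (ℕ × Ω)) (𝓝 0) := by
      refine squeeze_zero_norm' (hff.mono fun q hq => hq j k) ?_
      simpa using hnorm.const_mul B
    simpa using h1.add (tendsto_pi_nhds.1 (tendsto_pi_nhds.1 hf₀ j) k)
  refine ⟨u, hest, hcons, ?_, ?_, ?_, ?_, ?_, ?_⟩
  · exact hs.tendsto_score_est hD hest hnorm
  · refine hent hs.hess ?_
    filter_upwards [hs.regular, hnear] with q hreg hq j k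
    have := (hexp q.1 q.2 hreg _ hq).2.2.1 j k
    rwa [hth] at this
  · refine hent hs.info ?_
    filter_upwards [hs.regular, hnear] with q hreg hq j k
    have := (hexp q.1 q.2 hreg _ hq).2.2.2 j k
    rwa [hth] at this
  · filter_upwards [hK, hs.pen_pos] with q hq hl
    exact (score_of_isMinOn hl.le hq.1).1
  · filter_upwards [hK, hs.pen_pos] with q hq hl j hj
    exact ((score_of_isMinOn hl.le hq.1).2 j hj).1
  · filter_upwards [hK, hs.pen_pos] with q hq hl j hj
    exact ((score_of_isMinOn hl.le hq.1).2 j hj).2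

/-- `u` solves the first-order conditions of the limiting problem with active set `M`. -/
structure IsActiveSolution (D : SurveyGLM p Ω P) (M : Finset (Fin (p + 1))) (w : Fin (p + 1) → ℝ)
    (H : Matrix (Fin (p + 1)) (Fin (p + 1)) ℝ) (c : ℝ) (u : Fin (p + 1) → ℝ) : Prop where
  inactive : ∀ j, j ∉ M → u j = 0
  active : ∀ j : Act M, (w - H *ᵥ u) j.1 = c * D.signM M j

namespace IsLocalLimit

variable {𝒱 : Ultrafilter (ℕ × Ω)} {u v : Fin (p + 1) → ℝ} {M : Finset (Fin (p + 1))}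

lemma tendsto_score_apply (hl : D.IsLocalLimit lam th 𝒱 w H I u) (j : Fin (p + 1)) :
    Tendsto (fun q : ℕ × Ω => √(q.1 : ℝ) * D.score q.1 q.2 (th q.1 q.2) j) 𝒱 (𝓝 ((w - H *ᵥ u) j)) :=
  tendsto_pi_nhds.1 hl.score j

lemma eventually_sign_eq (hl : D.IsLocalLimit lam th 𝒱 w H I u) {j : Fin (p + 1)}
    (hj : D.θ₀ j ≠ 0) :
    ∀ᶠ q in (𝒱 : Filter (ℕ × Ω)), th q.1 q.2 j ≠ 0 ∧
      Real.sign (th q.1 q.2 j) = Real.sign (D.θ₀ j) := by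
  have ht := tendsto_pi_nhds.1 hl.consistent j
  rcases lt_or_gt_of_ne hj with h | h
  · filter_upwards [ht.eventually (gt_mem_nhds h)] with q hq
    exact ⟨hq.ne, by rw [Real.sign_of_neg hq, Real.sign_of_neg h]⟩
  · filter_upwards [ht.eventually (lt_mem_nhds h)] with q hq
    exact ⟨hq.ne', by rw [Real.sign_of_pos hq, Real.sign_of_pos h]⟩

lemma eventually_score_eq (hl : D.IsLocalLimit lam th 𝒱 w H I u)
    (hMin : ∀ j ∈ M, j ≠ 0 → D.θ₀ j ≠ 0) :
    ∀ᶠ q in (𝒱 : Filter (ℕ × Ω)), ∀ j : Act M,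
      D.score q.1 q.2 (th q.1 q.2) j.1 = lam q.1 * D.signM M j := by
  refine eventually_all.2 fun j => ?_
  by_cases h0 : j.1 = 0
  · filter_upwards [hl.score_zero] with q hq
    rw [h0, hq, signM, if_pos h0, mul_zero]
  · filter_upwards [hl.score_eq, hl.eventually_sign_eq (hMin j.1 j.2 h0)] with q hq hsgn
    rw [hq j.1 h0 hsgn.1, hsgn.2, signM, if_neg h0]

lemma active (hl : D.IsLocalLimit lam th 𝒱 w H I u) (hs : D.IsLocalSeq Cu lam th 𝒱 w H I c)
    (hMin : ∀ j ∈ M, j ≠ 0 → D.θ₀ j ≠ 0) (j : Act M) :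
    (w - H *ᵥ u) j.1 = c * D.signM M j := by
  refine tendsto_nhds_unique_of_eventuallyEq (hl.tendsto_score_apply j.1)
    (hs.pen.mul_const (D.signM M j)) ?_
  filter_upwards [hl.eventually_score_eq hMin] with q hq
  rw [hq j, mul_assoc]

lemma tendsto_est_of_zero (hl : D.IsLocalLimit lam th 𝒱 w H I u) {j : Fin (p + 1)}
    (hj : D.θ₀ j = 0) : Tendsto (fun q : ℕ × Ω => √(q.1 : ℝ) * th q.1 q.2 j) 𝒱 (𝓝 (u j)) := by
  have := tendsto_pi_nhds.1 hl.est j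
  simpa [hj] using this

/-- The limit of complementary slackness `θ_j S_j = λ |θ_j|` for a coefficient with true value zero. -/
lemma mul_score_of_zero (hl : D.IsLocalLimit lam th 𝒱 w H I u)
    (hs : D.IsLocalSeq Cu lam th 𝒱 w H I c) {j : Fin (p + 1)} (hj0 : j ≠ 0) (hj : D.θ₀ j = 0) :
    u j * (w - H *ᵥ u) j = c * |u j| := by
  have h1 := (hl.tendsto_est_of_zero hj).mul (hl.tendsto_score_apply j)
  have h2 := hs.pen.mul (hl.tendsto_est_of_zero hj).abs
  refine tendsto_nhds_unique_of_eventuallyEq h1 h2 ?_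
  filter_upwards [hl.score_eq] with q hq
  by_cases h0 : th q.1 q.2 j = 0
  · simp [h0]
  · rw [hq j hj0 h0, abs_mul, abs_of_nonneg (Real.sqrt_nonneg _)]
    have : th q.1 q.2 j * Real.sign (th q.1 q.2 j) = |th q.1 q.2 j| := by
      rcases lt_or_gt_of_ne h0 with h | h
      · rw [Real.sign_of_neg h, abs_of_neg h]; ring
      · rw [Real.sign_of_pos h, abs_of_pos h]; ring
    rw [← this]
    ring

/-- By monotonicity of the limiting first-order conditions their solution is unique. -/
lemma eq_of_isActiveSolution (hl : D.IsLocalLimit lam th 𝒱 w H I u)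
    (hs : D.IsLocalSeq Cu lam th 𝒱 w H I c) (hll : 0 < ll)
    (hH : ∀ x : Fin (p + 1) → ℝ, ll * (x ⬝ᵥ x) ≤ x ⬝ᵥ H *ᵥ x)
    (hM0 : 0 ∈ M) (hMin : ∀ j ∈ M, j ≠ 0 → D.θ₀ j ≠ 0) (hMout : ∀ j, j ∉ M → D.θ₀ j = 0)
    (hv : D.IsActiveSolution M w H c v) (hin : ∀ j, j ∉ M → |(w - H *ᵥ v) j| ≤ c) : u = v := by
  have h1 : 0 ≤ (u - v) ⬝ᵥ ((w - H *ᵥ u) - (w - H *ᵥ v)) := by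
    refine Finset.sum_nonneg fun j _ => ?_
    rw [Pi.sub_apply, Pi.sub_apply _ _ j]
    by_cases hj : j ∈ M
    · rw [hl.active hs hMin ⟨j, hj⟩, hv.active ⟨j, hj⟩, sub_self, mul_zero]
    · have hj0 : j ≠ 0 := fun h => hj (h ▸ hM0)
      rw [hv.inactive j hj, sub_zero, mul_sub, hl.mul_score_of_zero hs hj0 (hMout j hj)]
      have a1 : u j * (w - H *ᵥ v) j ≤ |u j| * |(w - H *ᵥ v) j| := by
        rw [← abs_mul]; exact le_abs_self _
      have a2 := mul_le_mul_of_nonneg_left (hin j hj) (abs_nonneg (u j))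
      linarith
  have h2 : (w - H *ᵥ u) - (w - H *ᵥ v) = -(H *ᵥ (u - v)) := by
    rw [mulVec_sub]; abel
  rw [h2, dotProduct_neg] at h1
  have h3 := hH (u - v)
  have h4 : (u - v) ⬝ᵥ (u - v) = 0 := by
    have h0 : 0 ≤ (u - v) ⬝ᵥ (u - v) := Finset.sum_nonneg fun i _ => mul_self_nonneg _
    nlinarith
  exact sub_eq_zero.1 (dotProduct_self_eq_zero.1 h4)

/-- If `M` is selected along the ultrafilter, the limit has inactive coefficients zero and solves the
active equations, whatever the size of the inactive score. -/
lemma eq_of_selected (hl : D.IsLocalLimit lam th 𝒱 w H I u)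
    (hs : D.IsLocalSeq Cu lam th 𝒱 w H I c) (hll : 0 < ll)
    (hH : ∀ x : Fin (p + 1) → ℝ, ll * (x ⬝ᵥ x) ≤ x ⬝ᵥ H *ᵥ x)
    (hMin : ∀ j ∈ M, j ≠ 0 → D.θ₀ j ≠ 0) (hMout : ∀ j, j ∉ M → D.θ₀ j = 0)
    (hv : D.IsActiveSolution M w H c v)
    (hsel : ∀ᶠ q in (𝒱 : Filter (ℕ × Ω)), selected (th q.1 q.2) = M) : u = v := by
  have hu0 : ∀ j, j ∉ M → u j = 0 := by
    intro j hj
    refine tendsto_nhds_unique_of_eventuallyEq (hl.tendsto_est_of_zero (hMout j hj))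
      tendsto_const_nhds ?_
    filter_upwards [hsel] with q hq
    have : j ∉ selected (th q.1 q.2) := by rwa [hq]
    simp only [selected, Finset.mem_filter, Finset.mem_univ, true_and, not_or, not_not] at this
    rw [this.2, mul_zero]
  have h1 : (u - v) ⬝ᵥ ((w - H *ᵥ u) - (w - H *ᵥ v)) = 0 := by
    refine Finset.sum_eq_zero fun j _ => ?_
    rw [Pi.sub_apply, Pi.sub_apply _ _ j]
    by_cases hj : j ∈ M
    · rw [hl.active hs hMin ⟨j, hj⟩, hv.active ⟨j, hj⟩, sub_self, mul_zero]
    · rw [hv.inactive j hj, hu0 j hj, sub_self, zero_mul]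
  have h2 : (w - H *ᵥ u) - (w - H *ᵥ v) = -(H *ᵥ (u - v)) := by
    rw [mulVec_sub]; abel
  rw [h2, dotProduct_neg] at h1
  have h3 := hH (u - v)
  have h4 : (u - v) ⬝ᵥ (u - v) = 0 := by
    have h0 : 0 ≤ (u - v) ⬝ᵥ (u - v) := Finset.sum_nonneg fun i _ => mul_self_nonneg _
    nlinarith
  exact sub_eq_zero.1 (dotProduct_self_eq_zero.1 h4)

/-- Strict feasibility of the inactive score forces the inactive coefficients to be exactly zero: a
nonzero coefficient would have a score of modulus `λ`. -/
lemma eventually_selected_eq (hl : D.IsLocalLimit lam th 𝒱 w H I u)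
    (hs : D.IsLocalSeq Cu lam th 𝒱 w H I c) (hll : 0 < ll)
    (hH : ∀ x : Fin (p + 1) → ℝ, ll * (x ⬝ᵥ x) ≤ x ⬝ᵥ H *ᵥ x)
    (hM0 : 0 ∈ M) (hMin : ∀ j ∈ M, j ≠ 0 → D.θ₀ j ≠ 0) (hMout : ∀ j, j ∉ M → D.θ₀ j = 0)
    (hv : D.IsActiveSolution M w H c v) (hin : ∀ j, j ∉ M → |(w - H *ᵥ v) j| < c) :
    ∀ᶠ q in (𝒱 : Filter (ℕ × Ω)), selected (th q.1 q.2) = M := by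
  have huv := hl.eq_of_isActiveSolution hs hll hH hM0 hMin hMout hv fun j hj => (hin j hj).le
  subst huv
  have hj : ∀ j, ∀ᶠ q in (𝒱 : Filter (ℕ × Ω)), j ∈ selected (th q.1 q.2) ↔ j ∈ M := by
    intro j
    simp only [selected, Finset.mem_filter, Finset.mem_univ, true_and]
    by_cases h0 : j = 0
    · exact Eventually.of_forall fun q => by simp [h0, hM0]
    by_cases hjM : j ∈ M
    · filter_upwards [hl.eventually_sign_eq (hMin j hjM h0)] with q hq
      simp [hjM, hq.1]
    · filter_upwards [hl.score_eq, hs.pen_pos,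
        ((hl.tendsto_score_apply j).abs.eventually_lt hs.pen (hin j hjM))] with q h1 h2 h3
      simp only [h0, false_or, hjM, iff_false, not_not]
      by_contra hne
      rw [h1 j h0 hne, abs_mul, abs_mul, abs_of_pos h2, abs_of_nonneg (Real.sqrt_nonneg _)] at h3
      have : |Real.sign (th q.1 q.2 j)| = 1 := by
        rcases lt_or_gt_of_ne hne with h | h
        · rw [Real.sign_of_neg h]; simp
        · rw [Real.sign_of_pos h]; simp
      rw [this, mul_one] at h3
      exact lt_irrefl _ h3
  filter_upwards [eventually_all.2 hj] with q hq
  exact Finset.ext hq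

end IsLocalLimit

end SurveyGLM

/-! ### Limits of truncation limits -/

section Cuts

variable {α : Type*} {F : Filter α}

lemma tendsto_cut_top {z s d : α → ℝ} {z₀ : ℝ} (hz : Tendsto z F (𝓝 z₀))
    (h : ∀ X : ℝ, ∀ᶠ q in F, X * d q < s q) :
    Tendsto (fun q => if 0 < d q then ((z q + s q / d q : ℝ) : EReal) else ⊤) F (𝓝 ⊤) := by
  rw [EReal.tendsto_nhds_top_iff_real]
  intro x
  filter_upwards [h (x - z₀ + 1), hz.eventually (lt_mem_nhds (sub_one_lt z₀))] with q h1 h2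
  split_ifs with hd
  · rw [← lt_div_iff₀ hd] at h1
    exact_mod_cast (by linarith : x < z q + s q / d q)
  · exact EReal.coe_lt_top x

/-- Limit of an upper truncation point with positive limiting slack `L`. An infinite slack, and a
slope that vanishes in the limit, both remove the constraint. -/
lemma tendsto_upper_cut {z s d : α → ℝ} {z₀ d₀ e₀ : ℝ} {L : EReal} (hz : Tendsto z F (𝓝 z₀))
    (hs : Tendsto (fun q => (s q : EReal)) F (𝓝 L)) (hd : Tendsto d F (𝓝 d₀)) (hL : 0 < L)
    (hde : L = ⊤ ∨ d₀ = e₀) :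
    Tendsto (fun q => if 0 < d q then ((z q + s q / d q : ℝ) : EReal) else ⊤) F
      (𝓝 (if 0 < e₀ then (z₀ : EReal) + L / (e₀ : EReal) else ⊤)) := by
  induction L with
  | bot => simp at hL
  | top =>
    have htop : (if 0 < e₀ then (z₀ : EReal) + ⊤ / (e₀ : EReal) else ⊤) = ⊤ := by
      split_ifs with h
      · rw [EReal.top_div_of_pos_ne_top (by exact_mod_cast h) (EReal.coe_ne_top _),
          EReal.coe_add_top]
      · rfl
    rw [htop]
    refine tendsto_cut_top hz fun X => ?_
    have h1 := (hd.const_mul X).eventually (gt_mem_nhds (lt_add_one (X * d₀)))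
    filter_upwards [h1, EReal.tendsto_nhds_top_iff_real.1 hs (X * d₀ + 1)] with q h1 h2
    exact h1.trans (by exact_mod_cast h2)
  | coe l =>
    have hl : 0 < l := by exact_mod_cast hL
    have hs' : Tendsto s F (𝓝 l) := EReal.tendsto_coe.1 hs
    obtain rfl : d₀ = e₀ := hde.resolve_left (EReal.coe_ne_top l)
    rcases lt_trichotomy 0 d₀ with h | h | h
    · rw [if_pos h, ← EReal.coe_div, ← EReal.coe_add]
      refine ((continuous_coe_real_ereal.tendsto _).comp (hz.add (hs'.div hd h.ne'))).congr' ?_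
      filter_upwards [hd.eventually (lt_mem_nhds h)] with q hq
      rw [if_pos hq]; rfl
    · rw [if_neg h.not_lt]
      refine tendsto_cut_top hz fun X => ?_
      refine (hd.const_mul X).eventually_lt hs' ?_
      rw [← h, mul_zero]
      exact hl
    · rw [if_neg h.not_gt]
      refine tendsto_const_nhds.congr' ?_
      filter_upwards [hd.eventually (gt_mem_nhds h)] with q hq
      rw [if_neg hq.not_gt]

/-- The mirror image of `tendsto_upper_cut`. -/
lemma tendsto_lower_cut {z s d : α → ℝ} {z₀ d₀ e₀ : ℝ} {L : EReal} (hz : Tendsto z F (𝓝 z₀))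
    (hs : Tendsto (fun q => (s q : EReal)) F (𝓝 L)) (hd : Tendsto d F (𝓝 d₀)) (hL : 0 < L)
    (hde : L = ⊤ ∨ d₀ = e₀) :
    Tendsto (fun q => if d q < 0 then ((z q + s q / d q : ℝ) : EReal) else ⊥) F
      (𝓝 (if e₀ < 0 then (z₀ : EReal) + L / (e₀ : EReal) else ⊥)) := by
  have h := (continuous_neg (G := EReal) |>.tendsto _).comp (tendsto_upper_cut hz.neg hs hd.neg hL
    (e₀ := -e₀) (hde.imp_right fun h => by rw [h]))
  have e : -(if 0 < -e₀ then ((-z₀ : ℝ) : EReal) + L / ((-e₀ : ℝ) : EReal) else ⊤) =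
      if e₀ < 0 then (z₀ : EReal) + L / (e₀ : EReal) else ⊥ := by
    by_cases h0 : e₀ < 0
    · rw [if_pos h0, if_pos (by linarith)]
      induction L with
      | bot => simp at hL
      | top =>
        rw [EReal.top_div_of_pos_ne_top (by exact_mod_cast (neg_pos.2 h0)) (EReal.coe_ne_top _),
          EReal.top_div_of_neg_ne_bot (by exact_mod_cast h0) (EReal.coe_ne_bot _),
          EReal.coe_add_top, EReal.neg_top, EReal.add_bot]
      | coe l =>
        rw [← EReal.coe_div, ← EReal.coe_div, ← EReal.coe_add, ← EReal.coe_add, ← EReal.coe_neg]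
        congr 1
        rw [div_neg]; ring
    · rw [if_neg h0, if_neg (by linarith), EReal.neg_top]
  rw [e] at h
  refine h.congr fun q => ?_
  simp only [Function.comp_apply, Left.neg_pos_iff]
  split_ifs with h0
  · rw [← EReal.coe_neg]
    congr 1
    rw [div_neg]; ring
  · exact EReal.neg_top

lemma tendsto_iInf_fintype {J : Type*} [Fintype J] {f : J → α → EReal} {g : J → EReal}
    (h : ∀ j, Tendsto (f j) F (𝓝 (g j))) : Tendsto (fun q => ⨅ j, f j q) F (𝓝 (⨅ j, g j)) := by
  simp only [← Finset.inf_univ_eq_iInf]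
  exact Filter.Tendsto.finset_inf_nhds_apply fun j _ => h j

lemma tendsto_iSup_fintype {J : Type*} [Fintype J] {f : J → α → EReal} {g : J → EReal}
    (h : ∀ j, Tendsto (f j) F (𝓝 (g j))) : Tendsto (fun q => ⨆ j, f j q) F (𝓝 (⨆ j, g j)) := by
  simp only [← Finset.sup_univ_eq_iSup]
  exact Filter.Tendsto.finset_sup_nhds_apply fun j _ => h j

/-- Limit of the truncated normal distribution function when the standardized slacks and slopes of
the constraints converge to those of the limiting region. -/
lemma tendsto_truncStd_rowPivot {ι J : Type*} [Fintype ι] [DecidableEq ι] [Fintype J]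
    {S : Matrix ι ι ℝ} {h : ι → ℝ} {a : J → EReal} {β : J → ι → ℝ} (ha : ∀ j, a j ≠ ⊥)
    {w : ι → ℝ} (hw : w ∈ rowRegion a β) {z : α → ℝ} {s d : J → α → ℝ} {d₀ : J → ℝ}
    (hz : Tendsto z F (𝓝 (h ⬝ᵥ w)))
    (hs : ∀ j, Tendsto (fun q => (s j q : EReal)) F (𝓝 (rowSlack a β j w)))
    (hd : ∀ j, Tendsto (d j) F (𝓝 (d₀ j)))
    (hde : ∀ j, rowSlack a β j w = ⊤ ∨ d₀ j = rowSlope S h β j) :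
    Tendsto (fun q => truncStd (z q)
      (⨆ j, if d j q < 0 then ((z q + s j q / d j q : ℝ) : EReal) else ⊥)
      (⨅ j, if 0 < d j q then ((z q + s j q / d j q : ℝ) : EReal) else ⊤)) F
        (𝓝 (rowPivot S h a β w)) ∧
    ∀ᶠ q in F, (⨆ j, if d j q < 0 then ((z q + s j q / d j q : ℝ) : EReal) else ⊥) < (z q : EReal) ∧
      (z q : EReal) < ⨅ j, if 0 < d j q then ((z q + s j q / d j q : ℝ) : EReal) else ⊤ := by
  have hup := tendsto_iInf_fintype fun j => tendsto_upper_cut hz (hs j) (hd j) (hw j) (hde j)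
  have hlo := tendsto_iSup_fintype fun j => tendsto_lower_cut hz (hs j) (hd j) (hw j) (hde j)
  have hz' : Tendsto (fun q => (z q : EReal)) F (𝓝 ((h ⬝ᵥ w : ℝ) : EReal)) :=
    (continuous_coe_real_ereal.tendsto _).comp hz
  have hup' : (⨅ j, if 0 < rowSlope S h β j then ((h ⬝ᵥ w : ℝ) : EReal) +
      rowSlack a β j w / (rowSlope S h β j : EReal) else ⊤) = rowUpper S h a β w := rfl
  have hlo' : (⨆ j, if rowSlope S h β j < 0 then ((h ⬝ᵥ w : ℝ) : EReal) +
      rowSlack a β j w / (rowSlope S h β j : EReal) else ⊥) = rowLower S h a β w := rfl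
  rw [hup'] at hup
  rw [hlo'] at hlo
  obtain ⟨-, hlt1, hlt2⟩ := (mem_rowRegion_iff (S := S) (h := h) ha w).1 hw
  refine ⟨?_, (hlo.eventually_lt hz' hlt1).and (hz'.eventually_lt hup hlt2)⟩
  have hne : stdNormalCDF (rowUpper S h a β w) - stdNormalCDF (rowLower S h a β w) ≠ 0 :=
    (sub_pos.2 (stdNormalCDF_strictMono (hlt1.trans hlt2))).ne'
  have hc := continuous_stdNormalCDF
  exact (((hc.tendsto _).comp hz').sub ((hc.tendsto _).comp hlo)).div
    (((hc.tendsto _).comp hup).sub ((hc.tendsto _).comp hlo)) hne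

end Cuts

/-! ### The pivot in terms of slacks and slopes -/

section Poly

variable {κ J : Type*} [Fintype κ] [DecidableEq κ] [Fintype J]

lemma mulVec_polyR (A : Matrix J κ ℝ) (Z : κ → ℝ) (S : Matrix κ κ ℝ) (e : κ → ℝ) (j : J) :
    (A *ᵥ polyR Z S e) j = (A *ᵥ Z) j - (e ⬝ᵥ Z) * (A *ᵥ polyC S e) j := by
  rw [polyR, sub_mulVec, one_mulVec, vecMulVec_mulVec, mulVec_sub, Pi.sub_apply]
  simp [mulVec_smul]

lemma standardize_iInf {m v : ℝ} (hv : 0 < v) (f : J → EReal) :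
    ((⨅ j, f j) - (m : EReal)) / (v : EReal) = ⨅ j, (f j - (m : EReal)) / (v : EReal) := by
  simp only [← Finset.inf_univ_eq_iInf]
  refine Finset.apply_inf_eq_inf_comp_of_linearOrder (fun x : EReal => (x - (m : EReal)) / (v : EReal))
    (ereal_standardize_strictMono m hv).monotone ?_
  rw [EReal.top_sub_coe, EReal.top_div_of_pos_ne_top (by exact_mod_cast hv) (EReal.coe_ne_top _)]

lemma standardize_iSup {m v : ℝ} (hv : 0 < v) (f : J → EReal) :
    ((⨆ j, f j) - (m : EReal)) / (v : EReal) = ⨆ j, (f j - (m : EReal)) / (v : EReal) := by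
  simp only [← Finset.sup_univ_eq_iSup]
  refine Finset.apply_sup_eq_sup_comp_of_linearOrder (fun x : EReal => (x - (m : EReal)) / (v : EReal))
    (ereal_standardize_strictMono m hv).monotone ?_
  rw [EReal.bot_sub, EReal.bot_div_of_pos_ne_top (by exact_mod_cast hv) (EReal.coe_ne_top _)]

/-- The standardized upper truncation limit. The rows of the constraint may be rescaled by positive
factors `k j`. -/
lemma standardize_vPlus (A : Matrix J κ ℝ) (b : J → ℝ) (Z : κ → ℝ) (S : Matrix κ κ ℝ) (e : κ → ℝ)
    {m v : ℝ} (hv : 0 < v) {k : J → ℝ} (hk : ∀ j, 0 < k j) :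
    (vPlus A b (polyC S e) (polyR Z S e) - (m : EReal)) / (v : EReal) =
      ⨅ j, if 0 < k j * (v * (A *ᵥ polyC S e) j) then
        (((e ⬝ᵥ Z - m) / v + k j * (b j - (A *ᵥ Z) j) / (k j * (v * (A *ᵥ polyC S e) j)) : ℝ) :
          EReal) else ⊤ := by
  have h1 : vPlus A b (polyC S e) (polyR Z S e) = ⨅ j, if 0 < (A *ᵥ polyC S e) j then
      (((b j - (A *ᵥ polyR Z S e) j) / (A *ᵥ polyC S e) j : ℝ) : EReal) else ⊤ := by
    rw [vPlus, iInf_subtype]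
    exact iInf_congr fun j => by by_cases h : 0 < (A *ᵥ polyC S e) j <;> simp [h]
  rw [h1, standardize_iInf hv]
  refine iInf_congr fun j => ?_
  have hkv : 0 < k j * v := mul_pos (hk j) hv
  have hiff : 0 < k j * (v * (A *ᵥ polyC S e) j) ↔ 0 < (A *ᵥ polyC S e) j := by
    rw [← mul_assoc]; exact mul_pos_iff_of_pos_left hkv
  simp only [hiff]
  split_ifs with h
  · rw [← EReal.coe_sub, ← EReal.coe_div, mulVec_polyR]
    congr 1
    have := (hk j).ne'
    field_simp
    ring
  · rw [EReal.top_sub_coe, EReal.top_div_of_pos_ne_top (by exact_mod_cast hv) (EReal.coe_ne_top _)]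

lemma standardize_vMinus (A : Matrix J κ ℝ) (b : J → ℝ) (Z : κ → ℝ) (S : Matrix κ κ ℝ) (e : κ → ℝ)
    {m v : ℝ} (hv : 0 < v) {k : J → ℝ} (hk : ∀ j, 0 < k j) :
    (vMinus A b (polyC S e) (polyR Z S e) - (m : EReal)) / (v : EReal) =
      ⨆ j, if k j * (v * (A *ᵥ polyC S e) j) < 0 then
        (((e ⬝ᵥ Z - m) / v + k j * (b j - (A *ᵥ Z) j) / (k j * (v * (A *ᵥ polyC S e) j)) : ℝ) :
          EReal) else ⊥ := by
  have h1 : vMinus A b (polyC S e) (polyR Z S e) = ⨆ j, if (A *ᵥ polyC S e) j < 0 then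
      (((b j - (A *ᵥ polyR Z S e) j) / (A *ᵥ polyC S e) j : ℝ) : EReal) else ⊥ := by
    rw [vMinus, iSup_subtype]
    exact iSup_congr fun j => by by_cases h : (A *ᵥ polyC S e) j < 0 <;> simp [h]
  rw [h1, standardize_iSup hv]
  refine iSup_congr fun j => ?_
  have hkv : 0 < k j * v := mul_pos (hk j) hv
  have hiff : k j * (v * (A *ᵥ polyC S e) j) < 0 ↔ (A *ᵥ polyC S e) j < 0 := by
    rw [← mul_assoc]; exact ⟨fun h => neg_of_mul_neg_right h hkv.le, fun h => mul_neg_of_pos_of_neg hkv h⟩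
  simp only [hiff]
  split_ifs with h
  · rw [← EReal.coe_sub, ← EReal.coe_div, mulVec_polyR]
    congr 1
    have := (hk j).ne'
    have := h.ne
    field_simp
    ring
  · rw [EReal.bot_sub, EReal.bot_div_of_pos_ne_top (by exact_mod_cast hv) (EReal.coe_ne_top _)]

end Poly

/-! ### Blocks of the limiting matrices -/

section Blocks

variable {p : ℕ} (M : Finset (Fin (p + 1)))

lemma pad_dotProduct (x : Act M → ℝ) (w : Fin (p + 1) → ℝ) : pad M x ⬝ᵥ w = x ⬝ᵥ restr M w := by
  have h1 : x ⬝ᵥ restr M w = ∑ k : Act M, pad M x k.1 * w k.1 :=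
    Finset.sum_congr rfl fun k _ => by simp [pad, restr, k.2]
  rw [h1, Finset.sum_coe_sort M fun k => pad M x k * w k, dotProduct]
  refine (Finset.sum_subset (Finset.subset_univ M) fun k _ hk => ?_).symm
  simp [pad, hk]

lemma restr_pad (x : Act M → ℝ) : restr M (pad M x) = x := by
  ext k; simp [restr, pad, k.2]

lemma pad_restr {θ : Fin (p + 1) → ℝ} (h : ∀ j, j ∉ M → θ j = 0) : pad M (restr M θ) = θ := by
  ext k
  by_cases hk : k ∈ M
  · simp [pad, restr, hk]
  · simp [pad, hk, h k hk]

variable (A B : Matrix (Fin (p + 1)) (Fin (p + 1)) ℝ)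

/-- The block `A_M`. -/
def blockMM : Matrix (Act M) (Act M) ℝ := A.submatrix Subtype.val Subtype.val

/-- The block `A_{M(-M)}`. -/
def blockMN : Matrix (Act M) (Inact M) ℝ := A.submatrix Subtype.val Subtype.val

/-- The block `A_{-MM}`. -/
def blockNM : Matrix (Inact M) (Act M) ℝ := A.submatrix Subtype.val Subtype.val

/-- `A_{-MM} A_M⁻¹` for a Hessian `A`. -/
noncomputable def projOf : Matrix (Inact M) (Act M) ℝ := blockNM M A * (blockMM M A)⁻¹

/-- The sandwich covariance `A_M⁻¹ B_M A_M⁻¹` for a Hessian `A` and an information matrix `B`. -/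
noncomputable def sandwichOf : Matrix (Act M) (Act M) ℝ :=
  (blockMM M A)⁻¹ * blockMM M B * (blockMM M A)⁻¹

/-- The covariance between the one-step estimator and the inactive part of the adjusted score, for a
Hessian `A` and an information matrix `B`. -/
noncomputable def crossOf : Matrix (Act M) (Inact M) ℝ :=
  (blockMM M A)⁻¹ * blockMN M B - sandwichOf M A B * blockMN M A

lemma mulVec_pad_active (x : Act M → ℝ) : restr M (A *ᵥ pad M x) = blockMM M A *ᵥ x := by
  ext k
  rw [restr, mulVec, dotProduct_comm, pad_dotProduct, dotProduct_comm]
  rfl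

lemma mulVec_pad_inactive (x : Act M → ℝ) (j : Inact M) :
    (A *ᵥ pad M x) j.1 = (blockNM M A *ᵥ x) j := by
  rw [mulVec, dotProduct_comm, pad_dotProduct, dotProduct_comm]
  rfl

variable {A B}

lemma blockMM_posDef (hA : A.PosDef) : (blockMM M A).PosDef :=
  hA.submatrix Subtype.val_injective

lemma transpose_of_isHermitian {ι : Type*} {X : Matrix ι ι ℝ} (hX : X.IsHermitian) : Xᵀ = X := by
  rw [← conjTranspose_eq_transpose_of_trivial]; exact hX

lemma transpose_blockMN (hA : A.IsHermitian) : (blockMN M A)ᵀ = blockNM M A := by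
  rw [blockMN, transpose_submatrix, transpose_of_isHermitian hA]; rfl

lemma transpose_blockMM (hA : A.IsHermitian) : (blockMM M A)ᵀ = blockMM M A := by
  rw [blockMM, transpose_submatrix, transpose_of_isHermitian hA]

lemma transpose_inv_blockMM (hA : A.IsHermitian) : ((blockMM M A)⁻¹)ᵀ = (blockMM M A)⁻¹ := by
  rw [transpose_nonsing_inv, transpose_blockMM M hA]

lemma sandwichOf_posDef (hA : A.PosDef) (hB : B.PosDef) : (sandwichOf M A B).PosDef := by
  have h := blockMM_posDef M hA
  have h1 := (blockMM_posDef M hB).mul_mul_conjTranspose_same (B := (blockMM M A)⁻¹) ?_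
  · rwa [conjTranspose_eq_transpose_of_trivial, transpose_inv_blockMM M hA.isHermitian] at h1
  · exact vecMul_injective_of_isUnit ((isUnit_nonsing_inv_iff).2 h.isUnit)

lemma transpose_crossOf (hA : A.IsHermitian) (hB : B.IsHermitian) :
    (crossOf M A B)ᵀ = blockNM M B * (blockMM M A)⁻¹ -
      projOf M A * (blockMM M B * (blockMM M A)⁻¹) := by
  rw [crossOf, sandwichOf, projOf]
  simp only [transpose_sub, transpose_mul, transpose_blockMN M hA, transpose_blockMN M hB,
    transpose_blockMM M hB, transpose_inv_blockMM M hA, Matrix.mul_assoc]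

end Blocks

/-! ### The limiting selection region -/

section LimitRows

variable {p : ℕ} (M : Finset (Fin (p + 1))) (H : Matrix (Fin (p + 1)) (Fin (p + 1)) ℝ)
  (sg g : Act M → ℝ) (c s : ℝ) (τ : EReal)

/-- The limit of `√n (θ̂_M - θ_{M0})` on the event that `M` is selected, with signs `sg` of the
slopes. -/
noncomputable def limEst (w : Fin (p + 1) → ℝ) : Act M → ℝ :=
  (blockMM M H)⁻¹ *ᵥ (restr M w - c • sg)

/-- The direction `h` for which `h'w` is the limit of the standardized one-step estimator of
`ρ`. -/
noncomputable def limDir : Fin (p + 1) → ℝ := pad M ((blockMM M H)⁻¹ *ᵥ g)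

/-- The linear functional that gives the inactive component `j` of the adjusted score. -/
noncomputable def limResid (j : Inact M) : Fin (p + 1) → ℝ :=
  Pi.single j.1 1 - pad M (projOf M H j)

/-- Constants of the limiting constraints. The sign constraint on `ρ` has the constant `τ`, infinite
if `ρ` does not vanish at rate `n^{-1/2}`; the sign constraints on the slopes, which are bounded
away from zero, are void in the limit. -/
noncomputable def limConst : Unit ⊕ (Slope M ⊕ (Inact M ⊕ Inact M)) → EReal :=
  Sum.elim (fun _ => τ + ((-(s * (c * (g ⬝ᵥ (blockMM M H)⁻¹ *ᵥ sg))) : ℝ) : EReal))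
    (Sum.elim (fun _ => ⊤)
      (Sum.elim (fun j => ((c * (1 - (projOf M H *ᵥ sg) j) : ℝ) : EReal))
        (fun j => ((c * (1 + (projOf M H *ᵥ sg) j) : ℝ) : EReal))))

/-- Normal vectors of the limiting constraints. -/
noncomputable def limNormal : Unit ⊕ (Slope M ⊕ (Inact M ⊕ Inact M)) → Fin (p + 1) → ℝ :=
  Sum.elim (fun _ => s • limDir M H g)
    (Sum.elim (fun _ => 0) (Sum.elim (fun j => -limResid M H j) (fun j => limResid M H j)))

variable {M H sg g c s τ}

lemma limConst_ne_bot (hτ : 0 ≤ τ) (j) : limConst M H sg g c s τ j ≠ ⊥ := by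
  have hτ' : τ ≠ ⊥ := fun h => by rw [h] at hτ; simp at hτ
  rcases j with _ | _ | _ | _
  · simp only [limConst, Sum.elim_inl]
    exact fun h => (EReal.add_eq_bot_iff.1 h).elim hτ' (EReal.coe_ne_bot _)
  · simp [limConst]
  · exact EReal.coe_ne_bot _
  · exact EReal.coe_ne_bot _

lemma limResid_dotProduct (j : Inact M) (v : Fin (p + 1) → ℝ) :
    limResid M H j ⬝ᵥ v = v j.1 - (projOf M H *ᵥ restr M v) j := by
  rw [limResid, sub_dotProduct, single_dotProduct, one_mul, pad_dotProduct]
  rfl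

lemma limResid_ne_zero (j : Inact M) : limResid M H j ≠ 0 := by
  intro h
  have := congrFun h j.1
  simp [limResid, pad, j.2] at this

lemma mulVec_limEst (hH : H.PosDef) (w : Fin (p + 1) → ℝ) :
    blockMM M H *ᵥ limEst M H sg c w = restr M w - c • sg := by
  rw [limEst, mulVec_mulVec, mul_nonsing_inv _
    ((isUnit_iff_isUnit_det _).1 (blockMM_posDef M hH).isUnit), one_mulVec]

lemma limDir_dotProduct (hH : H.PosDef) (w : Fin (p + 1) → ℝ) :
    limDir M H g ⬝ᵥ w =
      g ⬝ᵥ limEst M H sg c w + c * (g ⬝ᵥ (blockMM M H)⁻¹ *ᵥ sg) := by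
  rw [limDir, pad_dotProduct, limEst, mulVec_sub, mulVec_smul, dotProduct_sub, dotProduct_smul,
    smul_eq_mul, sub_add_cancel, dotProduct_mulVec g, ← mulVec_transpose,
    transpose_inv_blockMM M hH.isHermitian]

lemma rowSlack_rho (hH : H.PosDef) (w : Fin (p + 1) → ℝ) :
    rowSlack (limConst M H sg g c s τ) (limNormal M H g s) (Sum.inl ()) w =
      τ + ((s * (g ⬝ᵥ limEst M H sg c w) : ℝ) : EReal) := by
  simp only [rowSlack, limConst, limNormal, Sum.elim_inl]
  rw [add_assoc, ← EReal.coe_add, smul_dotProduct, limDir_dotProduct (sg := sg) (c := c) hH]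
  congr 2
  simp only [smul_eq_mul]
  ring

lemma score_limEst (w : Fin (p + 1) → ℝ) (j : Inact M) :
    (w - H *ᵥ pad M (limEst M H sg c w)) j.1 =
      limResid M H j ⬝ᵥ w + c * (projOf M H *ᵥ sg) j := by
  have h1 : (blockNM M H *ᵥ limEst M H sg c w) j = (projOf M H *ᵥ (restr M w - c • sg)) j := by
    rw [limEst, mulVec_mulVec]; rfl
  rw [Pi.sub_apply, mulVec_pad_inactive, h1, limResid_dotProduct, mulVec_sub, mulVec_smul]
  simp only [Pi.sub_apply, Pi.smul_apply, smul_eq_mul]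
  ring

lemma rowSlack_upper (w : Fin (p + 1) → ℝ) (j : Inact M) :
    rowSlack (limConst M H sg g c s τ) (limNormal M H g s) (Sum.inr (Sum.inr (Sum.inl j))) w =
      ((c - (w - H *ᵥ pad M (limEst M H sg c w)) j.1 : ℝ) : EReal) := by
  simp only [rowSlack, limConst, limNormal, Sum.elim_inl, Sum.elim_inr]
  rw [← EReal.coe_add, score_limEst, neg_dotProduct]
  congr 1
  ring

lemma rowSlack_lower (w : Fin (p + 1) → ℝ) (j : Inact M) :
    rowSlack (limConst M H sg g c s τ) (limNormal M H g s) (Sum.inr (Sum.inr (Sum.inr j))) w =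
      ((c + (w - H *ᵥ pad M (limEst M H sg c w)) j.1 : ℝ) : EReal) := by
  simp only [rowSlack, limConst, limNormal, Sum.elim_inr]
  rw [← EReal.coe_add, score_limEst]
  congr 1
  ring

lemma rowSlack_slope (w : Fin (p + 1) → ℝ) (j : Slope M) :
    rowSlack (limConst M H sg g c s τ) (limNormal M H g s) (Sum.inr (Sum.inl j)) w = ⊤ := by
  simp [rowSlack, limConst, limNormal]

variable {I : Matrix (Fin (p + 1)) (Fin (p + 1)) ℝ}

lemma limDir_variance (hH : H.PosDef) :
    limDir M H g ⬝ᵥ I *ᵥ limDir M H g = g ⬝ᵥ sandwichOf M H I *ᵥ g := by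
  rw [limDir, pad_dotProduct, mulVec_pad_active, sandwichOf, ← mulVec_mulVec, ← mulVec_mulVec,
    dotProduct_mulVec g, ← mulVec_transpose, transpose_inv_blockMM M hH.isHermitian]

lemma limResid_covariance (hH : H.PosDef) (hI : I.PosDef) (j : Inact M) :
    limResid M H j ⬝ᵥ I *ᵥ limDir M H g = (g ᵥ* crossOf M H I) j := by
  rw [limResid_dotProduct, limDir, mulVec_pad_active, mulVec_pad_inactive, ← mulVec_transpose,
    transpose_crossOf M hH.isHermitian hI.isHermitian, sub_mulVec, ← mulVec_mulVec,
    ← mulVec_mulVec, ← mulVec_mulVec]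
  rfl

/-- The selection region is nonempty: it contains the score for which `√n (θ̂_M - θ_{M0})` tends to
`s g` and the inactive score vanishes. -/
lemma rowRegion_nonempty (hH : H.PosDef) (hg : g ≠ 0) (hs : s * s = 1) (hτ : 0 ≤ τ)
    (hc : ∀ _ : Inact M, 0 < c) :
    (rowRegion (limConst M H sg g c s τ) (limNormal M H g s)).Nonempty := by
  set w : Fin (p + 1) → ℝ := H *ᵥ pad M (s • g) + pad M (c • sg) with hw
  have hest : limEst M H sg c w = s • g := by
    have h1 : restr M w = blockMM M H *ᵥ (s • g) + c • sg := by
      have e : restr M w = restr M (H *ᵥ pad M (s • g)) + restr M (pad M (c • sg)) := rfl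
      rw [e, mulVec_pad_active, restr_pad]
    rw [limEst, h1, add_sub_cancel_right, mulVec_mulVec, nonsing_inv_mul _
      ((isUnit_iff_isUnit_det _).1 (blockMM_posDef M hH).isUnit), one_mulVec]
  have hres : ∀ j : Inact M, (w - H *ᵥ pad M (limEst M H sg c w)) j.1 = 0 := by
    intro j
    rw [hest, hw, add_sub_cancel_left]
    simp [pad, j.2]
  refine ⟨w, fun j => ?_⟩
  rcases j with _ | j | j | j
  · rw [rowSlack_rho hH, hest, dotProduct_smul, smul_eq_mul, ← mul_assoc, hs, one_mul]
    have hpos : 0 < g ⬝ᵥ g := by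
      have h0 : 0 ≤ g ⬝ᵥ g := Finset.sum_nonneg fun i _ => mul_self_nonneg _
      exact lt_of_le_of_ne h0 fun h => hg (dotProduct_self_eq_zero.1 h.symm)
    calc (0 : EReal) < ((g ⬝ᵥ g : ℝ) : EReal) := by exact_mod_cast hpos
      _ = 0 + ((g ⬝ᵥ g : ℝ) : EReal) := (zero_add _).symm
      _ ≤ τ + ((g ⬝ᵥ g : ℝ) : EReal) := by gcongr
  · rw [rowSlack_slope]; exact EReal.zero_lt_top
  · rw [rowSlack_upper, hres, sub_zero]
    exact_mod_cast hc j
  · rw [rowSlack_lower, hres, add_zero]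
    exact_mod_cast hc j

lemma ae_rowSlack_ne_zero (hH : H.PosDef) (hI : I.PosDef)
    (hg : g ⬝ᵥ sandwichOf M H I *ᵥ g = 1) (hs : s * s = 1) :
    ∀ᵐ w ∂(gaussianPi I), ∀ j,
      rowSlack (limConst M H sg g c s τ) (limNormal M H g s) j w ≠ 0 := by
  refine ae_all_iff.2 fun j => ?_
  rw [ae_iff]
  simp only [ne_eq, not_not]
  refine gaussianPi_rowSlack_eq_zero hI ?_
  rcases j with _ | j | j | j
  · refine Or.inl fun h0 => ?_
    have h1 : s • limDir M H g = 0 := h0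
    have hs0 : s ≠ 0 := fun h => by rw [h] at hs; simp at hs
    have h2 := (smul_eq_zero.1 h1).resolve_left hs0
    rw [← limDir_variance hH, h2, zero_dotProduct] at hg
    exact zero_ne_one hg
  · exact Or.inr rfl
  · exact Or.inl fun h0 => limResid_ne_zero j (neg_eq_zero.1 h0)
  · exact Or.inl fun h0 => limResid_ne_zero j h0

end LimitRows

/-! ### Linearization of the parameter function -/

section Rho

variable {ι α : Type*} [Fintype ι] [DecidableEq ι] {F : Filter α}

lemma fderiv_apply_eq_grad (ρ : (ι → ℝ) → ℝ) (θ v : ι → ℝ) :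
    fderiv ℝ ρ θ v = grad ρ θ ⬝ᵥ v := by
  conv_lhs => rw [← Finset.univ_sum_single v]
  rw [map_sum]
  refine Finset.sum_congr rfl fun j _ => ?_
  have : (Pi.single j (v j) : ι → ℝ) = v j • Pi.single j 1 := by
    rw [← Pi.single_smul, smul_eq_mul, mul_one]
  rw [this, map_smul, smul_eq_mul, grad, mul_comm]

lemma abs_dotProduct_le (x y : ι → ℝ) : |x ⬝ᵥ y| ≤ Fintype.card ι * (‖x‖ * ‖y‖) := by
  refine (Finset.abs_sum_le_sum_abs _ _).trans ?_
  calc ∑ j, |x j * y j| ≤ ∑ _j : ι, ‖x‖ * ‖y‖ := Finset.sum_le_sum fun j _ => by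
        rw [abs_mul]
        exact mul_le_mul (norm_le_pi_norm x j) (norm_le_pi_norm y j) (abs_nonneg _) (norm_nonneg _)
    _ = _ := by simp

variable {ρ : ℕ → (ι → ℝ) → ℝ} {U : Set (ι → ℝ)} {θ : ι → ℝ}

/-- Linear approximation, uniform in `n`, of functions with equicontinuous gradients. -/
lemma exists_linear_approx (hU : IsOpen U) (hθ : θ ∈ U) (hρ : ∀ n, ContDiffOn ℝ 1 (ρ n) U)
    (hequi : EquicontinuousAt (fun n => grad (ρ n)) θ) {ε : ℝ} (hε : 0 < ε) :
    ∃ δ > 0, ∀ n t, ‖t - θ‖ < δ → ‖grad (ρ n) t - grad (ρ n) θ‖ ≤ ε ∧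
      |ρ n t - ρ n θ - grad (ρ n) θ ⬝ᵥ (t - θ)| ≤ Fintype.card ι * ε * ‖t - θ‖ := by
  obtain ⟨δ₁, hδ₁, hball⟩ := Metric.isOpen_iff.1 hU θ hθ
  obtain ⟨δ₂, hδ₂, hgrad⟩ := Metric.equicontinuousAt_iff.1 hequi ε hε
  have hg : ∀ n t, ‖t - θ‖ < min δ₁ δ₂ → ‖grad (ρ n) t - grad (ρ n) θ‖ ≤ ε := by
    intro n t ht
    have := hgrad t (by rw [dist_eq_norm]; exact ht.trans_le (min_le_right _ _)) n
    rw [dist_comm, dist_eq_norm] at this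
    exact this.le
  refine ⟨min δ₁ δ₂, lt_min hδ₁ hδ₂, fun n t ht => ⟨hg n t ht, ?_⟩⟩
  have hdiff : ∀ x ∈ Metric.ball θ (min δ₁ δ₂), DifferentiableAt ℝ (ρ n) x := fun x hx =>
    ((hρ n).differentiableOn one_ne_zero).differentiableAt
      (hU.mem_nhds (hball (Metric.ball_subset_ball (min_le_left _ _) hx)))
  have hbound : ∀ x ∈ Metric.ball θ (min δ₁ δ₂),
      ‖fderiv ℝ (ρ n) x - fderiv ℝ (ρ n) θ‖ ≤ Fintype.card ι * ε := by
    intro x hx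
    refine ContinuousLinearMap.opNorm_le_bound _ (by positivity) fun v => ?_
    rw [_root_.sub_apply, fderiv_apply_eq_grad, fderiv_apply_eq_grad,
      ← sub_dotProduct, mul_assoc]
    refine (abs_dotProduct_le _ _).trans ?_
    rw [Metric.mem_ball, dist_eq_norm] at hx
    have := hg n x hx
    gcongr
  have := (convex_ball θ (min δ₁ δ₂)).norm_image_sub_le_of_norm_fderiv_le' hdiff hbound
    (Metric.mem_ball_self (lt_min hδ₁ hδ₂)) (y := t) (by rwa [Metric.mem_ball, dist_eq_norm])
  rwa [fderiv_apply_eq_grad] at this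

variable {n : α → ℕ} {t : α → ι → ℝ} {σ r : α → ℝ} {σ₀ : ℝ} {g u : ι → ℝ}

/-- Delta method for a sequence of functions with equicontinuous gradients, normalized by `σ`. -/
lemma tendsto_delta_method (hU : IsOpen U) (hθ : θ ∈ U) (hρ : ∀ n, ContDiffOn ℝ 1 (ρ n) U)
    (hequi : EquicontinuousAt (fun n => grad (ρ n)) θ) (ht : Tendsto t F (𝓝 θ))
    (hσ₀ : 0 < σ₀) (hσ : ∀ᶠ q in F, σ₀ ≤ σ q)
    (hr : Tendsto (fun q => r q • (t q - θ)) F (𝓝 u))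
    (hg : Tendsto (fun q => (σ q)⁻¹ • grad (ρ (n q)) θ) F (𝓝 g)) :
    Tendsto (fun q => (σ q)⁻¹ • grad (ρ (n q)) (t q)) F (𝓝 g) ∧
    Tendsto (fun q => (σ q)⁻¹ * (r q * (ρ (n q) (t q) - ρ (n q) θ))) F (𝓝 (g ⬝ᵥ u)) := by
  have hnear : ∀ δ > 0, ∀ᶠ q in F, ‖t q - θ‖ < δ := fun δ hδ => by
    filter_upwards [ht.eventually (Metric.ball_mem_nhds θ hδ)] with q hq
    rwa [dist_eq_norm] at hq
  have hinv : ∀ᶠ q in F, |(σ q)⁻¹| ≤ σ₀⁻¹ := by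
    filter_upwards [hσ] with q hq
    rw [abs_of_pos (inv_pos.2 (hσ₀.trans_le hq))]
    exact inv_anti₀ hσ₀ hq
  constructor
  · have h0 : Tendsto (fun q => (σ q)⁻¹ • (grad (ρ (n q)) (t q) - grad (ρ (n q)) θ)) F (𝓝 0) := by
      rw [Metric.tendsto_nhds]
      intro ε hε
      obtain ⟨δ, hδ, happ⟩ := exists_linear_approx hU hθ hρ hequi (ε := ε * σ₀ / 2) (by positivity)
      filter_upwards [hnear δ hδ, hinv] with q hq hi
      rw [dist_zero_right, norm_smul, Real.norm_eq_abs]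
      calc |(σ q)⁻¹| * ‖grad (ρ (n q)) (t q) - grad (ρ (n q)) θ‖ ≤ σ₀⁻¹ * (ε * σ₀ / 2) :=
            mul_le_mul hi (happ (n q) (t q) hq).1 (norm_nonneg _) (by positivity)
        _ = ε / 2 := by field_simp
        _ < ε := half_lt_self hε
    have := h0.add hg
    rw [zero_add] at this
    refine this.congr fun q => ?_
    rw [smul_sub, sub_add_cancel]
  · have hlin : Tendsto (fun q => ((σ q)⁻¹ • grad (ρ (n q)) θ) ⬝ᵥ (r q • (t q - θ))) F
        (𝓝 (g ⬝ᵥ u)) := tendsto_dotProduct hg hr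
    have hbd : ∀ᶠ q in F, ‖r q • (t q - θ)‖ ≤ ‖u‖ + 1 :=
      (hr.norm.eventually (gt_mem_nhds (lt_add_one ‖u‖))).mono fun _ h => le_of_lt h
    set C : ℝ := σ₀⁻¹ * (Fintype.card ι * (‖u‖ + 1)) + 1 with hC
    have hC0 : 0 < C := by positivity
    have h0 : Tendsto (fun q => (σ q)⁻¹ * (r q * (ρ (n q) (t q) - ρ (n q) θ)) -
        ((σ q)⁻¹ • grad (ρ (n q)) θ) ⬝ᵥ (r q • (t q - θ))) F (𝓝 0) := by
      rw [Metric.tendsto_nhds]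
      intro ε hε
      obtain ⟨δ, hδ, happ⟩ := exists_linear_approx hU hθ hρ hequi (ε := ε / C) (by positivity)
      filter_upwards [hnear δ hδ, hinv, hbd] with q hq hi hb
      have e : (σ q)⁻¹ * (r q * (ρ (n q) (t q) - ρ (n q) θ)) -
          ((σ q)⁻¹ • grad (ρ (n q)) θ) ⬝ᵥ (r q • (t q - θ)) =
          (σ q)⁻¹ * (r q * (ρ (n q) (t q) - ρ (n q) θ - grad (ρ (n q)) θ ⬝ᵥ (t q - θ))) := by
        rw [smul_dotProduct, dotProduct_smul, smul_eq_mul, smul_eq_mul]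
        ring
      rw [dist_zero_right, Real.norm_eq_abs, e, abs_mul, abs_mul]
      rw [norm_smul, Real.norm_eq_abs] at hb
      have h1 : |r q| * |ρ (n q) (t q) - ρ (n q) θ - grad (ρ (n q)) θ ⬝ᵥ (t q - θ)| ≤
          Fintype.card ι * (ε / C) * (‖u‖ + 1) :=
        calc _ ≤ |r q| * (Fintype.card ι * (ε / C) * ‖t q - θ‖) :=
              mul_le_mul_of_nonneg_left (happ (n q) (t q) hq).2 (abs_nonneg _)
          _ = Fintype.card ι * (ε / C) * (|r q| * ‖t q - θ‖) := by ring
          _ ≤ _ := mul_le_mul_of_nonneg_left hb (by positivity)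
      calc _ ≤ σ₀⁻¹ * (Fintype.card ι * (ε / C) * (‖u‖ + 1)) :=
            mul_le_mul hi h1 (by positivity) (by positivity)
        _ = (C - 1) * (ε / C) := by rw [hC]; ring
        _ < C * (ε / C) := by gcongr; linarith
        _ = ε := by field_simp
    have := h0.add hlin
    rw [zero_add] at this
    exact this.congr fun q => sub_add_cancel _ _

end Rho

namespace SurveyGLM

variable {p : ℕ} {Ω : Type*} [MeasurableSpace Ω] {P : Measure Ω} {D : SurveyGLM p Ω P}
  {M : Finset (Fin (p + 1))}

/-! ### Slacks and slopes of the sample constraints -/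

lemma aRho_mulVec (ρ : (Act M → ℝ) → ℝ) (z : Unit ⊕ (Slope M ⊕ Inact M) → ℝ) :
    D.aRho M ρ *ᵥ z = Sum.elim (fun _ => -D.signRho M ρ * z (Sum.inl ()))
      (Sum.elim (fun j => -(D.signM M (slopeIncl M j) * z (Sum.inr (Sum.inl j))))
        (Sum.elim (fun j => z (Sum.inr (Sum.inr j))) (fun j => -z (Sum.inr (Sum.inr j))))) := by
  ext j
  rcases j with j | j | j | j <;>
    simp [aRho, aMat, mulVec, dotProduct, diagonal_apply, one_apply]

/-- On the selection event the slacks are the distances of the estimates from zero and of the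
inactive scores from the penalty level. -/
lemma bRho_sub_aRho_mulVec_zRho {n : ℕ} {ω : Ω} {l : ℝ} (ρ : (Act M → ℝ) → ℝ) {tM : Act M → ℝ}
    (hsc : D.scoreM n ω M tM = l • D.signM M) :
    D.bRho n ω M l ρ tM - D.aRho M ρ *ᵥ D.zRho n ω M ρ tM =
      Sum.elim (fun _ => D.signRho M ρ * (√(n : ℝ) * ρ tM))
        (Sum.elim (fun j => D.signM M (slopeIncl M j) * (√(n : ℝ) * tM (slopeIncl M j)))
          (Sum.elim (fun j => √(n : ℝ) * (l - D.scoreN n ω M tM j))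
            (fun j => √(n : ℝ) * (l + D.scoreN n ω M tM j)))) := by
  have hA : D.aRho M ρ *ᵥ D.zRho n ω M ρ tM = Sum.elim
      (fun _ => -D.signRho M ρ * (√(n : ℝ) * D.rhoTilde n ω M ρ tM))
      (Sum.elim (fun j => -(D.signM M (slopeIncl M j) *
          (√(n : ℝ) * D.oneStep n ω M tM (slopeIncl M j))))
        (Sum.elim (fun j => √(n : ℝ) * D.scoreTilde n ω M tM j)
          (fun j => -(√(n : ℝ) * D.scoreTilde n ω M tM j)))) := by
    ext j
    rw [aRho_mulVec]
    rcases j with j | j | j | j <;> rfl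
  rw [hA]
  ext j
  rcases j with j | j | j | j
  · simp only [bRho, Pi.sub_apply, Sum.elim_inl, rhoTilde, hsc]
    ring
  · simp only [bRho, bVec, Pi.sub_apply, Sum.elim_inl, Sum.elim_inr, oneStep, hsc, Pi.smul_apply,
      Pi.add_apply, smul_eq_mul]
    ring
  · simp only [bRho, bVec, Pi.sub_apply, Sum.elim_inl, Sum.elim_inr, scoreTilde, hsc,
      Pi.smul_apply, smul_eq_mul, mulVec_smul]
    ring
  · simp only [bRho, bVec, Pi.sub_apply, Sum.elim_inr, scoreTilde, hsc, Pi.smul_apply, smul_eq_mul,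
      mulVec_smul]
    ring

lemma sigmaRho_mulVec_eRho (n : ℕ) (ω : Ω) (ρ : (Act M → ℝ) → ℝ) (tM : Act M → ℝ) :
    D.sigmaRho n ω M ρ tM *ᵥ eRho M = Sum.elim
      (fun _ => grad ρ tM ⬝ᵥ (D.sandwich n ω M tM *ᵥ grad ρ tM)) (D.sigmaRhoRow n ω M ρ tM) := by
  ext j
  rw [eRho, mulVec_single_one]
  rcases j with j | j <;> rfl

lemma eRho_dotProduct_sigmaRho (n : ℕ) (ω : Ω) (ρ : (Act M → ℝ) → ℝ) (tM : Act M → ℝ) :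
    eRho M ⬝ᵥ (D.sigmaRho n ω M ρ tM *ᵥ eRho M) =
      grad ρ tM ⬝ᵥ (D.sandwich n ω M tM *ᵥ grad ρ tM) := by
  rw [sigmaRho_mulVec_eRho, eRho, single_dotProduct, one_mul]
  rfl

lemma eRho_dotProduct_zRho (n : ℕ) (ω : Ω) (ρ : (Act M → ℝ) → ℝ) (tM : Act M → ℝ) :
    eRho M ⬝ᵥ D.zRho n ω M ρ tM = √(n : ℝ) * D.rhoTilde n ω M ρ tM := by
  rw [eRho, single_dotProduct, one_mul]
  rfl

lemma aRho_mulVec_polyC (n : ℕ) (ω : Ω) (ρ : (Act M → ℝ) → ℝ) (tM : Act M → ℝ) {v : ℝ}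
    (hv : grad ρ tM ⬝ᵥ (D.sandwich n ω M tM *ᵥ grad ρ tM) = v) (hv0 : v ≠ 0) :
    D.aRho M ρ *ᵥ polyC (D.sigmaRho n ω M ρ tM) (eRho M) = Sum.elim (fun _ => -D.signRho M ρ)
      (Sum.elim (fun j => -(D.signM M (slopeIncl M j) *
          (v⁻¹ * D.sigmaRhoRow n ω M ρ tM (Sum.inl j))))
        (Sum.elim (fun j => v⁻¹ * D.sigmaRhoRow n ω M ρ tM (Sum.inr j))
          (fun j => -(v⁻¹ * D.sigmaRhoRow n ω M ρ tM (Sum.inr j))))) := by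
  rw [polyC, eRho_dotProduct_sigmaRho, sigmaRho_mulVec_eRho, hv]
  ext j
  rw [aRho_mulVec]
  rcases j with j | j | j | j <;> simp [hv0]

end SurveyGLM

namespace SurveyGLM

variable {p : ℕ} {Ω : Type*} [MeasurableSpace Ω] {P : Measure Ω} {D : SurveyGLM p Ω P}
  {Cl Cu ll lu η L₀ : ℝ} {M : Finset (Fin (p + 1))}

/-! ### Limit of the pivot on the selection event -/

/-- Limits of the parameter functions, normalized by a scale `σ` of their estimates: the gradient
tends to `g`, the sign is eventually `s`, and the normalized distance from zero tends to `τ`. -/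
structure IsRhoLimit (D : SurveyGLM p Ω P) (ρ : ℕ → (Act M → ℝ) → ℝ) (𝒰 : Filter ℕ) (σ : ℕ → ℝ)
    (g : Act M → ℝ) (s : ℝ) (τ : EReal) : Prop where
  scale : ∃ σ₀ > 0, ∀ᶠ n in 𝒰, σ₀ ≤ σ n
  grad : Tendsto (fun n => (σ n)⁻¹ • grad (ρ n) (D.thetaM0 M)) 𝒰 (𝓝 g)
  sign : ∀ᶠ n in 𝒰, D.signRho M (ρ n) = s
  rate : Tendsto (fun n : ℕ => (((σ n)⁻¹ * (√(n : ℝ) * |ρ n (D.thetaM0 M)|) : ℝ) : EReal)) 𝒰 (𝓝 τ)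
  sign_eq : s = 1 ∨ s = -1

lemma sign_eq_iff {s x : ℝ} (hs : s = 1 ∨ s = -1) : Real.sign x = s ↔ 0 < s * x := by
  rcases lt_trichotomy x 0 with h | h | h
  · rw [Real.sign_of_neg h]
    rcases hs with rfl | rfl
    · simp only [one_mul, not_lt.2 h.le, iff_false]; norm_num
    · simpa using h
  · subst h
    rw [Real.sign_zero]
    rcases hs with rfl | rfl <;> simp
  · rw [Real.sign_of_pos h]
    rcases hs with rfl | rfl
    · simpa using h
    · simp only [neg_mul, one_mul, neg_pos, not_lt.2 h.le, iff_false]; norm_num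

variable {lam : ℕ → ℝ} {th : ℕ → Ω → (Fin (p + 1) → ℝ)} {w : Fin (p + 1) → ℝ}
  {H I : Matrix (Fin (p + 1)) (Fin (p + 1)) ℝ} {c : ℝ}
  {ρ : ℕ → (Act M → ℝ) → ℝ} {σ : ℕ → ℝ} {g : Act M → ℝ} {s : ℝ} {τ : EReal}
  {U : Set (Act M → ℝ)}

lemma isActiveSolution_limEst (hH : H.PosDef) :
    D.IsActiveSolution M w H c (pad M (limEst M H (D.signM M) c w)) where
  inactive j hj := by simp [pad, hj]
  active j := by
    have h : restr M (H *ᵥ pad M (limEst M H (D.signM M) c w)) = restr M w - c • D.signM M := by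
      rw [mulVec_pad_active, mulVec_limEst hH]
    have hj := congrFun h j
    simp only [restr, Pi.sub_apply, Pi.smul_apply, smul_eq_mul] at hj
    rw [Pi.sub_apply, hj]
    ring

lemma pad_restr_of_selected {θ : Fin (p + 1) → ℝ} (h : selected θ = M) :
    pad M (restr M θ) = θ := by
  refine pad_restr M fun j hj => ?_
  rw [← h] at hj
  simp only [selected, Finset.mem_filter, Finset.mem_univ, true_and, not_or, not_not] at hj
  exact hj.2

lemma tendsto_inv_matrix {α ι : Type*} [Fintype ι] [DecidableEq ι] {F : Filter α}
    {A : α → Matrix ι ι ℝ} {A₀ : Matrix ι ι ℝ} (hA : Tendsto A F (𝓝 A₀)) (h : IsUnit A₀) :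
    Tendsto (fun q => (A q)⁻¹) F (𝓝 A₀⁻¹) := by
  have hdet : A₀.det ≠ 0 := ((isUnit_iff_isUnit_det _).1 h).ne_zero
  have hc : ContinuousAt Ring.inverse A₀.det := by
    have e : (Ring.inverse : ℝ → ℝ) = fun x => x⁻¹ := Ring.inverse_eq_inv'
    rw [e]
    exact continuousAt_inv₀ hdet
  exact (continuousAt_matrix_inv A₀ hc).tendsto.comp hA

lemma tendsto_submatrix {α ι κ κ' : Type*} {F : Filter α} {A : α → Matrix ι ι ℝ}
    {A₀ : Matrix ι ι ℝ} (hA : Tendsto A F (𝓝 A₀)) (e : κ → ι) (f : κ' → ι) :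
    Tendsto (fun q => (A q).submatrix e f) F (𝓝 (A₀.submatrix e f)) :=
  tendsto_pi_nhds.2 fun i => tendsto_pi_nhds.2 fun j =>
    tendsto_pi_nhds.1 (tendsto_pi_nhds.1 hA (e i)) (f j)

section Blocks

variable {α : Type*} {F : Filter α} {A B : α → Matrix (Fin (p + 1)) (Fin (p + 1)) ℝ}

lemma tendsto_inv_blockMM (hH : H.PosDef) (hA : Tendsto A F (𝓝 H)) :
    Tendsto (fun q => (blockMM M (A q))⁻¹) F (𝓝 (blockMM M H)⁻¹) :=
  tendsto_inv_matrix (tendsto_submatrix hA _ _) (blockMM_posDef M hH).isUnit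

lemma tendsto_sandwichOf (hH : H.PosDef) (hA : Tendsto A F (𝓝 H)) (hB : Tendsto B F (𝓝 I)) :
    Tendsto (fun q => sandwichOf M (A q) (B q)) F (𝓝 (sandwichOf M H I)) :=
  tendsto_matrix_mul (tendsto_matrix_mul (tendsto_inv_blockMM hH hA) (tendsto_submatrix hB _ _))
    (tendsto_inv_blockMM hH hA)

lemma tendsto_crossOf (hH : H.PosDef) (hA : Tendsto A F (𝓝 H)) (hB : Tendsto B F (𝓝 I)) :
    Tendsto (fun q => crossOf M (A q) (B q)) F (𝓝 (crossOf M H I)) :=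
  (tendsto_matrix_mul (tendsto_inv_blockMM hH hA) (tendsto_submatrix hB _ _)).sub
    (tendsto_matrix_mul (tendsto_sandwichOf hH hA hB) (tendsto_submatrix hA _ _))

end Blocks

/-- The local limit model along `𝒱`: local limits of the data and of the parameter functions, with
positive definite limiting Hessian `H` and information `I`. -/
structure IsLocalModel (D : SurveyGLM p Ω P) (Cu ll : ℝ) (lam : ℕ → ℝ)
    (th : ℕ → Ω → (Fin (p + 1) → ℝ)) (𝒱 : Ultrafilter (ℕ × Ω)) (w : Fin (p + 1) → ℝ)
    (H I : Matrix (Fin (p + 1)) (Fin (p + 1)) ℝ) (c : ℝ) (M : Finset (Fin (p + 1)))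
    (ρ : ℕ → (Act M → ℝ) → ℝ) (σ : ℕ → ℝ) (g : Act M → ℝ) (s : ℝ) (τ : EReal)
    (U : Set (Act M → ℝ)) : Prop where
  seq : D.IsLocalSeq Cu lam th 𝒱 w H I c
  posDef_hess : H.PosDef
  hess_ge : ∀ x : Fin (p + 1) → ℝ, ll * (x ⬝ᵥ x) ≤ x ⬝ᵥ H *ᵥ x
  posDef_info : I.PosDef
  zero_mem : 0 ∈ M
  active_ne : ∀ j ∈ M, j ≠ 0 → D.θ₀ j ≠ 0
  inactive_eq : ∀ j, j ∉ M → D.θ₀ j = 0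
  rho : D.IsRhoLimit ρ ((𝒱 : Filter (ℕ × Ω)).map Prod.fst) σ g s τ
  rate_nonneg : 0 ≤ τ
  unit : g ⬝ᵥ sandwichOf M H I *ᵥ g = 1
  isOpen : IsOpen U
  mem : D.thetaM0 M ∈ U
  contDiff : ∀ n, ContDiffOn ℝ 1 (ρ n) U
  equi : EquicontinuousAt (fun n => SurveyLasso.grad (ρ n)) (D.thetaM0 M)

/-- The local limit model on the event that the Lasso selects `M`. -/
structure IsSelectedLimit (D : SurveyGLM p Ω P) (Cu ll : ℝ) (lam : ℕ → ℝ)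
    (th : ℕ → Ω → (Fin (p + 1) → ℝ)) (𝒱 : Ultrafilter (ℕ × Ω)) (w : Fin (p + 1) → ℝ)
    (H I : Matrix (Fin (p + 1)) (Fin (p + 1)) ℝ) (c : ℝ) (M : Finset (Fin (p + 1)))
    (ρ : ℕ → (Act M → ℝ) → ℝ) (σ : ℕ → ℝ) (g : Act M → ℝ) (s : ℝ) (τ : EReal)
    (U : Set (Act M → ℝ)) : Prop extends D.IsLocalModel Cu ll lam th 𝒱 w H I c M ρ σ g s τ U where
  lim : D.IsLocalLimit lam th 𝒱 w H I (pad M (limEst M H (D.signM M) c w))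
  selected_eq : ∀ᶠ q in (𝒱 : Filter (ℕ × Ω)), selected (th q.1 q.2) = M

namespace IsSelectedLimit

variable {𝒱 : Ultrafilter (ℕ × Ω)}

lemma tendsto_restr (h : D.IsSelectedLimit Cu ll lam th 𝒱 w H I c M ρ σ g s τ U) :
    Tendsto (fun q : ℕ × Ω => restr M (th q.1 q.2)) 𝒱 (𝓝 (D.thetaM0 M)) :=
  tendsto_pi_nhds.2 fun j => tendsto_pi_nhds.1 h.lim.consistent j.1

lemma tendsto_sqrt_restr (h : D.IsSelectedLimit Cu ll lam th 𝒱 w H I c M ρ σ g s τ U) :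
    Tendsto (fun q : ℕ × Ω => √(q.1 : ℝ) • (restr M (th q.1 q.2) - D.thetaM0 M)) 𝒱
      (𝓝 (limEst M H (D.signM M) c w)) := by
  have h1 := h.lim.est
  have h2 : Tendsto (fun q : ℕ × Ω => restr M (√(q.1 : ℝ) • (th q.1 q.2 - D.θ₀))) 𝒱
      (𝓝 (restr M (pad M (limEst M H (D.signM M) c w)))) :=
    tendsto_pi_nhds.2 fun j => tendsto_pi_nhds.1 h1 j.1
  rw [restr_pad] at h2
  exact h2

lemma eventually_scale_pos (h : D.IsSelectedLimit Cu ll lam th 𝒱 w H I c M ρ σ g s τ U) :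
    ∀ᶠ q in (𝒱 : Filter (ℕ × Ω)), 0 < σ q.1 := by
  obtain ⟨σ₀, hσ₀, hσ⟩ := h.rho.scale
  filter_upwards [eventually_map.1 hσ] with q hq
  exact hσ₀.trans_le hq

lemma delta_method (h : D.IsSelectedLimit Cu ll lam th 𝒱 w H I c M ρ σ g s τ U) :
    Tendsto (fun q : ℕ × Ω => (σ q.1)⁻¹ • SurveyLasso.grad (ρ q.1) (restr M (th q.1 q.2))) 𝒱 (𝓝 g) ∧
    Tendsto (fun q : ℕ × Ω => (σ q.1)⁻¹ * (√(q.1 : ℝ) *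
      (ρ q.1 (restr M (th q.1 q.2)) - ρ q.1 (D.thetaM0 M)))) 𝒱
      (𝓝 (g ⬝ᵥ limEst M H (D.signM M) c w)) := by
  obtain ⟨σ₀, hσ₀, hσ⟩ := h.rho.scale
  exact tendsto_delta_method (n := fun q : ℕ × Ω => q.1) (σ := fun q : ℕ × Ω => σ q.1)
    (r := fun q : ℕ × Ω => √(q.1 : ℝ)) h.isOpen h.mem h.contDiff h.equi h.tendsto_restr hσ₀
    (eventually_map.1 hσ) h.tendsto_sqrt_restr (tendsto_map'_iff.1 h.rho.grad)

/-- The slack of the sign constraint on `ρ`. -/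
lemma tendsto_slack_rho (h : D.IsSelectedLimit Cu ll lam th 𝒱 w H I c M ρ σ g s τ U) :
    Tendsto (fun q : ℕ × Ω => (((σ q.1)⁻¹ * (D.signRho M (ρ q.1) *
      (√(q.1 : ℝ) * ρ q.1 (restr M (th q.1 q.2)))) : ℝ) : EReal)) 𝒱
      (𝓝 (rowSlack (limConst M H (D.signM M) g c s τ) (limNormal M H g s) (Sum.inl ()) w)) := by
  rw [rowSlack_rho h.posDef_hess]
  have h1 := tendsto_map'_iff.1 h.rho.rate
  have h2 : Tendsto (fun q : ℕ × Ω => ((s * ((σ q.1)⁻¹ * (√(q.1 : ℝ) *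
      (ρ q.1 (restr M (th q.1 q.2)) - ρ q.1 (D.thetaM0 M)))) : ℝ) : EReal)) 𝒱
      (𝓝 ((s * (g ⬝ᵥ limEst M H (D.signM M) c w) : ℝ) : EReal)) :=
    (continuous_coe_real_ereal.tendsto _).comp (h.delta_method.2.const_mul s)
  have hadd : ContinuousAt (fun p : EReal × EReal => p.1 + p.2)
      (τ, ((s * (g ⬝ᵥ limEst M H (D.signM M) c w) : ℝ) : EReal)) :=
    EReal.continuousAt_add (Or.inr (EReal.coe_ne_bot _)) (Or.inr (EReal.coe_ne_top _))
  refine (hadd.tendsto.comp (h1.prodMk_nhds h2)).congr' ?_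
  filter_upwards [eventually_map.1 h.rho.sign] with q hq
  simp only [Function.comp_apply]
  rw [← EReal.coe_add, hq]
  congr 1
  have habs : |ρ q.1 (D.thetaM0 M)| = s * ρ q.1 (D.thetaM0 M) := by
    have h3 := (sign_eq_iff h.rho.sign_eq).1 hq
    rcases h.rho.sign_eq with rfl | rfl
    · rw [one_mul] at h3 ⊢; exact abs_of_pos h3
    · have : ρ q.1 (D.thetaM0 M) < 0 := by linarith
      rw [abs_of_neg this]; ring
  rw [habs]
  ring

lemma eventually_pad (h : D.IsSelectedLimit Cu ll lam th 𝒱 w H I c M ρ σ g s τ U) :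
    ∀ᶠ q in (𝒱 : Filter (ℕ × Ω)), pad M (restr M (th q.1 q.2)) = th q.1 q.2 :=
  h.selected_eq.mono fun _ hq => pad_restr_of_selected hq

/-- Eventually the active scores equal the penalty level times the signs of the slopes. -/
lemma eventually_scoreM (h : D.IsSelectedLimit Cu ll lam th 𝒱 w H I c M ρ σ g s τ U) :
    ∀ᶠ q in (𝒱 : Filter (ℕ × Ω)),
    D.scoreM q.1 q.2 M (restr M (th q.1 q.2)) = lam q.1 • D.signM M := by
  filter_upwards [h.eventually_pad, h.lim.eventually_score_eq h.active_ne] with q h1 h2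
  ext j
  rw [scoreM, h1, h2 j]; rfl

/-- Limits of all slacks; the slacks of the sign constraints on the slopes diverge. -/
lemma tendsto_slack (h : D.IsSelectedLimit Cu ll lam th 𝒱 w H I c M ρ σ g s τ U)
    (j : Unit ⊕ (Slope M ⊕ (Inact M ⊕ Inact M))) :
    Tendsto (fun q : ℕ × Ω => (((Sum.elim (fun _ => (σ q.1)⁻¹) (fun _ => 1) j : ℝ) *
      (D.bRho q.1 q.2 M (lam q.1) (ρ q.1) (restr M (th q.1 q.2)) j -
        (D.aRho M (ρ q.1) *ᵥ D.zRho q.1 q.2 M (ρ q.1) (restr M (th q.1 q.2))) j) : ℝ) : EReal)) 𝒱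
      (𝓝 (rowSlack (limConst M H (D.signM M) g c s τ) (limNormal M H g s) j w)) := by
  have hslack : ∀ᶠ q in (𝒱 : Filter (ℕ × Ω)),
      D.bRho q.1 q.2 M (lam q.1) (ρ q.1) (restr M (th q.1 q.2)) j -
        (D.aRho M (ρ q.1) *ᵥ D.zRho q.1 q.2 M (ρ q.1) (restr M (th q.1 q.2))) j =
      Sum.elim (fun _ => D.signRho M (ρ q.1) * (√(q.1 : ℝ) * ρ q.1 (restr M (th q.1 q.2))))
        (Sum.elim (fun j => D.signM M (slopeIncl M j) * (√(q.1 : ℝ) * th q.1 q.2 j.1))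
          (Sum.elim (fun j => √(q.1 : ℝ) * (lam q.1 - D.score q.1 q.2 (th q.1 q.2) j.1))
            (fun j => √(q.1 : ℝ) * (lam q.1 + D.score q.1 q.2 (th q.1 q.2) j.1)))) j := by
    filter_upwards [h.eventually_scoreM, h.eventually_pad] with q h1 h2
    rw [← Pi.sub_apply, bRho_sub_aRho_mulVec_zRho (ρ q.1) h1]
    simp only [scoreN, h2]
    rfl
  rcases j with j | j | j | j
  · refine h.tendsto_slack_rho.congr' ?_
    filter_upwards [hslack] with q hq
    rw [hq]; rfl
  · rw [rowSlack_slope]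
    have h1 : Tendsto (fun q : ℕ × Ω => D.signM M (slopeIncl M j) * (√(q.1 : ℝ) * th q.1 q.2 j.1))
        𝒱 atTop := by
      have hne := h.active_ne j.1 j.2.1 j.2.2
      have h2 : Tendsto (fun q : ℕ × Ω => D.signM M (slopeIncl M j) * th q.1 q.2 j.1) 𝒱
          (𝓝 (D.signM M (slopeIncl M j) * D.θ₀ j.1)) :=
        (tendsto_pi_nhds.1 h.lim.consistent j.1).const_mul _
      have hpos : 0 < D.signM M (slopeIncl M j) * D.θ₀ j.1 := by
        have e : D.signM M (slopeIncl M j) = Real.sign (D.θ₀ j.1) := if_neg j.2.2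
        rw [e]
        exact (sign_eq_iff ((Real.sign_apply_eq_of_ne_zero _ hne).symm)).1 rfl
      refine (h.seq.tendsto_sqrt.atTop_mul_pos hpos h2).congr fun q => ?_
      ring
    refine (EReal.tendsto_coe_nhds_top_iff.2 h1).congr' ?_
    filter_upwards [hslack] with q hq
    rw [hq]; simp
  · rw [rowSlack_upper]
    refine ((continuous_coe_real_ereal.tendsto _).comp
      (h.seq.pen.sub (h.lim.tendsto_score_apply j.1))).congr' ?_
    filter_upwards [hslack] with q hq
    rw [hq]; simp [mul_sub]
  · rw [rowSlack_lower]
    refine ((continuous_coe_real_ereal.tendsto _).comp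
      (h.seq.pen.add (h.lim.tendsto_score_apply j.1))).congr' ?_
    filter_upwards [hslack] with q hq
    rw [hq]; simp [mul_add]

end IsSelectedLimit

end SurveyGLM

namespace SurveyGLM

variable {p : ℕ} {Ω : Type*} [MeasurableSpace Ω] {P : Measure Ω} {D : SurveyGLM p Ω P}
  {Cl Cu ll lu η L₀ : ℝ} {M : Finset (Fin (p + 1))}
  {lam : ℕ → ℝ} {th : ℕ → Ω → (Fin (p + 1) → ℝ)} {w : Fin (p + 1) → ℝ}
  {H I : Matrix (Fin (p + 1)) (Fin (p + 1)) ℝ} {c : ℝ}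
  {ρ : ℕ → (Act M → ℝ) → ℝ} {σ : ℕ → ℝ} {g : Act M → ℝ} {s : ℝ} {τ : EReal}
  {U : Set (Act M → ℝ)}

/-- Estimated variance of the one-step estimator of `ρ`. -/
noncomputable def rhoVar (D : SurveyGLM p Ω P) (n : ℕ) (ω : Ω) (M : Finset (Fin (p + 1)))
    (ρ : (Act M → ℝ) → ℝ) (tM : Act M → ℝ) : ℝ :=
  grad ρ tM ⬝ᵥ (D.sandwich n ω M tM *ᵥ grad ρ tM)

namespace IsSelectedLimit

variable {𝒱 : Ultrafilter (ℕ × Ω)}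

lemma tendsto_sandwich (h : D.IsSelectedLimit Cu ll lam th 𝒱 w H I c M ρ σ g s τ U) :
    Tendsto (fun q : ℕ × Ω => D.sandwich q.1 q.2 M (restr M (th q.1 q.2))) 𝒱
      (𝓝 (sandwichOf M H I)) := by
  refine (tendsto_sandwichOf h.posDef_hess h.lim.hess h.lim.info).congr' ?_
  filter_upwards [h.eventually_pad] with q hq
  have e : D.sandwich q.1 q.2 M (restr M (th q.1 q.2)) =
    sandwichOf M (D.hess q.1 q.2 (pad M (restr M (th q.1 q.2))))
      (D.info q.1 q.2 (pad M (restr M (th q.1 q.2)))) := rfl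
  rw [e, hq]

lemma tendsto_crossCov (h : D.IsSelectedLimit Cu ll lam th 𝒱 w H I c M ρ σ g s τ U) :
    Tendsto (fun q : ℕ × Ω => D.crossCov q.1 q.2 M (restr M (th q.1 q.2))) 𝒱
      (𝓝 (crossOf M H I)) := by
  refine (tendsto_crossOf h.posDef_hess h.lim.hess h.lim.info).congr' ?_
  filter_upwards [h.eventually_pad] with q hq
  have e : D.crossCov q.1 q.2 M (restr M (th q.1 q.2)) =
    crossOf M (D.hess q.1 q.2 (pad M (restr M (th q.1 q.2))))
      (D.info q.1 q.2 (pad M (restr M (th q.1 q.2)))) := rfl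
  rw [e, hq]

lemma tendsto_inv_hessMM (h : D.IsSelectedLimit Cu ll lam th 𝒱 w H I c M ρ σ g s τ U) :
    Tendsto (fun q : ℕ × Ω => (D.hessMM q.1 q.2 M (restr M (th q.1 q.2)))⁻¹) 𝒱
      (𝓝 (blockMM M H)⁻¹) := by
  refine (tendsto_inv_blockMM h.posDef_hess h.lim.hess).congr' ?_
  filter_upwards [h.eventually_pad] with q hq
  have e : D.hessMM q.1 q.2 M (restr M (th q.1 q.2)) =
    blockMM M (D.hess q.1 q.2 (pad M (restr M (th q.1 q.2)))) := rfl
  rw [e, hq]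

/-- The estimated standard deviation of `ρ̃` is asymptotically equivalent to the scale `σ`. -/
lemma tendsto_sqrt_rhoVar (h : D.IsSelectedLimit Cu ll lam th 𝒱 w H I c M ρ σ g s τ U) :
    Tendsto (fun q : ℕ × Ω =>
      (σ q.1)⁻¹ * √(D.rhoVar q.1 q.2 M (ρ q.1) (restr M (th q.1 q.2)))) 𝒱 (𝓝 1) := by
  have h1 := tendsto_dotProduct h.delta_method.1 (tendsto_mulVec h.tendsto_sandwich h.delta_method.1)
  rw [h.unit] at h1
  have h2 := (Real.continuous_sqrt.tendsto 1).comp h1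
  rw [Real.sqrt_one] at h2
  refine h2.congr' ?_
  filter_upwards [h.eventually_scale_pos] with q hq
  rw [Function.comp_apply, smul_dotProduct, mulVec_smul, dotProduct_smul, smul_eq_mul, smul_eq_mul,
    ← mul_assoc, Real.sqrt_mul (mul_self_nonneg _), Real.sqrt_mul_self (inv_pos.2 hq).le]
  rfl

lemma eventually_rhoVar_pos (h : D.IsSelectedLimit Cu ll lam th 𝒱 w H I c M ρ σ g s τ U) :
    ∀ᶠ q in (𝒱 : Filter (ℕ × Ω)), 0 < D.rhoVar q.1 q.2 M (ρ q.1) (restr M (th q.1 q.2)) := by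
  filter_upwards [h.tendsto_sqrt_rhoVar.eventually (lt_mem_nhds one_pos),
    h.eventually_scale_pos] with q hq hσ
  exact Real.sqrt_pos.1 ((mul_pos_iff_of_pos_left (inv_pos.2 hσ)).1 hq)

/-- The standardized one-step estimator. -/
lemma tendsto_standardized_rhoTilde (h : D.IsSelectedLimit Cu ll lam th 𝒱 w H I c M ρ σ g s τ U) :
    Tendsto (fun q : ℕ × Ω => (eRho M ⬝ᵥ D.zRho q.1 q.2 M (ρ q.1) (restr M (th q.1 q.2)) -
      √(q.1 : ℝ) * ρ q.1 (D.thetaM0 M)) /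
        √(D.rhoVar q.1 q.2 M (ρ q.1) (restr M (th q.1 q.2)))) 𝒱 (𝓝 (limDir M H g ⬝ᵥ w)) := by
  have hsc : Tendsto (fun q : ℕ × Ω => √(q.1 : ℝ) • D.scoreM q.1 q.2 M (restr M (th q.1 q.2))) 𝒱
      (𝓝 (c • D.signM M)) := by
    have : Tendsto (fun q : ℕ × Ω => (√(q.1 : ℝ) * lam q.1) • D.signM M) 𝒱
      (𝓝 (c • D.signM M)) := h.seq.pen.smul_const _
    refine this.congr' ?_
    filter_upwards [h.eventually_scoreM] with q hq
    rw [hq, smul_smul]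
  have h1 := (h.delta_method.2.add (tendsto_dotProduct h.delta_method.1
    (tendsto_mulVec h.tendsto_inv_hessMM hsc))).div h.tendsto_sqrt_rhoVar one_ne_zero
  rw [div_one, mulVec_smul, dotProduct_smul, smul_eq_mul, ← limDir_dotProduct h.posDef_hess] at h1
  refine h1.congr' ?_
  filter_upwards [h.eventually_scale_pos] with q hq
  rw [eRho_dotProduct_zRho, rhoTilde, Pi.div_apply, smul_dotProduct, mulVec_smul, dotProduct_smul,
    smul_eq_mul, smul_eq_mul, ← mul_add, mul_div_mul_left _ _ (inv_pos.2 hq).ne']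
  congr 1
  ring

lemma tendsto_sigmaRhoRow (h : D.IsSelectedLimit Cu ll lam th 𝒱 w H I c M ρ σ g s τ U)
    (k : Slope M ⊕ Inact M) :
    Tendsto (fun q : ℕ × Ω => √(D.rhoVar q.1 q.2 M (ρ q.1) (restr M (th q.1 q.2))) *
      ((D.rhoVar q.1 q.2 M (ρ q.1) (restr M (th q.1 q.2)))⁻¹ *
        D.sigmaRhoRow q.1 q.2 M (ρ q.1) (restr M (th q.1 q.2)) k)) 𝒱
      (𝓝 (Sum.elim (fun j => (g ᵥ* sandwichOf M H I) (slopeIncl M j)) (g ᵥ* crossOf M H I) k)) := by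
  have h1 : Tendsto (fun q : ℕ × Ω => (σ q.1)⁻¹ *
      D.sigmaRhoRow q.1 q.2 M (ρ q.1) (restr M (th q.1 q.2)) k) 𝒱
      (𝓝 (Sum.elim (fun j => (g ᵥ* sandwichOf M H I) (slopeIncl M j)) (g ᵥ* crossOf M H I) k)) := by
    rcases k with j | j
    · refine (tendsto_pi_nhds.1 (tendsto_vecMul h.delta_method.1 h.tendsto_sandwich)
        (slopeIncl M j)).congr fun q => ?_
      rw [smul_vecMul]; rfl
    · refine (tendsto_pi_nhds.1 (tendsto_vecMul h.delta_method.1 h.tendsto_crossCov)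
        j).congr fun q => ?_
      rw [smul_vecMul]; rfl
  have h2 := h1.div h.tendsto_sqrt_rhoVar one_ne_zero
  rw [div_one] at h2
  refine h2.congr' ?_
  filter_upwards [h.eventually_scale_pos, h.eventually_rhoVar_pos] with q hσ hv
  rw [Pi.div_apply, mul_div_mul_left _ _ (inv_pos.2 hσ).ne', div_eq_inv_mul, ← mul_assoc]
  congr 1
  have hs := (Real.sqrt_pos.2 hv).ne'
  conv_rhs => rw [← Real.mul_self_sqrt hv.le]
  rw [Real.sqrt_mul_self (Real.sqrt_nonneg _)]
  field_simp

/-- Limits of the slopes of the sample constraints. -/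
lemma tendsto_slope (h : D.IsSelectedLimit Cu ll lam th 𝒱 w H I c M ρ σ g s τ U)
    (j : Unit ⊕ (Slope M ⊕ (Inact M ⊕ Inact M))) :
    Tendsto (fun q : ℕ × Ω => (Sum.elim (fun _ => (σ q.1)⁻¹) (fun _ => 1) j : ℝ) *
      (√(D.rhoVar q.1 q.2 M (ρ q.1) (restr M (th q.1 q.2))) *
        (D.aRho M (ρ q.1) *ᵥ polyC (D.sigmaRho q.1 q.2 M (ρ q.1) (restr M (th q.1 q.2)))
          (eRho M)) j)) 𝒱
      (𝓝 (Sum.elim (fun _ => -s)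
        (Sum.elim (fun j => -(D.signM M (slopeIncl M j) *
            (g ᵥ* sandwichOf M H I) (slopeIncl M j)))
          (Sum.elim (g ᵥ* crossOf M H I) (fun j => -(g ᵥ* crossOf M H I) j))) j)) := by
  have hA : ∀ᶠ q in (𝒱 : Filter (ℕ × Ω)), D.aRho M (ρ q.1) *ᵥ
      polyC (D.sigmaRho q.1 q.2 M (ρ q.1) (restr M (th q.1 q.2))) (eRho M) = _ :=
    h.eventually_rhoVar_pos.mono fun q hq => aRho_mulVec_polyC q.1 q.2 (ρ q.1) _ rfl hq.ne'
  rcases j with j | j | j | j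
  · have h1 := h.tendsto_sqrt_rhoVar.mul_const (-s)
    rw [one_mul] at h1
    refine h1.congr' ?_
    filter_upwards [hA, eventually_map.1 h.rho.sign] with q hq hs
    rw [hq]
    simp only [Sum.elim_inl, hs, mul_assoc]
  · refine ((h.tendsto_sigmaRhoRow (Sum.inl j)).const_mul
      (-D.signM M (slopeIncl M j))).congr' ?_ |>.trans_eq ?_
    · filter_upwards [hA] with q hq
      rw [hq]
      simp only [Sum.elim_inl, Sum.elim_inr, one_mul, rhoVar]
      ring
    · simp only [Sum.elim_inl, Sum.elim_inr, neg_mul]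
  · refine (h.tendsto_sigmaRhoRow (Sum.inr j)).congr' ?_
    filter_upwards [hA] with q hq
    rw [hq]
    simp only [Sum.elim_inl, Sum.elim_inr, one_mul, rhoVar]
  · refine (h.tendsto_sigmaRhoRow (Sum.inr j)).neg.congr' ?_
    filter_upwards [hA] with q hq
    rw [hq]
    simp only [Sum.elim_inr, one_mul, rhoVar, mul_neg]

/-- At points of the limiting region the pivot converges, and the one-step estimator eventually lies
strictly between the truncation limits. -/
theorem tendsto_pivot (h : D.IsSelectedLimit Cu ll lam th 𝒱 w H I c M ρ σ g s τ U)
    (hw : w ∈ rowRegion (limConst M H (D.signM M) g c s τ) (limNormal M H g s)) :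
    Tendsto (fun q : ℕ × Ω => D.pivot q.1 q.2 M (lam q.1) (ρ q.1) (restr M (th q.1 q.2))
      (ρ q.1 (D.thetaM0 M))) 𝒱
      (𝓝 (rowPivot I (limDir M H g) (limConst M H (D.signM M) g c s τ) (limNormal M H g s) w)) ∧
    ∀ᶠ q in (𝒱 : Filter (ℕ × Ω)), ∀ ζ ∈ Set.Ioo (0 : ℝ) 1,
      (ρ q.1 (D.thetaM0 M) ∈ D.ci q.1 q.2 M ζ (lam q.1) (ρ q.1) (restr M (th q.1 q.2)) ↔
        D.pivot q.1 q.2 M (lam q.1) (ρ q.1) (restr M (th q.1 q.2)) (ρ q.1 (D.thetaM0 M)) ∈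
          Set.Icc (ζ / 2) (1 - ζ / 2)) := by
  have hde : ∀ j, rowSlack (limConst M H (D.signM M) g c s τ) (limNormal M H g s) j w = ⊤ ∨
      Sum.elim (fun _ => -s) (Sum.elim (fun j => -(D.signM M (slopeIncl M j) *
            (g ᵥ* sandwichOf M H I) (slopeIncl M j)))
          (Sum.elim (g ᵥ* crossOf M H I) (fun j => -(g ᵥ* crossOf M H I) j))) j =
        rowSlope I (limDir M H g) (limNormal M H g s) j := by
    intro j
    rcases j with j | j | j | j
    · refine Or.inr ?_
      simp only [rowSlope, limNormal, Sum.elim_inl]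
      rw [smul_dotProduct, limDir_variance h.posDef_hess, h.unit, smul_eq_mul, mul_one]
    · exact Or.inl (rowSlack_slope w j)
    · refine Or.inr ?_
      simp only [rowSlope, limNormal, Sum.elim_inl, Sum.elim_inr]
      rw [neg_dotProduct, neg_neg, limResid_covariance h.posDef_hess h.posDef_info]
    · refine Or.inr ?_
      simp only [rowSlope, limNormal, Sum.elim_inr]
      rw [limResid_covariance h.posDef_hess h.posDef_info]
  obtain ⟨hlim, hbtw⟩ := tendsto_truncStd_rowPivot (limConst_ne_bot h.rate_nonneg) hw
    h.tendsto_standardized_rhoTilde h.tendsto_slack h.tendsto_slope hde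
  have hstd : ∀ᶠ q in (𝒱 : Filter (ℕ × Ω)), 0 < q.1 ∧
      0 < D.rhoVar q.1 q.2 M (ρ q.1) (restr M (th q.1 q.2)) ∧
      ∀ j : Unit ⊕ (Slope M ⊕ (Inact M ⊕ Inact M)),
        0 < (Sum.elim (fun _ => (σ q.1)⁻¹) (fun _ => 1) j : ℝ) := by
    filter_upwards [h.eventually_scale_pos, h.eventually_rhoVar_pos,
      h.seq.fst.eventually_gt_atTop 0] with q hσ hv hn
    refine ⟨hn, hv, fun j => ?_⟩
    rcases j with j | j
    · exact inv_pos.2 hσ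
    · exact one_pos
  constructor
  · refine hlim.congr' ?_
    filter_upwards [hstd] with q ⟨_, hv, hk⟩
    have hsq := Real.sqrt_pos.2 hv
    simp only [pivot]
    rw [truncCDF_eq_truncStd, eRho_dotProduct_sigmaRho,
      show grad (ρ q.1) (restr M (th q.1 q.2)) ⬝ᵥ (D.sandwich q.1 q.2 M (restr M (th q.1 q.2)) *ᵥ
        grad (ρ q.1) (restr M (th q.1 q.2))) =
          D.rhoVar q.1 q.2 M (ρ q.1) (restr M (th q.1 q.2)) from rfl,
      standardize_vMinus _ _ _ _ _ hsq hk, standardize_vPlus _ _ _ _ _ hsq hk]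
  · filter_upwards [hstd, hbtw] with q ⟨hn, hv, hk⟩ ⟨h1, h2⟩ ζ hζ
    have hsq := Real.sqrt_pos.2 hv
    rw [← standardize_vMinus _ _ _ _ _ hsq hk, EReal.coe_div, EReal.coe_sub] at h1
    rw [← standardize_vPlus _ _ _ _ _ hsq hk, EReal.coe_div, EReal.coe_sub] at h2
    have hmono := ereal_standardize_strictMono (√(q.1 : ℝ) * ρ q.1 (D.thetaM0 M)) hsq
    have h1' := hmono.lt_iff_lt.1 h1
    have h2' := hmono.lt_iff_lt.1 h2
    have hv' : 0 < eRho M ⬝ᵥ (D.sigmaRho q.1 q.2 M (ρ q.1) (restr M (th q.1 q.2)) *ᵥ eRho M) := by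
      rw [eRho_dotProduct_sigmaRho]; exact hv
    exact exists_quantiles_iff hv' (Real.sqrt_pos.2 (by exact_mod_cast hn)) h1' h2' hζ _

end IsSelectedLimit

end SurveyGLM

namespace SurveyGLM

variable {p : ℕ} {Ω : Type*} [MeasurableSpace Ω] {P : Measure Ω} {D : SurveyGLM p Ω P}
  {Cl Cu ll lu η L₀ : ℝ} {M : Finset (Fin (p + 1))}
  {lam : ℕ → ℝ} {th : ℕ → Ω → (Fin (p + 1) → ℝ)} {w : Fin (p + 1) → ℝ}
  {H I : Matrix (Fin (p + 1)) (Fin (p + 1)) ℝ} {c : ℝ}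
  {ρ : ℕ → (Act M → ℝ) → ℝ} {σ : ℕ → ℝ} {g : Act M → ℝ} {s : ℝ} {τ : EReal}
  {U : Set (Act M → ℝ)}

/-! ### Limits of the selection event and of coverage -/

namespace IsLocalModel

variable {𝒱 : Ultrafilter (ℕ × Ω)}

lemma isSelectedLimit (h : D.IsLocalModel Cu ll lam th 𝒱 w H I c M ρ σ g s τ U)
    (hD : D.AsyValid Cl Cu ll lu η L₀)
    (hsel : ∀ᶠ q in (𝒱 : Filter (ℕ × Ω)), selected (th q.1 q.2) = M) :
    D.IsSelectedLimit Cu ll lam th 𝒱 w H I c M ρ σ g s τ U := by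
  obtain ⟨u, hu⟩ := h.seq.exists_isLocalLimit hD h.hess_ge
  have := hu.eq_of_selected h.seq hD.ll_pos h.hess_ge h.active_ne h.inactive_eq
    (isActiveSolution_limEst h.posDef_hess) hsel
  exact { h with lim := this ▸ hu, selected_eq := hsel }

/-- At points of the limiting region the conditioning event eventually occurs. -/
lemma eventually_mem_condEvent (h : D.IsLocalModel Cu ll lam th 𝒱 w H I c M ρ σ g s τ U)
    (hD : D.AsyValid Cl Cu ll lu η L₀)
    (hw : w ∈ rowRegion (limConst M H (D.signM M) g c s τ) (limNormal M H g s)) :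
    D.IsSelectedLimit Cu ll lam th 𝒱 w H I c M ρ σ g s τ U ∧
      ∀ᶠ q in (𝒱 : Filter (ℕ × Ω)), q.2 ∈ D.condEvent M (ρ q.1) (th q.1) := by
  obtain ⟨u, hu⟩ := h.seq.exists_isLocalLimit hD h.hess_ge
  have hsel := hu.eventually_selected_eq h.seq hD.ll_pos h.hess_ge h.zero_mem h.active_ne
    h.inactive_eq (isActiveSolution_limEst h.posDef_hess) fun j hj => by
      have h1 := hw (Sum.inr (Sum.inr (Sum.inl ⟨j, hj⟩)))
      have h2 := hw (Sum.inr (Sum.inr (Sum.inr ⟨j, hj⟩)))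
      rw [rowSlack_upper] at h1
      rw [rowSlack_lower] at h2
      rw [abs_lt]
      have h1' := EReal.coe_pos.1 h1
      have h2' := EReal.coe_pos.1 h2
      constructor <;> linarith
  have hS := h.isSelectedLimit hD hsel
  refine ⟨hS, ?_⟩
  have hsgn : ∀ᶠ q in (𝒱 : Filter (ℕ × Ω)), ∀ j : Slope M,
      Real.sign (th q.1 q.2 j.1) = Real.sign (D.θ₀ j.1) :=
    eventually_all.2 fun j =>
      (hu.eventually_sign_eq (h.active_ne j.1 j.2.1 j.2.2)).mono fun q hq => hq.2
  filter_upwards [hsel, hsgn, hS.tendsto_slack_rho.eventually (lt_mem_nhds (hw (Sum.inl ()))),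
    eventually_map.1 h.rho.sign, hS.eventually_scale_pos,
    h.seq.tendsto_sqrt.eventually_gt_atTop 0] with q h1 h2 h3 h4 h5 h6
  refine ⟨h1, h2, ?_⟩
  rw [h4] at h3 ⊢
  rw [sign_eq_iff h.rho.sign_eq]
  have h3' := (mul_pos_iff_of_pos_left (inv_pos.2 h5)).1 (EReal.coe_pos.1 h3)
  rw [mul_left_comm] at h3'
  exact (mul_pos_iff_of_pos_left h6).1 h3'

/-- Off the closure of the limiting region the conditioning event eventually fails. -/
lemma eventually_notMem_condEvent (h : D.IsLocalModel Cu ll lam th 𝒱 w H I c M ρ σ g s τ U)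
    (hD : D.AsyValid Cl Cu ll lu η L₀)
    (hne : ∀ j, rowSlack (limConst M H (D.signM M) g c s τ) (limNormal M H g s) j w ≠ 0)
    (hw : w ∉ rowRegion (limConst M H (D.signM M) g c s τ) (limNormal M H g s)) :
    ∀ᶠ q in (𝒱 : Filter (ℕ × Ω)), q.2 ∉ D.condEvent M (ρ q.1) (th q.1) := by
  refine Ultrafilter.eventually_not.2 fun hE => hw fun j => lt_of_le_of_ne ?_ (hne j).symm
  have hS := h.isSelectedLimit hD (hE.mono fun q hq => hq.1)
  have hle : ∀ j : Inact M, |(w - H *ᵥ pad M (limEst M H (D.signM M) c w)) j.1| ≤ c := fun j => by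
    refine le_of_tendsto_of_tendsto (hS.lim.tendsto_score_apply j.1).abs h.seq.pen ?_
    filter_upwards [hS.lim.score_le] with q hq
    rw [abs_mul, abs_of_nonneg (Real.sqrt_nonneg _)]
    exact mul_le_mul_of_nonneg_left (hq j.1 fun h0 => j.2 (h0 ▸ h.zero_mem)) (Real.sqrt_nonneg _)
  rcases j with j | j | j | j
  · refine ge_of_tendsto hS.tendsto_slack_rho ?_
    filter_upwards [hE, eventually_map.1 h.rho.sign, hS.eventually_scale_pos] with q hq h4 h5
    have h6 := hq.2.2
    rw [h4] at h6 ⊢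
    have h7 := (sign_eq_iff h.rho.sign_eq).1 h6
    refine EReal.coe_nonneg.2 (mul_nonneg (inv_pos.2 h5).le ?_)
    rw [mul_left_comm]
    exact mul_nonneg (Real.sqrt_nonneg _) h7.le
  · rw [rowSlack_slope]; exact le_top
  · rw [rowSlack_upper]
    exact EReal.coe_nonneg.2 (by linarith [(abs_le.1 (hle j)).2])
  · rw [rowSlack_lower]
    exact EReal.coe_nonneg.2 (by linarith [(abs_le.1 (hle j)).1])

/-- Coverage is decided in the limit by the pivot of the limiting Gaussian model. -/
lemma eventually_mem_ci_iff (h : D.IsLocalModel Cu ll lam th 𝒱 w H I c M ρ σ g s τ U)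
    (hD : D.AsyValid Cl Cu ll lu η L₀)
    (hw : w ∈ rowRegion (limConst M H (D.signM M) g c s τ) (limNormal M H g s)) {ζ : ℝ}
    (hζ : ζ ∈ Set.Ioo (0 : ℝ) 1) {pv : ℝ}
    (hpv : pv = rowPivot I (limDir M H g) (limConst M H (D.signM M) g c s τ) (limNormal M H g s) w)
    (h1 : pv ≠ ζ / 2) (h2 : pv ≠ 1 - ζ / 2) :
    ∀ᶠ q in (𝒱 : Filter (ℕ × Ω)),
      (ρ q.1 (D.thetaM0 M) ∈ D.ci q.1 q.2 M ζ (lam q.1) (ρ q.1) (restr M (th q.1 q.2)) ↔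
        pv ∈ Set.Ioo (ζ / 2) (1 - ζ / 2)) := by
  obtain ⟨hS, -⟩ := h.eventually_mem_condEvent hD hw
  obtain ⟨hlim, hiff⟩ := hS.tendsto_pivot hw
  rw [← hpv] at hlim
  have hlo : ∀ᶠ q in (𝒱 : Filter (ℕ × Ω)), (ζ / 2 ≤ D.pivot q.1 q.2 M (lam q.1) (ρ q.1)
      (restr M (th q.1 q.2)) (ρ q.1 (D.thetaM0 M)) ↔ ζ / 2 < pv) := by
    rcases lt_or_gt_of_ne h1 with hlt | hlt
    · filter_upwards [hlim.eventually (gt_mem_nhds hlt)] with q hq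
      exact iff_of_false (not_le.2 hq) (not_lt.2 hlt.le)
    · filter_upwards [hlim.eventually (lt_mem_nhds hlt)] with q hq
      exact iff_of_true (le_of_lt hq) hlt
  have hhi : ∀ᶠ q in (𝒱 : Filter (ℕ × Ω)), (D.pivot q.1 q.2 M (lam q.1) (ρ q.1)
      (restr M (th q.1 q.2)) (ρ q.1 (D.thetaM0 M)) ≤ 1 - ζ / 2 ↔ pv < 1 - ζ / 2) := by
    rcases lt_or_gt_of_ne h2 with hlt | hlt
    · filter_upwards [hlim.eventually (gt_mem_nhds hlt)] with q hq
      exact iff_of_true (le_of_lt hq) hlt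
    · filter_upwards [hlim.eventually (lt_mem_nhds hlt)] with q hq
      exact iff_of_false (not_le.2 hq) (not_lt.2 hlt.le)
  filter_upwards [hiff, hlo, hhi] with q h3 h4 h5
  rw [h3 ζ hζ, Set.mem_Icc, h4, h5, Set.mem_Ioo]

end IsLocalModel

/-! ### Subsequential limits of the penalty level and of the parameter function -/

/-- Along an ultrafilter the normalized parameter functions converge, even if their gradients are
unbounded. -/
lemma exists_isRhoLimit {K : Matrix (Act M) (Act M) ℝ} (hK : K.PosDef) {𝒰 : Ultrafilter ℕ}
    (hgrad : ∃ l : ℝ, 0 < l ∧ ∀ n,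
      l < SurveyLasso.grad (ρ n) (D.thetaM0 M) ⬝ᵥ SurveyLasso.grad (ρ n) (D.thetaM0 M))
    (hne : ∀ n, ρ n (D.thetaM0 M) ≠ 0) :
    ∃ σ g s τ, D.IsRhoLimit ρ (𝒰 : Filter ℕ) σ g s τ ∧ 0 ≤ τ ∧ g ⬝ᵥ K *ᵥ g = 1 := by
  obtain ⟨l, hl, hgrad⟩ := hgrad
  set d : ℕ → Act M → ℝ := fun n => SurveyLasso.grad (ρ n) (D.thetaM0 M) with hd
  set N : ℝ := Fintype.card (Act M) + 1 with hN
  have hN0 : 0 < N := by positivity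
  have hnorm : ∀ n, √(l / N) ≤ ‖d n‖ := by
    intro n
    refine Real.sqrt_le_iff.2 ⟨norm_nonneg _, ?_⟩
    rw [div_le_iff₀ hN0]
    have h1 := (le_abs_self _).trans (abs_dotProduct_le (d n) (d n))
    have h2 := hgrad n
    have h3 : 0 ≤ ‖d n‖ * ‖d n‖ := by positivity
    rw [hN]
    nlinarith
  have hm : 0 < √(l / N) := Real.sqrt_pos.2 (by positivity)
  have hpos : ∀ n, 0 < ‖d n‖ := fun n => hm.trans_le (hnorm n)
  -- the gradients may be unbounded in `n`, but their directions lie on the compact unit sphere; the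
  -- scale `σ n = k ‖d n‖` gives the limit `e / k` unit variance
  obtain ⟨e, he1, he⟩ := (isCompact_sphere (0 : Act M → ℝ) 1).ultrafilter_le_nhds
    (𝒰.map fun n => ‖d n‖⁻¹ • d n) (by
      rw [le_principal_iff]
      refine Eventually.of_forall (f := (𝒰 : Filter ℕ)) fun n => ?_
      rw [mem_sphere_zero_iff_norm, norm_smul, norm_inv, norm_norm, inv_mul_cancel₀ (hpos n).ne'])
  have he' : Tendsto (fun n => ‖d n‖⁻¹ • d n) 𝒰 (𝓝 e) := he
  have he0 : e ≠ 0 := by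
    intro h0
    rw [h0, mem_sphere_zero_iff_norm, norm_zero] at he1
    exact zero_ne_one he1
  have hKe : 0 < e ⬝ᵥ K *ᵥ e := by
    have := hK.dotProduct_mulVec_pos he0
    rwa [star_trivial] at this
  set k : ℝ := √(e ⬝ᵥ K *ᵥ e) with hk
  have hk0 : 0 < k := Real.sqrt_pos.2 hKe
  have hσpos : ∀ n, 0 < k * ‖d n‖ := fun n => mul_pos hk0 (hpos n)
  obtain ⟨s, hs, hsign⟩ : ∃ s : ℝ, (s = 1 ∨ s = -1) ∧
      ∀ᶠ n in (𝒰 : Filter ℕ), D.signRho M (ρ n) = s := by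
    have hor : ∀ᶠ n in (𝒰 : Filter ℕ), D.signRho M (ρ n) = -1 ∨ D.signRho M (ρ n) = 1 :=
      Eventually.of_forall fun n => Real.sign_apply_eq_of_ne_zero _ (hne n)
    rcases Ultrafilter.eventually_or.1 hor with h | h
    · exact ⟨-1, Or.inr rfl, h⟩
    · exact ⟨1, Or.inl rfl, h⟩
  set R : ℕ → EReal := fun n =>
    (((k * ‖d n‖)⁻¹ * (√(n : ℝ) * |ρ n (D.thetaM0 M)|) : ℝ) : EReal) with hR
  obtain ⟨τ, -, hτ⟩ := isCompact_univ.ultrafilter_le_nhds (𝒰.map R) (by simp)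
  have hτ' : Tendsto R 𝒰 (𝓝 τ) := hτ
  refine ⟨fun n => k * ‖d n‖, k⁻¹ • e, s, τ, ⟨⟨k * √(l / N), mul_pos hk0 hm, ?_⟩, ?_, hsign, hτ',
    hs⟩, ?_, ?_⟩
  · exact Eventually.of_forall fun n => mul_le_mul_of_nonneg_left (hnorm n) hk0.le
  · refine (he'.const_smul k⁻¹).congr fun n => ?_
    rw [smul_smul, ← mul_inv]
  · refine ge_of_tendsto hτ' (Eventually.of_forall fun n => EReal.coe_nonneg.2 ?_)
    have := hσpos n
    positivity
  · rw [smul_dotProduct, mulVec_smul, dotProduct_smul, smul_eq_mul, smul_eq_mul, ← mul_assoc,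
      ← mul_inv, hk, Real.mul_self_sqrt hKe.le, inv_mul_cancel₀ hKe.ne']

/-- The limit of the penalty level is positive as soon as there is an inactive regressor. -/
lemma exists_pen_limit {C : ℕ → ℝ} {𝒰 : Ultrafilter ℕ} (h𝒰 : (𝒰 : Filter ℕ) ≤ atTop)
    (hlam : ∀ n, 1 ≤ n → lam n = C n * (n : ℝ) ^ (-(1 / 2) : ℝ))
    (hCpos : ∀ n, 0 < C n) (hCbdd : ∃ K : ℝ, ∀ n, C n ≤ K)
    (hClow : M = Finset.univ ∨ ∃ k : ℝ, 0 < k ∧ ∀ n, k ≤ C n) :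
    ∃ c, Tendsto (fun n : ℕ => √(n : ℝ) * lam n) 𝒰 (𝓝 c) ∧ ∀ _ : Inact M, 0 < c := by
  obtain ⟨K, hK⟩ := hCbdd
  obtain ⟨c, -, hc⟩ := (isCompact_Icc (a := 0) (b := K)).ultrafilter_le_nhds (𝒰.map C) (by
    rw [le_principal_iff]
    exact Eventually.of_forall (f := (𝒰 : Filter ℕ)) fun n => ⟨(hCpos n).le, hK n⟩)
  have hc' : Tendsto C 𝒰 (𝓝 c) := hc
  refine ⟨c, hc'.congr' ?_, fun j => ?_⟩
  · filter_upwards [h𝒰 (eventually_ge_atTop 1)] with n hn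
    have hn0 : (0 : ℝ) < n := by exact_mod_cast hn
    rw [hlam n hn, Real.rpow_neg hn0.le, ← Real.sqrt_eq_rpow, mul_left_comm,
      mul_inv_cancel₀ (Real.sqrt_pos.2 hn0).ne', mul_one]
  · rcases hClow with hM | ⟨k, hk, hkC⟩
    · exact absurd (hM ▸ Finset.mem_univ j.1) j.2
    · exact hk.trans_le (ge_of_tendsto hc' (Eventually.of_forall hkC))

/-! ### Measurability of the selection event -/

lemma measurable_real_sign : Measurable Real.sign := by
  unfold Real.sign
  exact Measurable.ite measurableSet_Iio measurable_const
    (Measurable.ite measurableSet_Ioi measurable_const measurable_const)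

lemma measurableSet_condEvent {ρ : (Act M → ℝ) → ℝ} (hρ : Measurable ρ)
    {th : Ω → (Fin (p + 1) → ℝ)} (hth : Measurable th) :
    MeasurableSet (D.condEvent M ρ th) := by
  have hj : ∀ j, Measurable fun ω => th ω j := fun j => (measurable_pi_apply j).comp hth
  refine MeasurableSet.inter ?_ (MeasurableSet.inter ?_ ?_)
  · have : {ω | selected (th ω) = M} = ⋂ j, {ω | (j = 0 ∨ th ω j ≠ 0) ↔ j ∈ M} := by
      ext ω
      simp [selected, Finset.ext_iff]
    change MeasurableSet {ω | selected (th ω) = M}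
    rw [this]
    refine MeasurableSet.iInter fun j => MeasurableSet.iff ?_ (MeasurableSet.const _)
    exact (MeasurableSet.const _).union ((hj j) (measurableSet_singleton (0 : ℝ)).compl)
  · have : {ω | ∀ j : Slope M, Real.sign (th ω j.1) = Real.sign (D.θ₀ j.1)} =
        ⋂ j : Slope M, {ω | Real.sign (th ω j.1) = Real.sign (D.θ₀ j.1)} := by
      ext ω; simp
    change MeasurableSet {ω | ∀ j : Slope M, Real.sign (th ω j.1) = Real.sign (D.θ₀ j.1)}
    rw [this]
    exact MeasurableSet.iInter fun j =>
      (measurable_real_sign.comp (hj j.1)) (measurableSet_singleton _)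
  · have hr : Measurable fun ω => restr M (th ω) := measurable_pi_lambda _ fun j => hj j.1
    exact (measurable_real_sign.comp (hρ.comp hr)) (measurableSet_singleton _)

end SurveyGLM

namespace SurveyGLM

variable {p : ℕ} {Ω : Type*} [MeasurableSpace Ω] {P : Measure Ω} [IsProbabilityMeasure P]
  {D : SurveyGLM p Ω P} {Cl Cu ll lu η L₀ : ℝ} {M : Finset (Fin (p + 1))}
  {lam : ℕ → ℝ} {th : ℕ → Ω → (Fin (p + 1) → ℝ)} {H I : Matrix (Fin (p + 1)) (Fin (p + 1)) ℝ}
  {c : ℝ} {ρ : ℕ → (Act M → ℝ) → ℝ} {σ : ℕ → ℝ} {g : Act M → ℝ} {s : ℝ} {τ : EReal}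
  {U : Set (Act M → ℝ)} {𝒰 : Ultrafilter ℕ} {ζ : ℝ}

/-! ### Limiting probabilities of selection and coverage -/

lemma IsRhoLimit.mono {F G : Filter ℕ} (h : D.IsRhoLimit ρ G σ g s τ) (hFG : F ≤ G) :
    D.IsRhoLimit ρ F σ g s τ where
  scale := h.scale.imp fun _ h1 => ⟨h1.1, hFG h1.2⟩
  grad := h.grad.mono_left hFG
  sign := hFG h.sign
  rate := h.rate.mono_left hFG
  sign_eq := h.sign_eq

/-- The sample points at which the boundedness conditions hold and the estimator minimizes the Lasso
objective whenever a minimizer exists. -/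
def regularSet (D : SurveyGLM p Ω P) (Cu : ℝ) (lam : ℕ → ℝ) (th : ℕ → Ω → (Fin (p + 1) → ℝ)) :
    Set Ω :=
  {ω | D.IsRegularPoint Cu ω ∧ ∀ n, (∃ θ, IsMinOn (D.lassoObj n (lam n) ω) Set.univ θ) →
    IsMinOn (D.lassoObj n (lam n) ω) Set.univ (th n ω)}

lemma AsyValid.regularSet_mem_ae (hD : D.AsyValid Cl Cu ll lu η L₀)
    (hth : ∀ n, D.IsLasso n (lam n) (th n)) : D.regularSet Cu lam th ∈ ae P := by
  filter_upwards [hD.ae_isRegularPoint, ae_all_iff.2 fun n => (hth n).2] with ω h1 h2 using ⟨h1, h2⟩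

/-- Limits along an ultrafilter `𝒰` of sample sizes: of the population moments, of the penalty level
and of the parameter functions. -/
structure IsLimitModel (D : SurveyGLM p Ω P) (ll : ℝ) (lam : ℕ → ℝ) (𝒰 : Ultrafilter ℕ)
    (H I : Matrix (Fin (p + 1)) (Fin (p + 1)) ℝ) (c : ℝ) (M : Finset (Fin (p + 1)))
    (ρ : ℕ → (Act M → ℝ) → ℝ) (σ : ℕ → ℝ) (g : Act M → ℝ) (s : ℝ) (τ : EReal)
    (U : Set (Act M → ℝ)) : Prop where
  le_atTop : (𝒰 : Filter ℕ) ≤ atTop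
  popHess : Tendsto D.popHess atTop (𝓝 H)
  popInfo : Tendsto D.popInfo atTop (𝓝 I)
  posDef_hess : H.PosDef
  hess_ge : ∀ x : Fin (p + 1) → ℝ, ll * (x ⬝ᵥ x) ≤ x ⬝ᵥ H *ᵥ x
  posDef_info : I.PosDef
  zero_mem : 0 ∈ M
  active_ne : ∀ j ∈ M, j ≠ 0 → D.θ₀ j ≠ 0
  inactive_eq : ∀ j, j ∉ M → D.θ₀ j = 0
  pen : Tendsto (fun n : ℕ => √(n : ℝ) * lam n) 𝒰 (𝓝 c)
  pen_pos : ∀ n, 1 ≤ n → 0 < lam n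
  rho : D.IsRhoLimit ρ (𝒰 : Filter ℕ) σ g s τ
  rate_nonneg : 0 ≤ τ
  unit : g ⬝ᵥ sandwichOf M H I *ᵥ g = 1
  isOpen : IsOpen U
  mem : D.thetaM0 M ∈ U
  contDiff : ∀ n, ContDiffOn ℝ 1 (ρ n) U
  equi : EquicontinuousAt (fun n => SurveyLasso.grad (ρ n)) (D.thetaM0 M)

namespace IsLimitModel

lemma isLocalModel (h : D.IsLimitModel ll lam 𝒰 H I c M ρ σ g s τ U) {w : Fin (p + 1) → ℝ}
    {𝒱 : Ultrafilter (ℕ × Ω)}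
    (h𝒱 : (𝒱 : Filter (ℕ × Ω)) ≤ localFilter (𝒰 : Filter ℕ) (D.regularSet Cu lam th)
      (fun n ω => √(n : ℝ) • D.score n ω D.θ₀) w D.momentStat
      (fun b => if b.1 then H b.2.1 b.2.2 else I b.2.1 b.2.2)) :
    D.IsLocalModel Cu ll lam th 𝒱 w H I c M ρ σ g s τ U := by
  have hprod := h𝒱.trans (inf_le_left)
  have hW := h𝒱.trans (inf_le_right.trans inf_le_left)
  have hY := h𝒱.trans (inf_le_right.trans inf_le_right)
  have hfst : Tendsto Prod.fst (𝒱 : Filter (ℕ × Ω)) 𝒰 := tendsto_fst.mono_left hprod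
  have hreg : ∀ᶠ q in (𝒱 : Filter (ℕ × Ω)), q.2 ∈ D.regularSet Cu lam th :=
    (tendsto_snd.mono_left hprod).eventually (mem_principal_self _)
  have hmom : Tendsto (fun q : ℕ × Ω => D.momentStat q.1 q.2) 𝒱
      (𝓝 (fun b => if b.1 then H b.2.1 b.2.2 else I b.2.1 b.2.2)) :=
    tendsto_iff_comap.2 hY
  refine { h with seq := ?_, rho := h.rho.mono hfst }
  refine
    { fst := hfst.mono_right h.le_atTop
      regular := hreg.mono fun q hq => hq.1
      lasso := hreg.mono fun q hq => hq.2 q.1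
      score := tendsto_iff_comap.2 hW
      hess := tendsto_pi_nhds.2 fun i => tendsto_pi_nhds.2 fun j => ?_
      info := tendsto_pi_nhds.2 fun i => tendsto_pi_nhds.2 fun j => ?_
      pen := h.pen.comp hfst
      pen_pos := (hfst.mono_right h.le_atTop).eventually
        ((eventually_ge_atTop 1).mono h.pen_pos) }
  · simpa [momentStat] using tendsto_pi_nhds.1 hmom (true, i, j)
  · simpa [momentStat] using tendsto_pi_nhds.1 hmom (false, i, j)

lemma sign_mul_self (h : D.IsLimitModel ll lam 𝒰 H I c M ρ σ g s τ U) : s * s = 1 := by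
  rcases h.rho.sign_eq with rfl | rfl <;> norm_num

/-- An event that, along every local limit, holds exactly when the limit of the rescaled score lies
in `A`, has asymptotically the probability that the limiting Gaussian law gives to `A`. -/
lemma tendsto_measure (h : D.IsLimitModel ll lam 𝒰 H I c M ρ σ g s τ U)
    (hD : D.AsyValid Cl Cu ll lu η L₀) (hth : ∀ n, D.IsLasso n (lam n) (th n))
    {A : Set (Fin (p + 1) → ℝ)} (hA : MeasurableSet A) {Ev : ℕ → Set Ω}
    (hEv : ∀ᵐ w ∂(gaussianPi I), ∀ 𝒱 : Ultrafilter (ℕ × Ω),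
      D.IsLocalModel Cu ll lam th 𝒱 w H I c M ρ σ g s τ U →
        (w ∈ A → ∀ᶠ q in (𝒱 : Filter (ℕ × Ω)), q.2 ∈ Ev q.1) ∧
        (w ∉ A → ∀ᶠ q in (𝒱 : Filter (ℕ × Ω)), q.2 ∉ Ev q.1)) :
    Tendsto (fun n => P (Ev n)) 𝒰 (𝓝 (gaussianPi I A)) := by
  refine tendsto_measure_of_local measurable_sqrt_smul_score
    (fun G hG => hD.gaussianPi_le_liminf_score h.posDef_info.posSemidef h.popInfo h.le_atTop hG)
    measurable_momentStat (hD.tendstoInProb_momentStat h.popHess h.popInfo h.le_atTop)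
    (hD.regularSet_mem_ae hth) hA ?_
  filter_upwards [hEv] with w hw
  exact ⟨fun hwA => Filter.mem_iff_ultrafilter.2 fun 𝒱 h𝒱 => (hw 𝒱 (h.isLocalModel h𝒱)).1 hwA,
    fun hwA => Filter.mem_iff_ultrafilter.2 fun 𝒱 h𝒱 => (hw 𝒱 (h.isLocalModel h𝒱)).2 hwA⟩

lemma tendsto_measure_condEvent (h : D.IsLimitModel ll lam 𝒰 H I c M ρ σ g s τ U)
    (hD : D.AsyValid Cl Cu ll lu η L₀) (hth : ∀ n, D.IsLasso n (lam n) (th n)) :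
    Tendsto (fun n => P (D.condEvent M (ρ n) (th n))) 𝒰 (𝓝 (gaussianPi I
      (rowRegion (limConst M H (D.signM M) g c s τ) (limNormal M H g s)))) := by
  refine h.tendsto_measure hD hth measurableSet_rowRegion ?_
  filter_upwards [ae_rowSlack_ne_zero (sg := D.signM M) (c := c) (τ := τ)
    h.posDef_hess h.posDef_info h.unit h.sign_mul_self] with w hw 𝒱 h𝒱
  exact ⟨fun hwA => (h𝒱.eventually_mem_condEvent hD hwA).2,
    fun hwA => h𝒱.eventually_notMem_condEvent hD hw hwA⟩

lemma limDir_unit (h : D.IsLimitModel ll lam 𝒰 H I c M ρ σ g s τ U) :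
    limDir M H g ⬝ᵥ I *ᵥ limDir M H g = 1 :=
  (limDir_variance h.posDef_hess).trans h.unit

lemma tendsto_measure_condEvent_inter_ci (h : D.IsLimitModel ll lam 𝒰 H I c M ρ σ g s τ U)
    (hD : D.AsyValid Cl Cu ll lu η L₀) (hth : ∀ n, D.IsLasso n (lam n) (th n))
    (hζ : ζ ∈ Set.Ioo (0 : ℝ) 1) :
    Tendsto (fun n => P (D.condEvent M (ρ n) (th n) ∩ {ω | ρ n (D.thetaM0 M) ∈
        D.ci n ω M ζ (lam n) (ρ n) (restr M (th n ω))})) 𝒰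
      (𝓝 (ENNReal.ofReal (1 - ζ) * gaussianPi I
        (rowRegion (limConst M H (D.signM M) g c s τ) (limNormal M H g s)))) := by
  have hα := fun j => limConst_ne_bot (M := M) (H := H) (sg := D.signM M) (g := g) (c := c) (s := s)
    h.rate_nonneg j
  have hIoo := gaussianPi_rowPivot_Ioo (β := limNormal M H g s) (s := ζ / 2) (t := 1 - ζ / 2)
    h.posDef_info.posSemidef h.limDir_unit hα (by linarith [hζ.1]) (by linarith [hζ.2])
    (by linarith [hζ.1])
  rw [show 1 - ζ / 2 - ζ / 2 = 1 - ζ by ring] at hIoo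
  rw [← hIoo]
  have hnull : ∀ t : ℝ, ∀ᵐ w ∂(gaussianPi I),
      w ∈ rowRegion (limConst M H (D.signM M) g c s τ) (limNormal M H g s) →
      rowPivot I (limDir M H g) (limConst M H (D.signM M) g c s τ) (limNormal M H g s) w ≠ t := by
    intro t
    rw [ae_iff]
    refine measure_mono_null (fun w hw => ?_) (gaussianPi_rowPivot_eq
      (β := limNormal M H g s) h.posDef_info.posSemidef
      h.limDir_unit hα t)
    simpa using hw
  refine h.tendsto_measure hD hth (measurableSet_rowRegion.inter
    (measurable_rowPivot measurableSet_Ioo)) ?_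
  filter_upwards [ae_rowSlack_ne_zero (sg := D.signM M) (c := c) (τ := τ)
    h.posDef_hess h.posDef_info h.unit h.sign_mul_self, hnull (ζ / 2), hnull (1 - ζ / 2)]
    with w hw h1 h2 𝒱 h𝒱
  refine ⟨fun hwA => ?_, fun hwA => ?_⟩
  · filter_upwards [(h𝒱.eventually_mem_condEvent hD hwA.1).2,
      h𝒱.eventually_mem_ci_iff hD hwA.1 hζ rfl (h1 hwA.1) (h2 hwA.1)] with q hq hci
    exact ⟨hq, hci.2 hwA.2⟩
  · by_cases hwR : w ∈ rowRegion (limConst M H (D.signM M) g c s τ) (limNormal M H g s)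
    · filter_upwards [h𝒱.eventually_mem_ci_iff hD hwR hζ rfl (h1 hwR) (h2 hwR)] with q hci hq
      exact hwA ⟨hwR, hci.1 hq.2⟩
    · filter_upwards [h𝒱.eventually_notMem_condEvent hD hw hwR] with q hq hq'
      exact hq hq'.1

/-- The conditional coverage probability tends to `1 - ζ`, the limit of the selection probability
being positive. -/
lemma tendsto_cond_ci (h : D.IsLimitModel ll lam 𝒰 H I c M ρ σ g s τ U)
    (hD : D.AsyValid Cl Cu ll lu η L₀) (hth : ∀ n, D.IsLasso n (lam n) (th n))
    (hρ : ∀ n, Measurable (ρ n)) (hc : ∀ _ : Inact M, 0 < c) (hζ : ζ ∈ Set.Ioo (0 : ℝ) 1) :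
    Tendsto (fun n : ℕ => (P[|D.condEvent M (ρ n) (th n)]).real {ω | ρ n (D.thetaM0 M) ∈
        D.ci n ω M ζ (lam n) (ρ n) (restr M (th n ω))}) 𝒰 (𝓝 (1 - ζ)) := by
  set R := rowRegion (limConst M H (D.signM M) g c s τ) (limNormal M H g s) with hR
  have hg : g ≠ 0 := by
    rintro rfl
    simpa using h.unit
  have hpos : 0 < gaussianPi I R := gaussianPi_pos_of_isOpen h.posDef_info
    (isOpen_rowRegion fun j => limConst_ne_bot h.rate_nonneg j)
    (rowRegion_nonempty h.posDef_hess hg h.sign_mul_self h.rate_nonneg hc)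
  have hfin : gaussianPi I R ≠ ⊤ := measure_ne_top _ _
  have hlim : Tendsto (fun n : ℕ => (P (D.condEvent M (ρ n) (th n)))⁻¹ *
      P (D.condEvent M (ρ n) (th n) ∩ {ω | ρ n (D.thetaM0 M) ∈
        D.ci n ω M ζ (lam n) (ρ n) (restr M (th n ω))})) 𝒰
      (𝓝 ((gaussianPi I R)⁻¹ * (ENNReal.ofReal (1 - ζ) * gaussianPi I R))) :=
    ENNReal.Tendsto.mul (tendsto_inv_iff.2 (h.tendsto_measure_condEvent hD hth))
      (Or.inl (ENNReal.inv_ne_zero.2 hfin)) (h.tendsto_measure_condEvent_inter_ci hD hth hζ)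
      (Or.inr (ENNReal.inv_ne_top.2 hpos.ne'))
  rw [mul_left_comm, ENNReal.inv_mul_cancel hpos.ne' hfin, mul_one] at hlim
  have hreal := (ENNReal.tendsto_toReal ENNReal.ofReal_ne_top).comp hlim
  rw [ENNReal.toReal_ofReal (by linarith [hζ.2])] at hreal
  refine hreal.congr fun n => ?_
  rw [measureReal_def, cond_apply (measurableSet_condEvent (hρ n) (hth n).1)]
  rfl

end IsLimitModel

end SurveyGLM

end SurveyLasso

theorem corollary1 {p : ℕ} {Ω : Type*} [MeasurableSpace Ω] {P : Measure Ω}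
    [IsProbabilityMeasure P]
    (D : SurveyLasso.SurveyGLM p Ω P)
    {Cl Cu ll lu η L₀ : ℝ} (hD : D.AsyValid Cl Cu ll lu η L₀)
    -- `H(θ₀)` and `I(θ₀)` converge to nonsingular matrices
    (Hlim Ilim : Matrix (Fin (p + 1)) (Fin (p + 1)) ℝ)
    (hH : Tendsto D.popHess atTop (𝓝 Hlim)) (hHns : IsUnit Hlim.det)
    (hI : Tendsto D.popInfo atTop (𝓝 Ilim)) (hIns : IsUnit Ilim.det)
    -- the model `M`: the constant and the regressors with nonzero true coefficient
    (M : Finset (Fin (p + 1))) (hM0 : 0 ∈ M)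
    (hMin : ∀ j ∈ M, j ≠ 0 → D.θ₀ j ≠ 0) (hMout : ∀ j, j ∉ M → D.θ₀ j = 0)
    -- the penalty level and the Lasso estimator
    (lam C : ℕ → ℝ) (hlam : ∀ n, 1 ≤ n → lam n = C n * (n : ℝ) ^ (-(1 / 2) : ℝ))
    (hCpos : ∀ n, 0 < C n) (hCbdd : ∃ K : ℝ, ∀ n, C n ≤ K)
    (hClow : M = Finset.univ ∨ ∃ k : ℝ, 0 < k ∧ ∀ n, k ≤ C n)
    (thetaHat : ℕ → Ω → (Fin (p + 1) → ℝ))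
    (hLasso : ∀ n, D.IsLasso n (lam n) (thetaHat n))
    -- the parameter function, which may depend on `n`
    (ρ : ℕ → (SurveyLasso.Act M → ℝ) → ℝ) (hρmeas : ∀ n, Measurable (ρ n))
    (U : Set (SurveyLasso.Act M → ℝ)) (hU : IsOpen U) (hUmem : D.thetaM0 M ∈ U)
    (hρC1 : ∀ n, ContDiffOn ℝ 1 (ρ n) U)
    (hρequi : EquicontinuousAt (fun n => SurveyLasso.grad (ρ n)) (D.thetaM0 M))
    (hρgrad : ∃ l : ℝ, 0 < l ∧ ∀ n,
      l < SurveyLasso.grad (ρ n) (D.thetaM0 M) ⬝ᵥ SurveyLasso.grad (ρ n) (D.thetaM0 M))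
    (hρne : ∀ n, ρ n (D.thetaM0 M) ≠ 0)
    (ζ : ℝ) (hζ : ζ ∈ Set.Ioo (0 : ℝ) 1) :
    liminf (fun n : ℕ =>
      (P[|D.condEvent M (ρ n) (thetaHat n)]).real
        {ω | ρ n (D.thetaM0 M) ∈
          D.ci n ω M ζ (lam n) (ρ n) (SurveyLasso.restr M (thetaHat n ω))}) atTop = 1 - ζ := by
  refine (tendsto_iff_ultrafilter _ _ _ |>.2 fun 𝒰 h𝒰 => ?_ : Tendsto _ _ _).liminf_eq
  obtain ⟨hHherm, hHge⟩ := SurveyLasso.SurveyGLM.dotProduct_mulVec_ge_of_tendsto hH hD.eig_hess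
  obtain ⟨hIherm, hIge⟩ := SurveyLasso.SurveyGLM.dotProduct_mulVec_ge_of_tendsto hI hD.eig_info
  have hHpos := SurveyLasso.SurveyGLM.posDef_of_dotProduct_ge hHherm hD.ll_pos hHge
  have hIpos := SurveyLasso.SurveyGLM.posDef_of_dotProduct_ge hIherm hD.ll_pos hIge
  obtain ⟨c, hpen, hc⟩ := SurveyLasso.SurveyGLM.exists_pen_limit h𝒰 hlam hCpos hCbdd hClow
  obtain ⟨σ, g, s, τ, hlim, hτ, hunit⟩ := SurveyLasso.SurveyGLM.exists_isRhoLimit (𝒰 := 𝒰)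
    (SurveyLasso.sandwichOf_posDef M hHpos hIpos) hρgrad hρne
  have hlam_pos : ∀ n, 1 ≤ n → 0 < lam n := fun n hn => by
    rw [hlam n hn]
    exact mul_pos (hCpos n) (Real.rpow_pos_of_pos (by exact_mod_cast hn) _)
  have hmodel : D.IsLimitModel ll lam 𝒰 Hlim Ilim c M ρ σ g s τ U :=
    ⟨h𝒰, hH, hI, hHpos, hHge, hIpos, hM0, hMin, hMout, hpen, hlam_pos, hlim, hτ, hunit, hU, hUmem,
      hρC1, hρequi⟩
  exact hmodel.tendsto_cond_ci hD hLasso hρmeas hc hζ
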